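/- **Conventions.** Let $\mathcal Z$ be an integral domain with fraction field $\mathcal Q$, let $\underline T=(T_1,\dots,T_k)$ and $\underline Y=(Y_1,\dots,Y_n)$ be tuples of indeterminates ($k\ge 0$, $n\ge 1$). A *half near UFD* is an integral domain in which every nonzero element has only finitely many prime divisors up to units; a *near UFD* is a half near UFD in which every nonzero nonunit has a prime divisor. A *primality type* is a set $\mathcal P$ of proper ideals of $\mathcal Z$; in particular ${\rm Spec}$ is the set of all prime ideals, and ${\rm Irred}$, ${\rm Prime}$, ${\rm Nonunit}$ are the sets of all principal ideals $\langle a\rangle$ with $a$ irreducible, $a$ a prime element, $a$ a nonzero nonunit, respectively. A proper ideal $\mathfrak p$ is a *fixed divisor* of $P\in\mathcal Z[\underline T,\underline Y]$ with respect to $\underline T$ if all coefficients of $P(\underline t,\underline Y)$ lie in $\mathfrak p$ for every $\underline t\in\mathcal Z^k$. A subset $H\subset\mathcal Z^k$ is *Zariski-dense* if no nonzero polynomial of $\mathcal Q[\underline T]$ vanishes on $H$. For $P_1,\dots,P_s\in\mathcal Z[\underline T,\underline Y]$ consider the conditions: - $({\rm Irred}/\mathcal Q(\underline T))$: each $P_i$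 is irreducible in $\mathcal Q(\underline T)[\underline Y]$; - $({\rm Prim}/\mathcal Q[\underline T])$: for each $i$, the coefficients in $\mathcal Q[\underline T]$ of $P_i$, viewed as a polynomial in $\underline Y$, have no nonunit common divisor in $\mathcal Q[\underline T]$; - $({\rm NoFixDiv}/\mathcal Z[\underline T])_{\mathcal P}$: the product $P_1\cdots P_s$ has no fixed divisor in $\mathcal P$ with respect to $\underline T$. $\mathcal Z$ is a *Schinzel ring with respect to $\mathcal P$* if, for all $k,n,s\ge 1$ and all $P_1,\dots,P_s\in\mathcal Z[\underline T,\underline Y]$ satisfying $({\rm Prim}/\mathcal Q[\underline T])$ and $({\rm NoFixDiv}/\mathcal Z[\underline T])_{\mathcal P}$, there are $\omega,\alpha\in\mathcal Z$, $\omega\ne 0$, such that for all but finitely many $t_1\in\omega\mathcal Z+\alpha$ the polynomials $P_i(t_1,\underline T',\underline Y)$, where $\underline T'=(T_2,\dots,T_k)$, satisfy $({\rm Prim}/\mathcal Q[\underline T'])$ and $({\rm NoFixDiv}/\mathcal Z[\underline T'])_{\mathcal P}$. $\mathcal Z$ is *integrally Hilbertian with respect to $\mathcal P$* if, for all $k,n,s\ge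 1$ and all $P_1,\dots,P_s\in\mathcal Z[\underline T,\underline Y]$ satisfying the three conditions, the set of all $\underline m\in\mathcal Z^k$ such that every $P_i(\underline m,\underline Y)$ is irreducible in $\mathcal Q[\underline Y]$ and $\prod_i P_i(\underline m,\underline Y)$ is nonzero modulo every ideal in $\mathcal P$ is Zariski-dense. $\mathcal Z$ is a *Hilbertian ring* if, for all $k,n,s\ge 1$ and all irreducible $P_1,\dots,P_s\in\mathcal Q[\underline T,\underline Y]$ of degree $\ge 1$ in $\underline Y$, there is a Zariski-dense subset $H\subset\mathcal Z^k$ such that $P_1(\underline t,\underline Y),\dots,P_s(\underline t,\underline Y)$ are irreducible in $\mathcal Q[\underline Y]$ for every $\underline t\in H$. It is *imperfect* if it has characteristic $p>0$ and $\mathcal Q\ne\mathcal Q^p$. **Theorem.** (a) Every Dedekind domain is a Schinzel ring with respect to each of ${\rm Spec}$, ${\rm Irred}$, ${\rm Prime}$ and ${\rm Nonunit}$. Every near UFD is a Schinzel ring with respect to each of ${\rm Irred}$, ${\rm Prime}$ and ${\rm Nonunit}$. Every half near UFD is a Schinzel ring with respect to ${\rm Prime}$. However, $\mathbb Z[\sqrt5]$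 is a half near UFD that is not a Schinzel ring with respect to ${\rm Irred}$, nor with respect to ${\rm Nonunit}$. (b) Let $\mathcal Z$ be a Hilbertian ring that is of characteristic $0$ or imperfect. If $\mathcal Z$ is a Dedekind domain, it is integrally Hilbertian with respect to each of ${\rm Spec}$, ${\rm Irred}$, ${\rm Prime}$ and ${\rm Nonunit}$. If $\mathcal Z$ is a near UFD, it is integrally Hilbertian with respect to each of ${\rm Irred}$, ${\rm Prime}$ and ${\rm Nonunit}$. If $\mathcal Z$ is a half near UFD, it is integrally Hilbertian with respect to ${\rm Prime}$. However, $\mathbb Z[\sqrt5]$ is a Hilbertian ring of characteristic $0$ and a half near UFD that is not integrally Hilbertian with respect to ${\rm Irred}$, nor with respect to ${\rm Nonunit}$. -/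

import Mathlib

namespace SchinzelRing

/-- The polynomial ring `Z[T₁,…,T_k][Y₁,…,Y_n]`: the inner variables `T` are the parameters,
the outer ones `Y` are the variables. -/
abbrev PolyTY (Z : Type*) [CommRing Z] (k n : ℕ) : Type _ :=
  MvPolynomial (Fin n) (MvPolynomial (Fin k) Z)

/-! ### Near UFDs -/

/-- A half near UFD: an integral domain in which every nonzero element has only finitely many
prime divisors up to units, i.e. only finitely many ideals `⟨p⟩` with `p` a prime divisor. -/
structure IsHalfNearUFD (Z : Type*) [CommRing Z] [IsDomain Z] : Prop where
  finite_prime_divisors : ∀ a : Z, a ≠ 0 →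
    {I : Ideal Z | ∃ p : Z, Prime p ∧ p ∣ a ∧ I = Ideal.span {p}}.Finite

/-- A near UFD: a half near UFD in which every nonzero nonunit has a prime divisor. -/
structure IsNearUFD (Z : Type*) [CommRing Z] [IsDomain Z] : Prop extends IsHalfNearUFD Z where
  exists_prime_divisor : ∀ a : Z, a ≠ 0 → ¬ IsUnit a → ∃ p : Z, Prime p ∧ p ∣ a

/-! ### Primality types (sets of proper ideals) -/

/-- All prime ideals (including the zero ideal). -/
def specType (Z : Type*) [CommRing Z] : Set (Ideal Z) :=
  {I | I.IsPrime}

/-- All principal ideals generated by an irreducible element. -/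
def irredType (Z : Type*) [CommRing Z] : Set (Ideal Z) :=
  {I | ∃ a : Z, Irreducible a ∧ I = Ideal.span {a}}

/-- All nonzero principal prime ideals, i.e. those generated by a prime element. -/
def primeType (Z : Type*) [CommRing Z] : Set (Ideal Z) :=
  {I | ∃ a : Z, Prime a ∧ I = Ideal.span {a}}

/-- All nonzero proper principal ideals. -/
def nonunitType (Z : Type*) [CommRing Z] : Set (Ideal Z) :=
  {I | ∃ a : Z, a ≠ 0 ∧ ¬ IsUnit a ∧ I = Ideal.span {a}}

/-! ### Specialization, divisors and fixed divisors -/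

/-- `P(t, Y)`, for `t ∈ Z^k`. -/
noncomputable def spec {Z : Type*} [CommRing Z] {k n : ℕ} (t : Fin k → Z) (P : PolyTY Z k n) :
    MvPolynomial (Fin n) Z :=
  MvPolynomial.map (MvPolynomial.eval t) P

/-- `P(t₁, T₂, …, T_{k+1}, Y)`, for `t₁ ∈ Z`; the remaining parameters are renumbered. -/
noncomputable def specFirst {Z : Type*} [CommRing Z] {k n : ℕ} (t₁ : Z)
    (P : PolyTY Z (k + 1) n) : PolyTY Z k n :=
  MvPolynomial.map
    (MvPolynomial.aeval
      (Fin.cons (MvPolynomial.C t₁) MvPolynomial.X : Fin (k + 1) → MvPolynomial (Fin k) Z) :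
      MvPolynomial (Fin (k + 1)) Z →ₐ[Z] MvPolynomial (Fin k) Z).toRingHom P

/-- `P(Y) ≡ 0` modulo the ideal `I`: all the coefficients of `P` are in `I`. -/
def IsZeroMod {Z : Type*} [CommRing Z] {n : ℕ} (I : Ideal Z) (P : MvPolynomial (Fin n) Z) : Prop :=
  ∀ d, P.coeff d ∈ I

/-- The proper ideal `I` is a fixed divisor of `P` with respect to `T`. -/
def IsFixedDivisor {Z : Type*} [CommRing Z] {k n : ℕ} (I : Ideal Z) (P : PolyTY Z k n) : Prop :=
  I ≠ ⊤ ∧ ∀ t : Fin k → Z, IsZeroMod I (spec t P)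

/-! ### The three conditions on a polynomial or a family of polynomials -/

/-- `P` is irreducible in `Q(T)[Y]`, where `Q` is the fraction field of `Z`. -/
def IrredOverQT {Z : Type*} [CommRing Z] {k n : ℕ} (P : PolyTY Z k n) : Prop :=
  Irreducible
    (MvPolynomial.map
      (algebraMap (MvPolynomial (Fin k) (FractionRing Z))
        (FractionRing (MvPolynomial (Fin k) (FractionRing Z))))
      (MvPolynomial.map (MvPolynomial.map (algebraMap Z (FractionRing Z))) P))

/-- `P` is primitive with respect to `Q[T]`: the coefficients in `Q[T]` of `P`, viewed as a
polynomial in `Y`, have no nonunit common divisor in `Q[T]`. -/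
def PrimOverQT {Z : Type*} [CommRing Z] {k n : ℕ} (P : PolyTY Z k n) : Prop :=
  ∀ r : MvPolynomial (Fin k) (FractionRing Z),
    (∀ d, r ∣ MvPolynomial.map (algebraMap Z (FractionRing Z)) (P.coeff d)) → IsUnit r

/-- The product `P₁ ⋯ P_s` has no fixed divisor in `PT` with respect to `T`. -/
def NoFixDiv {Z : Type*} [CommRing Z] {k n s : ℕ} (PT : Set (Ideal Z))
    (P : Fin s → PolyTY Z k n) : Prop :=
  ∀ I ∈ PT, ¬ IsFixedDivisor I (∏ i, P i)

/-! ### Hilbertian, Schinzel and integrally Hilbertian rings -/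

/-- A subset `H` of `Z^k` is Zariski-dense in the affine space `𝔸^k` over the fraction field `Q`:
no nonzero polynomial over `Q` vanishes on `H`. -/
def ZariskiDense {Z : Type*} [CommRing Z] {k : ℕ} (H : Set (Fin k → Z)) : Prop :=
  ∀ f : MvPolynomial (Fin k) (FractionRing Z), f ≠ 0 →
    ∃ t ∈ H, MvPolynomial.eval (fun i => algebraMap Z (FractionRing Z) (t i)) f ≠ 0

/-- Hilbertian rings: the Hilbert specialization property holds over the fraction field `Q`, with
Zariski-dense subsets of good specializations that consist of points of `Z^k`. -/
def IsHilbertianRing (Z : Type*) [CommRing Z] [IsDomain Z] : Prop :=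
  ∀ k n s : ℕ, 1 ≤ k → 1 ≤ n → 1 ≤ s →
    ∀ P : Fin s → PolyTY (FractionRing Z) k n,
      (∀ i, Irreducible (P i)) → (∀ i, 1 ≤ (P i).totalDegree) →
      ∃ H : Set (Fin k → Z), ZariskiDense H ∧
        ∀ t ∈ H, ∀ i, Irreducible (spec (fun j => algebraMap Z (FractionRing Z) (t j)) (P i))

/-- `Z` is of characteristic `0` or imperfect, i.e. of characteristic `p > 0` with `Q ≠ Q^p`. -/
def IsCharZeroOrImperfect (Z : Type*) [CommRing Z] [IsDomain Z] : Prop :=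
  CharZero Z ∨ ∃ p : ℕ, p.Prime ∧ CharP Z p ∧ ∃ x : FractionRing Z, ∀ y : FractionRing Z, y ^ p ≠ x

/-- Schinzel rings with respect to the primality type `PT`. There is at least one parameter
(the number of parameters is `k + 1`), and the arithmetic progression is `ω Z + α`. -/
def IsSchinzelRing (Z : Type*) [CommRing Z] [IsDomain Z] (PT : Set (Ideal Z)) : Prop :=
  ∀ k n s : ℕ, 1 ≤ n → 1 ≤ s →
    ∀ P : Fin s → PolyTY Z (k + 1) n,
      (∀ i, PrimOverQT (P i)) → NoFixDiv PT P →
      ∃ ω α : Z, ω ≠ 0 ∧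
        {t₁ ∈ Set.range (fun l : Z => ω * l + α) |
          ¬ ((∀ i, PrimOverQT (specFirst t₁ (P i))) ∧
              NoFixDiv PT (fun i => specFirst t₁ (P i)))}.Finite

/-- The set of all `m ∈ Z^k` such that the `P_i(m, Y)` are irreducible in `Q[Y]` and their product
has no ideal divisor in `PT`. -/
def hilbertSchinzelSet {Z : Type*} [CommRing Z] {k n s : ℕ} (PT : Set (Ideal Z))
    (P : Fin s → PolyTY Z k n) : Set (Fin k → Z) :=
  {m | (∀ i, Irreducible (MvPolynomial.map (algebraMap Z (FractionRing Z)) (spec m (P i)))) ∧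
    ∀ I ∈ PT, ¬ IsZeroMod I (∏ i, spec m (P i))}

/-- Integrally Hilbertian rings with respect to the primality type `PT`. -/
def IsIntegrallyHilbertian (Z : Type*) [CommRing Z] [IsDomain Z] (PT : Set (Ideal Z)) : Prop :=
  ∀ k n s : ℕ, 1 ≤ k → 1 ≤ n → 1 ≤ s →
    ∀ P : Fin s → PolyTY Z k n,
      (∀ i, IrredOverQT (P i)) → (∀ i, PrimOverQT (P i)) → NoFixDiv PT P →
      ZariskiDense (hilbertSchinzelSet PT P)

/-- The ring `ℤ[√5]` is an integral domain. -/
instance isDomain_zsqrtd_five : IsDomain (Zsqrtd 5) := by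
  have : Zsqrtd.Nonsquare 5 := ⟨fun n h => by
    have h1 : n < 3 := by nlinarith
    interval_cases n <;> omega⟩
  exact (inferInstance : IsDomain (Zsqrtd ((5 : ℕ) : ℤ)))

end SchinzelRing

open SchinzelRing

/-!
# Schinzel rings and integrally Hilbertian rings

**From Schinzel to integrally Hilbertian.** Over a Hilbertian ring every arithmetic progression
`ω Z + α` is a Hilbert set (`IsHilbertianRing.isHilbertSet`). The Schinzel property supplies a
progression on which, with finitely many exceptions, specializing the first parameter keeps the
polynomials primitive and their product free of fixed divisors; so the parameters can be specialized
one at a time (`isIntegrallyHilbertian_of_isSchinzelRing`).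

**Schinzel rings.** Primitivity survives almost all specializations `t₁`
(`finite_not_primOverQT_specFirst`): for each remaining parameter `T_j`, Gauss's lemma gives a nonzero
combination of the coefficients that is free of `T_j`, and it bounds the degree in `T_j` of a common
divisor of the specialized coefficients. As for fixed divisors, there is `δ ≠ 0` such that no prime
ideal that avoids `δ` is ever a fixed divisor of the specialized product
(`exists_ne_zero_not_isZeroMod`). Only the primes that contain `δ` are left.
* In a Dedekind domain these are finitely many; by the Chinese remainder theorem `α` can be chosen such
  that for each of them the specialized product has a value, for some choice of the other parameters,
  that is as little divisible as the values of the original product allow. Then all nonzero fixed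
  divisors of the specialized product are fixed divisors of the original product
  (`isSchinzelRing_of_isDedekindDomain`).
* In a half near UFD there are finitely many principal primes that contain `δ`. They are incomparable,
  which suffices to find one point at which the product vanishes modulo none of them
  (`exists_forall_not_isZeroMod`); its first coordinate serves as `α`. In a near UFD every principal
  proper nonzero ideal lies in a principal prime, which reduces the other types to this one.

**The counterexample.** In `ℤ[√5]` the elements `2` and `1 + √5` are irreducible of norm `±4`, and both
divide `4`. The polynomial `(2 + (√5 - 1) T) Y + 4` has no fixed divisor, but for each value `m` of
`T` one of the two divides all coefficients, depending on the parity of `x + y` for `m = x + y √5`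
(`exists_irreducible_dvd`).

**`ℤ[√5]` is Hilbertian.** Kronecker's substitution reduces to polynomials in one variable over `K[X]`
(`exists_finset_irreducible_of_kronecker`), and the coefficients of a partial product of linear factors
in a splitting field reduce further to polynomials `Q` that have no root in `K(X)` and should have no
root in `K` at some `X = t` (`exists_finset_irreducible_of_forall_eval_ne_zero`); after rescaling, the
roots in question lie in the ring itself. The `t < p U` at which `Q` has a root are counted for a large
inert prime `p` (`exists_card_roots_le`). In a residue class modulo `p` in which `Q` is separable, the
roots are, by Hensel's lemma, congruent modulo `p ^ M` to values of a single polynomial in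
`p u`, where `t = t₀ + p u`. Lagrange interpolation at `M` nodes then determines a fixed multiple of
each root up to a multiple of `p ^ M`, and hence exactly, as both real embeddings are too small
to allow another multiple: the points lie on the graph of a rational function of bounded degree. Since
that is not a root of `Q`, the class contains boundedly many points, `R` say. The total is at most
`δ U + p R`, with `δ` the number of inseparable classes, and this is smaller than `p U`
once `U > R` and `p` is large.
-/

namespace SchinzelRing
open MvPolynomial

/-! ### Regrouping variables -/

section Regroup
variable (R : Type*) [CommRing R] (k n : ℕ)

/-- The isomorphism `R[T₁,…,T_{k+1}] ≃ R[T₁][T₂,…,T_{k+1}]`. -/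
noncomputable def splitFirst :
    MvPolynomial (Fin (k + 1)) R ≃ₐ[R] MvPolynomial (Fin k) (Polynomial R) :=
  (renameEquiv R (_root_.finSuccEquiv k)).trans (optionEquivRight R (Fin k))

@[simp] lemma splitFirst_C (r : R) : splitFirst R k (C r) = C (Polynomial.C r) := by
  simp [splitFirst]

@[simp] lemma splitFirst_X_zero : splitFirst R k (X 0) = C Polynomial.X := by
  simp [splitFirst]

@[simp] lemma splitFirst_X_succ (i : Fin k) : splitFirst R k (X i.succ) = X i := by
  simp [splitFirst]

/-- The isomorphism `R[T][Y] ≃ R[Y, T]`. -/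
noncomputable def flatten : PolyTY R k n ≃+* MvPolynomial (Fin n ⊕ Fin k) R :=
  ((sumAlgEquiv R (Fin n) (Fin k)).symm : _ ≃+* _)

/-- The isomorphism `R[T₁,…,T_{k+1}][Y] ≃ R[T₁][Y, T₂,…,T_{k+1}]`. -/
noncomputable def isolateFirst :
    PolyTY R (k + 1) n ≃+* MvPolynomial (Fin n ⊕ Fin k) (Polynomial R) :=
  (mapEquiv (Fin n) (splitFirst R k : _ ≃+* _)).trans (flatten (Polynomial R) k n)

variable {R k n}

@[simp] lemma flatten_C_C (r : R) : flatten R k n (C (C r)) = C r := by simp [flatten]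
@[simp] lemma flatten_C_X (i : Fin k) : flatten R k n (C (X i)) = X (.inr i) := by simp [flatten]
@[simp] lemma flatten_X (i : Fin n) : flatten R k n (X i) = X (.inl i) := by simp [flatten]

@[simp] lemma isolateFirst_C (r : MvPolynomial (Fin (k + 1)) R) :
    isolateFirst R k n (C r) = flatten (Polynomial R) k n (C (splitFirst R k r)) := by
  simp [isolateFirst]
@[simp] lemma isolateFirst_X (i : Fin n) : isolateFirst R k n (X i) = X (.inl i) := by
  simp [isolateFirst]

/-- Specializing the isolated first parameter is `specFirst`. -/
lemma flatten_specFirst (t : R) (P : PolyTY R (k + 1) n) :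
    flatten R k n (specFirst t P) =
      map (Polynomial.evalRingHom t) (isolateFirst R k n P) := by
  have : ((flatten R k n).toRingHom.comp (MvPolynomial.map
    (MvPolynomial.aeval
      (Fin.cons (MvPolynomial.C t) MvPolynomial.X : Fin (k + 1) → MvPolynomial (Fin k) R) :
      MvPolynomial (Fin (k + 1)) R →ₐ[R] MvPolynomial (Fin k) R).toRingHom)) =
      (map (Polynomial.evalRingHom t)).comp (isolateFirst R k n).toRingHom := by
    refine ringHom_ext' (ringHom_ext' ?_ ?_) ?_
    · ext r; simp
    · intro i
      refine Fin.cases ?_ (fun j => ?_) i <;> simp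
    · intro i; simp
  exact congrArg (fun f => f P) this

lemma specFirst_eq_splitFirst (t : R) (r : MvPolynomial (Fin (k + 1)) R) :
    MvPolynomial.aeval
      (Fin.cons (MvPolynomial.C t) MvPolynomial.X : Fin (k + 1) → MvPolynomial (Fin k) R) r =
      map (Polynomial.evalRingHom t) (splitFirst R k r) := by
  have : (MvPolynomial.aeval
      (Fin.cons (MvPolynomial.C t) MvPolynomial.X : Fin (k + 1) → MvPolynomial (Fin k) R) :
      MvPolynomial (Fin (k + 1)) R →ₐ[R] MvPolynomial (Fin k) R).toRingHom =
      (map (Polynomial.evalRingHom t)).comp (splitFirst R k).toAlgHom.toRingHom := by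
    refine ringHom_ext' ?_ ?_
    · ext r; simp
    · intro i
      refine Fin.cases ?_ (fun j => ?_) i <;> simp
  exact congrArg (fun f => f r) this

lemma coeff_specFirst (t : R) (P : PolyTY R (k + 1) n) (d : Fin n →₀ ℕ) :
    (specFirst t P).coeff d = map (Polynomial.evalRingHom t) (splitFirst R k (P.coeff d)) := by
  rw [← specFirst_eq_splitFirst, specFirst, coeff_map]; rfl

/-- Specializing the first parameter, then the others, is specializing them all. -/
lemma spec_specFirst (t : R) (u : Fin k → R) (P : PolyTY R (k + 1) n) :
    spec u (specFirst t P) = spec (Fin.cons t u : Fin (k + 1) → R) P := by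
  rw [spec, spec, specFirst, map_map]
  refine congrArg (fun g => map g P) ?_
  refine ringHom_ext' ?_ ?_
  · ext r; simp
  · intro i
    refine Fin.cases ?_ (fun j => ?_) i <;> simp

lemma eval_specFirst (t : R) (u : Fin k → R) (f : MvPolynomial (Fin (k + 1)) R) :
    eval (Fin.cons t u : Fin (k + 1) → R) f =
      eval u (map (Polynomial.evalRingHom t) (splitFirst R k f)) := by
  rw [← specFirst_eq_splitFirst]
  have : (eval (Fin.cons t u : Fin (k + 1) → R)) = (eval u).comp (MvPolynomial.aeval
      (Fin.cons (MvPolynomial.C t) MvPolynomial.X : Fin (k + 1) → MvPolynomial (Fin k) R) :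
      MvPolynomial (Fin (k + 1)) R →ₐ[R] MvPolynomial (Fin k) R).toRingHom := by
    refine ringHom_ext' ?_ ?_
    · ext r; simp
    · intro i
      refine Fin.cases ?_ (fun j => ?_) i <;> simp
  exact congrArg (fun g => g f) this

lemma specFirst_prod {s : ℕ} (t : R) (P : Fin s → PolyTY R (k + 1) n) :
    specFirst t (∏ i, P i) = ∏ i, specFirst t (P i) := by
  simp only [specFirst, map_prod]

lemma spec_prod {s : ℕ} (t : Fin k → R) (P : Fin s → PolyTY R k n) :
    spec t (∏ i, P i) = ∏ i, spec t (P i) := by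
  simp only [spec, map_prod]

section BaseChange
variable {S : Type*} [CommRing S] (f : R →+* S)

lemma splitFirst_map (r : MvPolynomial (Fin (k + 1)) R) :
    splitFirst S k (map f r) = map (Polynomial.mapRingHom f) (splitFirst R k r) := by
  have : (splitFirst S k).toAlgHom.toRingHom.comp (map f) =
      (map (Polynomial.mapRingHom f)).comp (splitFirst R k).toAlgHom.toRingHom := by
    refine ringHom_ext' ?_ ?_
    · ext r; simp
    · intro i
      refine Fin.cases ?_ (fun j => ?_) i <;> simp
  exact congrArg (fun g => g r) this

lemma flatten_map (P : PolyTY R k n) :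
    flatten S k n (map (map f) P) = map f (flatten R k n P) := by
  have : (flatten S k n).toRingHom.comp (map (map f)) =
      (map f).comp (flatten R k n).toRingHom := by
    refine ringHom_ext' (ringHom_ext' ?_ ?_) ?_
    · ext r; simp
    · intro i; simp
    · intro i; simp
  exact congrArg (fun g => g P) this

lemma isolateFirst_map (P : PolyTY R (k + 1) n) :
    isolateFirst S k n (map (map f) P) =
      map (Polynomial.mapRingHom f) (isolateFirst R k n P) := by
  rw [isolateFirst, isolateFirst]
  simp only [RingEquiv.coe_trans, Function.comp_apply]
  rw [← flatten_map]
  congr 1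
  simp only [mapEquiv_apply, map_map]
  refine congrArg (fun g => map g P) ?_
  exact RingHom.ext fun r => splitFirst_map f r

lemma specFirst_map (t : R) (P : PolyTY R (k + 1) n) :
    specFirst (f t) (map (map f) P) = map (map f) (specFirst t P) := by
  apply (flatten S k n).injective
  rw [flatten_specFirst, isolateFirst_map, flatten_map, flatten_specFirst, map_map, map_map]
  congr 1
  ext <;> simp

lemma spec_map (t : Fin k → R) (P : PolyTY R k n) :
    spec (fun j => f (t j)) (map (map f) P) = map f (spec t P) := by
  rw [spec, spec, map_map, map_map]
  refine congrArg (fun g => map g P) ?_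
  refine ringHom_ext' ?_ ?_
  · ext r; simp
  · intro i; simp

end BaseChange
end Regroup

/-! ### Irreducibility over the fraction field of the coefficient ring -/

section Gauss

/-- Denominators of a polynomial over a fraction field can be cleared. -/
lemma exists_clear_denominators {σ R F : Type*} [CommRing R] [CommRing F]
    [Algebra R F] [IsFractionRing R F] (A : MvPolynomial σ F) :
    ∃ (c : R) (A' : MvPolynomial σ R), c ∈ nonZeroDivisors R ∧
      map (algebraMap R F) A' = C (algebraMap R F c) * A := by
  let := algebraMvPolynomial (σ := σ) (R := R) (S := F)
  obtain ⟨⟨A', c⟩, h⟩ :=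
    IsLocalization.surj ((nonZeroDivisors R).map (C (σ := σ))) A
  obtain ⟨c, r, hr, rfl⟩ := c
  refine ⟨r, A', hr, ?_⟩
  have h' : A * map (algebraMap R F) (C r) = map (algebraMap R F) A' := h
  rw [map_C] at h'
  rw [← h', mul_comm]

variable {σ R F : Type*} [CommRing R] [IsDomain R] [Field F]
  [Algebra R F] [IsFractionRing R F]

omit [IsDomain R] in
lemma totalDegree_map_algebraMap (P : MvPolynomial σ R) :
    (map (algebraMap R F) P).totalDegree = P.totalDegree := by
  simp only [totalDegree, support_map_of_injective P (IsFractionRing.injective R F)]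

/-- A polynomial of positive degree that is irreducible over a UFD stays irreducible over the
fraction field. -/
lemma irreducible_map_of_irreducible [UniqueFactorizationMonoid R] {P : MvPolynomial σ R}
    (hP : Irreducible P) (hd : 1 ≤ P.totalDegree) : Irreducible (map (algebraMap R F) P) := by
  have key : ∀ A B : MvPolynomial σ F, ∀ A' : MvPolynomial σ R, ∀ c : R, c ≠ 0 →
      map (algebraMap R F) P = A * B → map (algebraMap R F) A' = C (algebraMap R F c) * A →
      P ∣ A' → IsUnit B := by
    intro A B A' c hc hAB hA' hdvd
    have hP0 : map (algebraMap R F) P ≠ 0 := by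
      rw [Ne, map_eq_zero_iff _ (map_injective _ (IsFractionRing.injective R F))]
      exact hP.ne_zero
    have hA0 : A ≠ 0 := by rintro rfl; simp at hAB; exact hP0 hAB
    have hB0 : B ≠ 0 := by rintro rfl; simp at hAB; exact hP0 hAB
    have hcF : algebraMap R F c ≠ 0 := by
      rwa [Ne, IsFractionRing.to_map_eq_zero_iff]
    have hA'0 : A' ≠ 0 := by
      rintro rfl
      rw [map_zero] at hA'
      exact mul_ne_zero (by simpa using hcF) hA0 hA'.symm
    have h1 : A'.totalDegree = A.totalDegree := by
      rw [← totalDegree_map_algebraMap (F := F), hA',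
        totalDegree_mul_of_isDomain (by simpa using hcF) hA0]
      simp
    have h2 : P.totalDegree = A.totalDegree + B.totalDegree := by
      rw [← totalDegree_map_algebraMap (F := F), hAB, totalDegree_mul_of_isDomain hA0 hB0]
    have h3 : P.totalDegree ≤ A'.totalDegree := by
      obtain ⟨E, rfl⟩ := hdvd
      rw [totalDegree_mul_of_isDomain hP.ne_zero (right_ne_zero_of_mul hA'0)]
      omega
    have h4 : B.totalDegree = 0 := by omega
    rw [totalDegree_eq_zero_iff_eq_C] at h4
    rw [h4]
    refine IsUnit.map C (isUnit_iff_ne_zero.mpr ?_)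
    intro h0
    rw [h0, C_0] at h4
    exact hB0 h4
  refine ⟨fun hu => ?_, fun {A B} hAB => ?_⟩
  · have := (isUnit_iff_totalDegree_of_isReduced.mp hu).2
    rw [totalDegree_map_algebraMap] at this
    omega
  obtain ⟨a, A', ha, hA'⟩ := exists_clear_denominators (R := R) A
  obtain ⟨b, B', hb, hB'⟩ := exists_clear_denominators (R := R) B
  have ha0 := nonZeroDivisors.ne_zero ha
  have hb0 := nonZeroDivisors.ne_zero hb
  have hprod : C (a * b) * P = A' * B' := by
    apply map_injective _ (IsFractionRing.injective R F)
    rw [RingHom.map_mul (map (algebraMap R F)) A' B', hA', hB',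
      RingHom.map_mul (map (algebraMap R F)), map_C, hAB, map_mul, C_mul]
    ring
  rcases hP.prime.dvd_or_dvd (Dvd.intro_left _ hprod) with h | h
  · exact Or.inr (key A B A' a ha0 hAB hA' h)
  · exact Or.inl (key B A B' b hb0 (by rw [hAB, mul_comm]) hB' h)

omit [IsDomain R] in
/-- Conversely, a polynomial that is irreducible over the fraction field and whose coefficients have
no nonunit common divisor is irreducible. -/
lemma irreducible_of_irreducible_map {P : MvPolynomial σ R}
    (hP : Irreducible (map (algebraMap R F) P)) (hprim : ∀ r : R, C r ∣ P → IsUnit r) :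
    Irreducible P := by
  have key : ∀ A B : MvPolynomial σ R, P = A * B → IsUnit (map (algebraMap R F) A) →
      IsUnit A := by
    intro A B hAB hu
    have hd := (isUnit_iff_totalDegree_of_isReduced.mp hu).2
    rw [totalDegree_map_algebraMap, totalDegree_eq_zero_iff_eq_C] at hd
    rw [hd] at hAB ⊢
    exact (hprim _ (Dvd.intro _ hAB.symm)).map C
  refine ⟨fun hu => hP.not_isUnit (hu.map _), fun {A B} hAB => ?_⟩
  have := congrArg (map (algebraMap R F)) hAB
  rw [map_mul] at this
  rcases hP.isUnit_or_isUnit this with h | h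
  · exact Or.inl (key A B hAB h)
  · exact Or.inr (key B A (by rw [hAB, mul_comm]) h)

end Gauss

/-! ### Irreducibility and primitivity over the parameter ring -/

section Conditions
variable {Z : Type*} [CommRing Z] [IsDomain Z] {k n : ℕ}

/-- The polynomial `P` with its coefficients viewed in the fraction field. -/
noncomputable abbrev overQ (P : PolyTY Z k n) : PolyTY (FractionRing Z) k n :=
  map (map (algebraMap Z (FractionRing Z))) P

omit [IsDomain Z] in
lemma primOverQT_iff (P : PolyTY Z k n) :
    PrimOverQT P ↔ ∀ r : MvPolynomial (Fin k) (FractionRing Z), C r ∣ overQ P → IsUnit r := by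
  simp only [PrimOverQT, C_dvd_iff_dvd_coeff, overQ, coeff_map]

lemma irreducible_overQ {P : PolyTY Z k n} (h1 : IrredOverQT P) (h2 : PrimOverQT P) :
    Irreducible (overQ P) :=
  irreducible_of_irreducible_map h1 ((primOverQT_iff P).mp h2)

lemma one_le_totalDegree_overQ {P : PolyTY Z k n} (h1 : IrredOverQT P) :
    1 ≤ (overQ P).totalDegree := by
  by_contra h
  rw [← totalDegree_map_algebraMap
    (F := FractionRing (MvPolynomial (Fin k) (FractionRing Z)))] at h
  refine h1.not_isUnit ?_
  have h0 : (map (algebraMap (MvPolynomial (Fin k) (FractionRing Z))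
    (FractionRing (MvPolynomial (Fin k) (FractionRing Z)))) (overQ P)).totalDegree = 0 := by omega
  have hne := h1.ne_zero
  rw [totalDegree_eq_zero_iff_eq_C] at h0
  rw [h0] at hne ⊢
  exact IsUnit.map C (isUnit_iff_ne_zero.mpr fun h => hne (by rw [h, C_0]))

lemma irredOverQT_of_irreducible {P : PolyTY Z k n} (h : Irreducible (overQ P))
    (hd : 1 ≤ (overQ P).totalDegree) : IrredOverQT P :=
  irreducible_map_of_irreducible h hd

end Conditions

/-! ### Hilbert sets -/

section HilbertSet
variable {Q : Type*} [Field Q]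

/-- A set `S` of elements of a field `Q` is a Hilbert set if finitely many irreducible polynomials
over `Q[X]`, in any number of variables, stay irreducible after specializing `X` to a suitable
element of `S`, which can moreover be chosen off the zeros of a given nonzero polynomial. -/
def IsHilbertSet (S : Set Q) : Prop :=
  ∀ (N s : ℕ), 1 ≤ s → ∀ P : Fin s → MvPolynomial (Fin N) (Polynomial Q),
    (∀ i, Irreducible (P i)) → (∀ i, 1 ≤ (P i).totalDegree) → ∀ g : Polynomial Q, g ≠ 0 →
    ∃ t ∈ S, g.eval t ≠ 0 ∧ ∀ i, Irreducible (map (Polynomial.evalRingHom t) (P i))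

lemma IsHilbertSet.exists_irreducible {S : Set Q} (hS : IsHilbertSet S) {σ : Type*} [Finite σ]
    {s : ℕ} (hs : 1 ≤ s) (P : Fin s → MvPolynomial σ (Polynomial Q))
    (hP : ∀ i, Irreducible (P i)) (hd : ∀ i, 1 ≤ (P i).totalDegree) {g : Polynomial Q}
    (hg : g ≠ 0) :
    ∃ t ∈ S, g.eval t ≠ 0 ∧ ∀ i, Irreducible (map (Polynomial.evalRingHom t) (P i)) := by
  obtain ⟨N, ⟨e⟩⟩ := Finite.exists_equiv_fin σ
  obtain ⟨t, ht, hgt, hi⟩ := hS N s hs (fun i => renameEquiv _ e (P i))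
    (fun i => (MulEquiv.irreducible_iff (renameEquiv (Polynomial Q) e)).mpr (hP i))
    (fun i => by
      rw [totalDegree_renameEquiv]
      exact hd i) g hg
  refine ⟨t, ht, hgt, fun i => ?_⟩
  have := hi i
  rw [renameEquiv_apply, map_rename, ← renameEquiv_apply] at this
  exact (MulEquiv.irreducible_iff (renameEquiv Q e)).mp this

/-- A nonzero polynomial over `Q[X]` stays nonzero at all `t` off the zeros of some nonzero
polynomial. -/
lemma exists_ne_zero_of_eval_ne_zero {σ : Type*} {h : MvPolynomial σ (Polynomial Q)} (hh : h ≠ 0) :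
    ∃ g : Polynomial Q, g ≠ 0 ∧ ∀ t, g.eval t ≠ 0 → map (Polynomial.evalRingHom t) h ≠ 0 := by
  obtain ⟨d, hd⟩ := ne_zero_iff.mp hh
  refine ⟨h.coeff d, hd, fun t ht h0 => ht ?_⟩
  have := congrArg (coeff d) h0
  simpa [coeff_map] using this

variable {k n s : ℕ}

lemma one_le_totalDegree_iff {σ R : Type*} [CommRing R] (P : MvPolynomial σ R) :
    1 ≤ P.totalDegree ↔ ∃ d, P.coeff d ≠ 0 ∧ d ≠ 0 := by
  constructor
  · intro h
    by_contra! h'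
    have : P.totalDegree = 0 := by
      rw [totalDegree_eq_zero_iff]
      intro d hd i
      rw [h' d (mem_support_iff.mp hd)]
      rfl
    omega
  · rintro ⟨d, hd, hd0⟩
    by_contra h
    have h0 : P.totalDegree = 0 := by omega
    rw [totalDegree_eq_zero_iff] at h0
    apply hd0
    ext i
    exact h0 d (mem_support_iff.mpr hd) i

lemma one_le_totalDegree_isolateFirst {R : Type*} [CommRing R] {P : PolyTY R (k + 1) n}
    (hd : 1 ≤ P.totalDegree) : 1 ≤ (isolateFirst R k n P).totalDegree := by
  by_contra h
  have h0 : (isolateFirst R k n P).totalDegree = 0 := by omega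
  rw [totalDegree_eq_zero_iff_eq_C] at h0
  set a := coeff 0 (isolateFirst R k n P)
  have h1 : isolateFirst R k n P = isolateFirst R k n (C ((splitFirst R k).symm (C a))) := by
    rw [h0, isolateFirst_C, AlgEquiv.apply_symm_apply, flatten_C_C]
  rw [(isolateFirst R k n).injective h1, totalDegree_C] at hd
  omega

/-- Specialization of the first of several parameters in a Hilbert set preserves irreducibility. -/
lemma IsHilbertSet.exists_specFirst {S : Set Q} (hS : IsHilbertSet S) (hs : 1 ≤ s)
    (P : Fin s → PolyTY Q (k + 1) n) (hP : ∀ i, Irreducible (P i))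
    (hd : ∀ i, 1 ≤ (P i).totalDegree) {f : MvPolynomial (Fin (k + 1)) Q} (hf : f ≠ 0)
    {g : Polynomial Q} (hg : g ≠ 0) :
    ∃ t ∈ S, g.eval t ≠ 0 ∧ map (Polynomial.evalRingHom t) (splitFirst Q k f) ≠ 0 ∧
      ∀ i, Irreducible (specFirst t (P i)) ∧ 1 ≤ (specFirst t (P i)).totalDegree := by
  have h1 : ∀ i, ∃ gi : Polynomial Q, gi ≠ 0 ∧
      ∀ t, gi.eval t ≠ 0 → 1 ≤ (specFirst t (P i)).totalDegree := by
    intro i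
    obtain ⟨d, hd1, hd0⟩ := (one_le_totalDegree_iff _).mp (hd i)
    obtain ⟨gi, hgi, hgi'⟩ := exists_ne_zero_of_eval_ne_zero
      (h := splitFirst Q k ((P i).coeff d)) (by simpa using hd1)
    refine ⟨gi, hgi, fun t ht => (one_le_totalDegree_iff _).mpr ⟨d, ?_, hd0⟩⟩
    rw [coeff_specFirst]
    exact hgi' t ht
  choose gi hgi hgi' using h1
  obtain ⟨g0, hg0, hg0'⟩ := exists_ne_zero_of_eval_ne_zero
    (h := splitFirst Q k f) (by simpa using hf)
  obtain ⟨t, ht, hgt, hirr⟩ := hS.exists_irreducible hs (fun i => isolateFirst Q k n (P i))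
    (fun i => (MulEquiv.irreducible_iff (isolateFirst Q k n)).mpr (hP i))
    (fun i => one_le_totalDegree_isolateFirst (hd i))
    (g := g * g0 * ∏ i, gi i)
    (mul_ne_zero (mul_ne_zero hg hg0) (Finset.prod_ne_zero_iff.mpr fun i _ => hgi i))
  rw [Polynomial.eval_mul, Polynomial.eval_mul, Polynomial.eval_prod] at hgt
  refine ⟨t, ht, left_ne_zero_of_mul (left_ne_zero_of_mul hgt),
    hg0' t (right_ne_zero_of_mul (left_ne_zero_of_mul hgt)), fun i => ⟨?_, hgi' i t ?_⟩⟩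
  · have := hirr i
    rw [← flatten_specFirst] at this
    exact (MulEquiv.irreducible_iff (flatten Q k n)).mp this
  · exact Finset.prod_ne_zero_iff.mp (right_ne_zero_of_mul hgt) i (Finset.mem_univ i)

end HilbertSet

/-! ### Specializing the parameters one at a time -/

section Transfer
variable {Z : Type*} [CommRing Z] [IsDomain Z] {k n s : ℕ}

lemma irreducible_spec_of_isEmpty {Q : Type*} [Field Q] (t : Fin 0 → Q) {P : PolyTY Q 0 n}
    (hP : Irreducible P) : Irreducible (spec t P) := by
  have h : spec t P = mapEquiv (Fin n) (isEmptyRingEquiv Q (Fin 0)) P := by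
    rw [spec, mapEquiv_apply]
    refine congrArg (fun g => map g P) ?_
    refine ringHom_ext' ?_ (fun i => i.elim0)
    ext r
    simp only [RingHom.comp_apply, eval_C, RingEquiv.coe_toRingHom, isEmptyRingEquiv_eq_coeff_zero]
    exact (coeff_zero_C r).symm
  rw [h]
  exact (MulEquiv.irreducible_iff (mapEquiv (Fin n) (isEmptyRingEquiv Q (Fin 0)))).mpr hP

/-- If the elements of `Z` form a Hilbert set in the fraction field, then `Z` is Hilbertian. -/
theorem isHilbertianRing_of_isHilbertSet
    (hS : IsHilbertSet (Set.range (algebraMap Z (FractionRing Z)))) : IsHilbertianRing Z := by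
  intro k n s hk _ hs P hP hd
  clear hk
  refine ⟨{t | ∀ i, Irreducible (spec (fun j => algebraMap Z (FractionRing Z) (t j)) (P i))}, ?_,
    fun t ht => ht⟩
  intro f hf
  induction k with
  | zero =>
    refine ⟨Fin.elim0, fun i => irreducible_spec_of_isEmpty _ (hP i), ?_⟩
    rw [eq_C_of_isEmpty f] at hf ⊢
    rw [eval_C]
    intro h
    rw [h, C_0] at hf
    exact hf rfl
  | succ k ih =>
    obtain ⟨_, ⟨t, rfl⟩, -, hft, ht⟩ := hS.exists_specFirst hs P hP hd hf one_ne_zero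
    obtain ⟨u, hu, hfu⟩ := ih (fun i => specFirst (algebraMap Z (FractionRing Z) t) (P i))
      (fun i => (ht i).1) (fun i => (ht i).2) _ hft
    have hcons : (fun j => algebraMap Z (FractionRing Z) ((Fin.cons t u : Fin (k + 1) → Z) j)) =
        Fin.cons (algebraMap Z (FractionRing Z) t) (fun j => algebraMap Z (FractionRing Z) (u j)) := by
      funext j
      refine Fin.cases ?_ (fun i => ?_) j <;> simp
    refine ⟨Fin.cons t u, fun i => ?_, ?_⟩
    · rw [hcons, ← spec_specFirst]
      exact hu i
    · rw [hcons, eval_specFirst]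
      exact hfu

/-- In a Hilbertian ring every arithmetic progression is a Hilbert set. -/
lemma IsHilbertianRing.isHilbertSet (hZ : IsHilbertianRing Z) {ω : Z} (hω : ω ≠ 0) (α : Z) :
    IsHilbertSet (Set.range fun l : Z => algebraMap Z (FractionRing Z) (ω * l + α)) := by
  intro N s hs P hP hd g hg
  set a := algebraMap Z (FractionRing Z) ω with ha
  have ha0 : a ≠ 0 := by rwa [ha, Ne, IsFractionRing.to_map_eq_zero_iff]
  let inv := invertibleOfNonzero ha0
  have hN : 1 ≤ N := by
    rcases Nat.eq_zero_or_pos N with rfl | h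
    · have := hd ⟨0, hs⟩
      rw [eq_C_of_isEmpty (P ⟨0, hs⟩), totalDegree_C] at this
      omega
    · exact h
  let e : Polynomial (FractionRing Z) ≃+* MvPolynomial (Fin 1) (FractionRing Z) :=
    ((Polynomial.algEquivCMulXAddC a (algebraMap Z (FractionRing Z) α)).trans
      (uniqueAlgEquiv (FractionRing Z) (Fin 1)).symm : _ ≃ₐ[FractionRing Z] _)
  have he : ∀ v : Fin 1 → FractionRing Z, (eval v).comp (e : _ →+* _) =
      Polynomial.evalRingHom (a * v 0 + algebraMap Z (FractionRing Z) α) := by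
    intro v
    refine Polynomial.ringHom_ext' ?_ ?_
    · ext r
      simp [e]
    · simp [e]
  obtain ⟨H, hH, hirr⟩ := hZ 1 N s le_rfl hN hs (fun i => mapEquiv (Fin N) e (P i))
    (fun i => (MulEquiv.irreducible_iff (mapEquiv (Fin N) e)).mpr (hP i)) (fun i => by
      have h := hd i
      rw [totalDegree, ← support_map_of_injective (P i) (f := e.toRingHom) e.injective] at h
      exact h)
  obtain ⟨t, ht, hgt⟩ := hH (e g) (by simpa using hg)
  have hspec : ∀ x, eval (fun j => algebraMap Z (FractionRing Z) (t j)) (e x) =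
      x.eval (algebraMap Z (FractionRing Z) (ω * t 0 + α)) := by
    intro x
    have := congrArg (fun f => f x) (he (fun j => algebraMap Z (FractionRing Z) (t j)))
    simpa [ha] using this
  refine ⟨_, ⟨t 0, rfl⟩, ?_, fun i => ?_⟩
  · rwa [← hspec]
  · have h := hirr t ht i
    rw [spec, mapEquiv_apply, map_map, he, ha, ← map_mul, ← map_add] at h
    exact h

/-- A Hilbertian Schinzel ring is integrally Hilbertian: the arithmetic progression given by the
Schinzel property, minus its finitely many exceptions, is still a Hilbert set. -/
theorem isIntegrallyHilbertian_of_isSchinzelRing {PT : Set (Ideal Z)} (hPT : ∀ I ∈ PT, I ≠ ⊤)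
    (hZ : IsHilbertianRing Z) (hS : IsSchinzelRing Z PT) : IsIntegrallyHilbertian Z PT := by
  intro k n s hk hn hs P h1 h2 h3 f hf
  clear hk
  induction k with
  | zero =>
    refine ⟨Fin.elim0, ⟨fun i => ?_, fun I hI hz => ?_⟩, ?_⟩
    · rw [← spec_map]
      exact irreducible_spec_of_isEmpty _ (irreducible_overQ (h1 i) (h2 i))
    · refine h3 I hI ⟨hPT I hI, fun t => ?_⟩
      rw [Subsingleton.elim t Fin.elim0, spec_prod]
      exact hz
    · rw [eq_C_of_isEmpty f] at hf ⊢
      rw [eval_C]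
      intro h
      rw [h, C_0] at hf
      exact hf rfl
  | succ k ih =>
    obtain ⟨ω, α, hω, hfin⟩ := hS k n s hn hs P h2 h3
    obtain ⟨_, ⟨l, rfl⟩, hgl, hfl, hl⟩ := (hZ.isHilbertSet hω α).exists_specFirst hs
      (fun i => overQ (P i)) (fun i => irreducible_overQ (h1 i) (h2 i))
      (fun i => one_le_totalDegree_overQ (h1 i)) hf
      (g := ∏ b ∈ hfin.toFinset, (Polynomial.X - Polynomial.C (algebraMap Z (FractionRing Z) b)))
      (Finset.prod_ne_zero_iff.mpr fun b _ => Polynomial.X_sub_C_ne_zero _)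
    rw [Polynomial.eval_prod, Finset.prod_ne_zero_iff] at hgl
    have hgood : (∀ i, PrimOverQT (specFirst (ω * l + α) (P i))) ∧
        NoFixDiv PT (fun i => specFirst (ω * l + α) (P i)) := by
      by_contra hbad
      exact hgl (ω * l + α) (hfin.mem_toFinset.mpr ⟨⟨l, rfl⟩, hbad⟩) (by simp)
    have hl' : ∀ i, IrredOverQT (specFirst (ω * l + α) (P i)) := by
      intro i
      have := hl i
      simp only [overQ, specFirst_map] at this
      exact irredOverQT_of_irreducible this.1 this.2
    obtain ⟨u, ⟨hu1, hu2⟩, hfu⟩ := ih (fun i => specFirst (ω * l + α) (P i)) hl'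
      hgood.1 hgood.2 _ hfl
    have hcons : (fun j => algebraMap Z (FractionRing Z)
          ((Fin.cons (ω * l + α) u : Fin (k + 1) → Z) j)) =
        Fin.cons (algebraMap Z (FractionRing Z) (ω * l + α))
          (fun j => algebraMap Z (FractionRing Z) (u j)) := by
      funext j
      refine Fin.cases ?_ (fun i => ?_) j <;> simp
    refine ⟨Fin.cons (ω * l + α) u, ⟨fun i => ?_, ?_⟩, ?_⟩
    · rw [← spec_specFirst]
      exact hu1 i
    · simpa only [← spec_specFirst] using hu2
    · rw [hcons, eval_specFirst]
      exact hfu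

end Transfer

end SchinzelRing

namespace SchinzelRing

/-! ### Hensel lifting modulo powers of an ideal -/

section Hensel
open Polynomial
variable {A : Type*} [CommRing A] {I : Ideal A} {f : A[X]} {v : A}

lemma eval_sub_mem_of_sub_mem (g : A[X]) {x y : A} (h : x - y ∈ I) :
    g.eval x - g.eval y ∈ I :=
  I.mem_of_dvd (sub_dvd_eval_sub x y g) h

/-- Newton iteration: a simple root modulo `I` lifts to a root modulo any power of `I`. -/
lemma exists_eval_mem_pow {y₀ : A} (h₀ : f.eval y₀ ∈ I)
    (hv : v * f.derivative.eval y₀ - 1 ∈ I) (m : ℕ) :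
    ∃ y, y - y₀ ∈ I ∧ f.eval y ∈ I ^ m := by
  suffices ∃ y, y - y₀ ∈ I ∧ f.eval y ∈ I ^ (m + 1) by
    obtain ⟨y, h1, h2⟩ := this
    exact ⟨y, h1, Ideal.pow_le_pow_right (Nat.le_succ m) h2⟩
  induction m with
  | zero => exact ⟨y₀, by simp, by simpa using h₀⟩
  | succ m ih =>
    obtain ⟨y, h1, h2⟩ := ih
    have hyI : f.eval y ∈ I := Ideal.pow_le_self (Nat.succ_ne_zero m) h2
    obtain ⟨k, hk⟩ := binomExpansion f y (-(v * f.eval y))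
    refine ⟨y + -(v * f.eval y), ?_, ?_⟩
    · have : y + -(v * f.eval y) - y₀ = (y - y₀) - v * f.eval y := by ring
      rw [this]
      exact I.sub_mem h1 (I.mul_mem_left _ hyI)
    · have hd : 1 - v * f.derivative.eval y ∈ I := by
        have h3 := eval_sub_mem_of_sub_mem f.derivative h1
        have : 1 - v * f.derivative.eval y = -(v * f.derivative.eval y₀ - 1) -
            v * (f.derivative.eval y - f.derivative.eval y₀) := by ring
        rw [this]
        exact I.sub_mem (I.neg_mem hv) (I.mul_mem_left _ h3)
      have : f.eval (y + -(v * f.eval y)) = f.eval y * (1 - v * f.derivative.eval y) +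
          (k * v ^ 2) * (f.eval y * f.eval y) := by rw [hk]; ring
      rw [this, pow_succ I (m + 1)]
      exact Ideal.add_mem _ (Ideal.mul_mem_mul h2 hd)
        (Ideal.mul_mem_left _ _ (Ideal.mul_mem_mul h2 hyI))

/-- A root modulo a power of `I` is determined by its class modulo `I`, if that class is a simple
root. -/
lemma sub_mem_pow_of_eval_mem_pow {y y' : A} {m : ℕ} (h : y' - y ∈ I) (hy : f.eval y ∈ I ^ m)
    (hy' : f.eval y' ∈ I ^ m) (hv : v * f.derivative.eval y - 1 ∈ I) : y' - y ∈ I ^ m := by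
  suffices ∀ j ≤ m, y' - y ∈ I ^ j from this m le_rfl
  intro j
  induction j with
  | zero => simp
  | succ j ih =>
    intro hj
    have hj' := ih (by omega)
    obtain ⟨k, hk⟩ := binomExpansion f y (y' - y)
    rw [add_sub_cancel] at hk
    have : y' - y = v * (f.eval y' - f.eval y) - (v * k) * ((y' - y) * (y' - y)) -
        (y' - y) * (v * f.derivative.eval y - 1) := by rw [hk]; ring
    rw [this]
    have hle : I ^ m ≤ I ^ (j + 1) := Ideal.pow_le_pow_right hj
    refine Ideal.sub_mem _ (Ideal.sub_mem _ (Ideal.mul_mem_left _ _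
      (Ideal.sub_mem _ (hle hy') (hle hy))) (Ideal.mul_mem_left _ _ ?_)) ?_
    · rw [pow_succ]; exact Ideal.mul_mem_mul hj' h
    · rw [pow_succ]; exact Ideal.mul_mem_mul hj' hv

end Hensel

/-! ### Lagrange interpolation without denominators -/

section Lagrange
open Polynomial
variable (O : Type*) [CommRing O]

/-- The common denominator `∏_{i ≠ j} (i - j)` of the Lagrange interpolation at the nodes `s`. -/
def nodeDenom (s : Finset ℕ) : O := ∏ i ∈ s, ∏ j ∈ s.erase i, ((i : O) - j)

/-- The Lagrange basis polynomial of the node `i`, multiplied by `nodeDenom`. -/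
noncomputable def nodeNumer (s : Finset ℕ) (i : ℕ) : O[X] :=
  C (∏ i' ∈ s.erase i, ∏ j ∈ s.erase i', ((i' : O) - j)) * ∏ j ∈ s.erase i, (X - C (j : O))

variable {O}

lemma nodeDenom_ne_zero [IsDomain O] [CharZero O] (s : Finset ℕ) : nodeDenom O s ≠ 0 := by
  refine Finset.prod_ne_zero_iff.mpr fun i _ => Finset.prod_ne_zero_iff.mpr fun j hj => ?_
  rw [sub_ne_zero]
  exact_mod_cast (Finset.ne_of_mem_erase hj).symm

lemma natDegree_nodeNumer_lt [Nontrivial O] {s : Finset ℕ} {i : ℕ} (hi : i ∈ s) :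
    (nodeNumer O s i).natDegree < s.card := by
  refine lt_of_le_of_lt (natDegree_C_mul_le _ _) ?_
  refine lt_of_le_of_lt (natDegree_prod_le _ _) ?_
  simp only [natDegree_X_sub_C, Finset.sum_const, smul_eq_mul, mul_one]
  exact Finset.card_erase_lt_of_mem hi

lemma eval_nodeNumer_self {s : Finset ℕ} {i : ℕ} (hi : i ∈ s) :
    (nodeNumer O s i).eval (i : O) = nodeDenom O s := by
  rw [nodeNumer, nodeDenom, eval_mul, eval_C, eval_prod, ← Finset.prod_erase_mul _ _ hi]
  simp

lemma eval_nodeNumer_of_ne {s : Finset ℕ} {i j : ℕ} (hj : j ∈ s) (h : j ≠ i) :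
    (nodeNumer O s i).eval (j : O) = 0 := by
  have : ∏ l ∈ s.erase i, (X - C (l : O)).eval (j : O) = 0 :=
    Finset.prod_eq_zero (Finset.mem_erase.mpr ⟨h, hj⟩) (by simp)
  rw [nodeNumer, eval_mul, eval_prod, this, mul_zero]

lemma nodeDenom_mul_eq_sum [IsDomain O] [CharZero O] {s : Finset ℕ} {L : O[X]}
    (hL : L.degree < s.card) :
    C (nodeDenom O s) * L = ∑ i ∈ s, nodeNumer O s i * C (L.eval (i : O)) := by
  rw [← sub_eq_zero]
  refine eq_zero_of_degree_lt_of_eval_finset_eq_zero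
    (s.map ⟨(Nat.cast : ℕ → O), Nat.cast_injective⟩) ?_ ?_
  · rw [Finset.card_map]
    refine lt_of_le_of_lt (degree_sub_le _ _) (max_lt ?_ ?_)
    · rwa [degree_C_mul (nodeDenom_ne_zero s)]
    · refine lt_of_le_of_lt (degree_sum_le _ _) ?_
      rw [Finset.sup_lt_iff (by simp [bot_lt_iff_ne_bot])]
      intro i hi
      refine lt_of_le_of_lt degree_le_natDegree ?_
      refine lt_of_le_of_lt (Nat.cast_le.mpr (natDegree_mul_C_le _ _)) ?_
      exact_mod_cast natDegree_nodeNumer_lt hi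
  · intro x hx
    obtain ⟨k, hk, rfl⟩ := Finset.mem_map.mp hx
    rw [Function.Embedding.coeFn_mk, eval_sub, eval_mul, eval_C, eval_finsetSum,
      Finset.sum_eq_single k]
    · rw [eval_mul, eval_C, eval_nodeNumer_self hk, sub_self]
    · intro i _ hik
      rw [eval_mul, eval_nodeNumer_of_ne hk hik.symm, zero_mul]
    · exact fun h => absurd hk h

/-- The values of `G(p * X)` at the nodes `s` and at `u` satisfy the interpolation identity modulo
`p ^ #s`, since the coefficient of `X ^ l` is divisible by `p ^ l`. -/
lemma pow_dvd_nodeDenom_mul_sub [IsDomain O] [CharZero O] (s : Finset ℕ) (G : O[X]) (p u : O) :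
    p ^ s.card ∣ nodeDenom O s * G.eval (p * u) -
      ∑ i ∈ s, (nodeNumer O s i).eval u * G.eval (p * i) := by
  have hmon : (X ^ s.card : O[X]).Monic := monic_X_pow _
  set L := (G %ₘ X ^ s.card).comp (C p * X) with hLdef
  have hL : L.degree < s.card := by
    by_cases h0 : G %ₘ X ^ s.card = 0
    · rw [hLdef, h0, zero_comp, degree_zero]
      exact WithBot.bot_lt_coe _
    · have h1 : (G %ₘ X ^ s.card).degree < s.card := by
        have := degree_modByMonic_lt G hmon
        rwa [degree_X_pow] at this
      refine lt_of_le_of_lt degree_le_natDegree ?_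
      have h2 := natDegree_comp_le (p := G %ₘ X ^ s.card) (q := C p * X)
      have h3 : (C p * X : O[X]).natDegree ≤ 1 := (natDegree_C_mul_le _ _).trans natDegree_X_le
      have h4 : (G %ₘ X ^ s.card).natDegree < s.card := (natDegree_lt_iff_degree_lt h0).mpr h1
      have h5 : L.natDegree < s.card := by nlinarith
      exact_mod_cast h5
  have hG : ∀ x, G.eval (p * x) = L.eval x + p ^ s.card * (x ^ s.card *
      (G /ₘ X ^ s.card).eval (p * x)) := by
    intro x
    conv_lhs => rw [← modByMonic_add_div G (X ^ s.card)]
    simp only [hLdef, eval_add, eval_mul, eval_pow, eval_X, eval_comp, eval_C]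
    ring
  have hid := congrArg (eval u) (nodeDenom_mul_eq_sum hL)
  simp only [eval_mul, eval_C, eval_finsetSum] at hid
  simp only [hG, mul_add, Finset.sum_add_distrib]
  rw [hid]
  have : ∀ a b c : O, a + b - (a + c) = b - c := fun a b c => by ring
  rw [this]
  refine dvd_sub (Dvd.intro (nodeDenom O s * (u ^ s.card * (G /ₘ X ^ s.card).eval (p * u)))
    (by ring)) (Finset.dvd_sum fun i _ => Dvd.intro ((nodeNumer O s i).eval u * ((i : O) ^ s.card *
    (G /ₘ X ^ s.card).eval (p * i))) (by ring))

end Lagrange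

end SchinzelRing

namespace SchinzelRing
open Polynomial

/-! ### Bounds for algebraic functions at integers -/

section Bounds
variable {O : Type*} [CommRing O]

lemma abs_eval_natCast_le (σ : O →+* ℝ) (g : O[X]) {c : ℕ} (hc : g.natDegree ≤ c) (t : ℕ) :
    |σ (g.eval (t : O))| ≤ (∑ i ∈ g.support, |σ (g.coeff i)|) * ((t : ℝ) + 1) ^ c := by
  rw [eval_eq_sum, Polynomial.sum, map_sum, Finset.sum_mul]
  refine (Finset.abs_sum_le_sum_abs _ _).trans (Finset.sum_le_sum fun i hi => ?_)
  rw [map_mul, map_pow, map_natCast, abs_mul]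
  refine mul_le_mul_of_nonneg_left ?_ (abs_nonneg _)
  rw [abs_of_nonneg (by positivity)]
  have h1 : (t : ℝ) ^ i ≤ ((t : ℝ) + 1) ^ i := by gcongr; linarith
  have ht : (1 : ℝ) ≤ (t : ℝ) + 1 := by linarith [(Nat.cast_nonneg t : (0 : ℝ) ≤ t)]
  exact h1.trans (pow_le_pow_right₀ ht ((le_natDegree_of_mem_supp i hi).trans hc))

lemma abs_root_le {P : ℝ[X]} (hP : P.Monic) {B : ℝ} (hB0 : 0 ≤ B)
    (hB : ∀ i < P.natDegree, |P.coeff i| ≤ B) {y : ℝ} (hy : P.eval y = 0) : |y| ≤ B + 1 := by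
  have h := IsRoot.norm_lt_cauchyBound hP.ne_zero (a := y) hy
  lift B to NNReal using hB0
  have h2 : P.cauchyBound ≤ B + 1 := by
    rw [cauchyBound, hP.leadingCoeff, nnnorm_one, div_one]
    refine add_le_add (Finset.sup_le fun i hi => ?_) le_rfl
    rw [← NNReal.coe_le_coe]
    exact hB i (Finset.mem_range.mp hi)
  have h3 := (h.trans_le h2).le
  rw [← NNReal.coe_le_coe] at h3
  simpa using h3

/-- The roots of a monic polynomial over `O[X]`, specialized at natural numbers, grow at most
polynomially. -/
lemma exists_root_bound {ι : Type*} [Fintype ι] (σ : ι → O →+* ℝ) {Q : O[X][X]} (hQ : Q.Monic) :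
    ∃ (B : ℝ) (c : ℕ), 0 ≤ B ∧ ∀ (t : ℕ) (y : O), (Q.map (evalRingHom (t : O))).eval y = 0 →
      ∀ j, |σ j y| ≤ B * ((t : ℝ) + 1) ^ c := by
  set c := Q.support.sup fun i => (Q.coeff i).natDegree with hc
  have hci : ∀ i, (Q.coeff i).natDegree ≤ c := by
    intro i
    by_cases hi : i ∈ Q.support
    · exact Finset.le_sup (f := fun i => (Q.coeff i).natDegree) hi
    · rw [notMem_support_iff.mp hi]
      simp
  set a : ι → ℕ → ℝ := fun j i => ∑ l ∈ (Q.coeff i).support, |σ j ((Q.coeff i).coeff l)| with ha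
  have ha0 : ∀ j i, 0 ≤ a j i := fun j i => Finset.sum_nonneg fun _ _ => abs_nonneg _
  set B := ∑ j, ∑ i ∈ Finset.range Q.natDegree, a j i with hBdef
  have hB0 : 0 ≤ B := Finset.sum_nonneg fun j _ => Finset.sum_nonneg fun i _ => ha0 j i
  refine ⟨B + 1, c, by positivity, fun t y hy j => ?_⟩
  have : Nontrivial O := (σ j).domain_nontrivial
  have ht : (1 : ℝ) ≤ ((t : ℝ) + 1) ^ c :=
    one_le_pow₀ (by linarith [(Nat.cast_nonneg t : (0 : ℝ) ≤ t)])
  have hmon : ((Q.map (evalRingHom (t : O))).map (σ j)).Monic := (hQ.map _).map _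
  have hy' : ((Q.map (evalRingHom (t : O))).map (σ j)).eval (σ j y) = 0 := by
    rw [eval_map, eval₂_hom, hy, map_zero]
  have hdeg : ((Q.map (evalRingHom (t : O))).map (σ j)).natDegree = Q.natDegree := by
    rw [(hQ.map _).natDegree_map, hQ.natDegree_map]
  refine (abs_root_le hmon (B := B * ((t : ℝ) + 1) ^ c) (by positivity) (fun i hi => ?_)
    hy').trans (by nlinarith)
  rw [coeff_map, coeff_map, coe_evalRingHom]
  refine (abs_eval_natCast_le (σ j) _ (hci i) t).trans ?_
  refine mul_le_mul_of_nonneg_right ?_ (by positivity)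
  rw [hdeg] at hi
  refine (Finset.single_le_sum (f := a j) (fun i _ => ha0 j i) (Finset.mem_range.mpr hi)).trans ?_
  exact Finset.single_le_sum (f := fun j => ∑ i ∈ Finset.range Q.natDegree, a j i)
    (fun j _ => Finset.sum_nonneg fun i _ => ha0 j i) (Finset.mem_univ j)

/-- In a ring with a discrete system of real embeddings, a small multiple of `m` is zero. -/
lemma eq_zero_of_dvd_of_abs_lt {ι : Type*} {σ : ι → O →+* ℝ}
    (hσ : ∀ b : O, (∀ j, |σ j b| < 1) → b = 0) {m : ℕ} {a : O} (hm : (m : O) ∣ a)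
    (ha : ∀ j, |σ j a| < m) : a = 0 := by
  obtain ⟨b, rfl⟩ := hm
  rw [hσ b, mul_zero]
  intro j
  have h := ha j
  rw [map_mul, map_natCast, abs_mul, Nat.abs_cast] at h
  have hm0 : (0 : ℝ) < m := by
    rcases Nat.eq_zero_or_pos m with rfl | h'
    · simp at h
    · exact_mod_cast h'
  by_contra h1
  push Not at h1
  nlinarith

end Bounds

/-! ### Integral points in a residue class -/

section ResidueClass
variable {O : Type*} [CommRing O] [IsDomain O] [CharZero O] {ι : Type*} [Fintype ι]
  (σ : ι → O →+* ℝ)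

/-- A bound for the coefficients in the interpolation identities with nodes below `U`. -/
noncomputable def interpBound (U : ℕ) : ℝ :=
  ∑ s ∈ (Finset.range U).powerset, ∑ u ∈ Finset.range U, ∑ j,
    (|σ j (nodeDenom O s)| + ∑ i ∈ s, |σ j ((nodeNumer O s i).eval (u : O))|)

variable {σ}

omit [IsDomain O] [CharZero O] in
lemma le_interpBound {U : ℕ} {s : Finset ℕ} (hs : s ⊆ Finset.range U) {u : ℕ} (hu : u < U) (j : ι) :
    |σ j (nodeDenom O s)| + ∑ i ∈ s, |σ j ((nodeNumer O s i).eval (u : O))| ≤ interpBound σ U := by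
  have h0 : ∀ (s : Finset ℕ) (u : ℕ) (j : ι),
      0 ≤ |σ j (nodeDenom O s)| + ∑ i ∈ s, |σ j ((nodeNumer O s i).eval (u : O))| :=
    fun s u j => add_nonneg (abs_nonneg _) (Finset.sum_nonneg fun _ _ => abs_nonneg _)
  refine (Finset.single_le_sum (f := fun j => |σ j (nodeDenom O s)| +
    ∑ i ∈ s, |σ j ((nodeNumer O s i).eval (u : O))|) (fun j _ => h0 s u j)
    (Finset.mem_univ j)).trans ?_
  refine (Finset.single_le_sum (f := fun u => ∑ j, (|σ j (nodeDenom O s)| +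
    ∑ i ∈ s, |σ j ((nodeNumer O s i).eval ((u : ℕ) : O))|))
    (fun u _ => Finset.sum_nonneg fun j _ => h0 s u j) (Finset.mem_range.mpr hu)).trans ?_
  exact Finset.single_le_sum (f := fun s => ∑ u ∈ Finset.range U, ∑ j, (|σ j (nodeDenom O s)| +
    ∑ i ∈ s, |σ j ((nodeNumer O s i).eval ((u : ℕ) : O))|))
    (fun s _ => Finset.sum_nonneg fun u _ => Finset.sum_nonneg fun j _ => h0 s u j)
    (Finset.mem_powerset.mpr hs)

omit [IsDomain O] [CharZero O] in
lemma mem_span_C_X {p : O} {g : O[X]} (h : p ∣ g.eval 0) : g ∈ Ideal.span {C p, X} := by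
  rw [← divX_mul_X_add g]
  refine Ideal.add_mem _ (Ideal.mul_mem_left _ _ (Ideal.subset_span (by simp))) ?_
  rw [← coeff_zero_eq_eval_zero] at h
  obtain ⟨b, hb⟩ := h
  rw [hb, C_mul]
  exact Ideal.mul_mem_right _ _ (Ideal.subset_span (by simp))

omit [IsDomain O] [CharZero O] in
lemma pow_dvd_eval_of_mem {p u : O} {m : ℕ} {g : O[X]} (h : g ∈ (Ideal.span {C p, X}) ^ m) :
    p ^ m ∣ g.eval (p * u) := by
  have h1 := Ideal.mem_map_of_mem (evalRingHom (p * u)) h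
  rw [Ideal.map_pow, Ideal.map_span, Set.image_pair] at h1
  have h2 : Ideal.span {(evalRingHom (p * u)) (C p), (evalRingHom (p * u)) X} ≤ Ideal.span {p} := by
    rw [Ideal.span_le]
    rintro x (rfl | rfl) <;> simp [Ideal.mem_span_singleton]
  have h3 := Ideal.pow_right_mono h2 m h1
  rwa [Ideal.span_singleton_pow, Ideal.mem_span_singleton] at h3

omit [IsDomain O] [CharZero O] in
/-- The `y`-coordinates of points in a simple residue class are congruent, modulo any power of `p`,
to the values of one polynomial in `p * u`. -/
lemma exists_hensel_polynomial {Q : O[X][X]} {p : O} {t₀ : O} {y₀ v : O}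
    (h₀ : p ∣ (Q.map (evalRingHom t₀)).eval y₀)
    (hv : p ∣ v * (derivative (Q.map (evalRingHom t₀))).eval y₀ - 1) (m : ℕ) :
    ∃ G : O[X], ∀ u y : O, (Q.map (evalRingHom (t₀ + p * u))).eval y = 0 → p ∣ y - y₀ →
      p ^ m ∣ y - G.eval (p * u) := by
  set f : O[X][X] := Q.map (compRingHom (C t₀ + X)) with hf
  have hcomp : ∀ x : O, (evalRingHom x).comp (compRingHom (C t₀ + X)) =
      evalRingHom (t₀ + x) := by
    intro x
    refine ringHom_ext' ?_ ?_
    · ext; simp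
    · simp
  have hfx : ∀ x : O, f.map (evalRingHom x) = Q.map (evalRingHom (t₀ + x)) := by
    intro x
    rw [hf, map_map, hcomp]
  have heval : ∀ (g : O[X][X]) (G : O[X]) (x : O),
      (g.eval G).eval x = (g.map (evalRingHom x)).eval (G.eval x) := by
    intro g G x
    rw [eval_map, ← coe_evalRingHom x, eval₂_hom]
  obtain ⟨G, hG1, hG2⟩ := exists_eval_mem_pow (I := Ideal.span {C p, X}) (f := f) (v := C v)
    (y₀ := C y₀) (mem_span_C_X (by rw [heval, hfx]; simpa using h₀))
    (mem_span_C_X (by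
      rw [eval_sub, eval_mul, heval, ← derivative_map, hfx]; simpa using hv)) m
  refine ⟨G, fun u y hy hyy => ?_⟩
  have hGy : p ∣ G.eval (p * u) - y₀ := by
    have := pow_dvd_eval_of_mem (u := u) (m := 1) (by rwa [pow_one])
    simpa using this
  rw [← Ideal.mem_span_singleton, ← Ideal.span_singleton_pow]
  refine sub_mem_pow_of_eval_mem_pow (f := Q.map (evalRingHom (t₀ + p * u))) (v := v) ?_ ?_ ?_ ?_
  · rw [Ideal.mem_span_singleton]
    have := dvd_sub hyy hGy
    rwa [sub_sub_sub_cancel_right] at this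
  · rw [Ideal.span_singleton_pow, Ideal.mem_span_singleton, ← hfx, ← heval]
    exact pow_dvd_eval_of_mem hG2
  · rw [hy]; exact Ideal.zero_mem _
  · rw [Ideal.mem_span_singleton]
    have h1 : p ∣ (derivative (Q.map (evalRingHom (t₀ + p * u)))).eval (G.eval (p * u)) -
        (derivative (Q.map (evalRingHom (t₀ + p * u)))).eval y₀ :=
      hGy.trans (sub_dvd_eval_sub _ _ _)
    have h2 : p ∣ (derivative (Q.map (evalRingHom (t₀ + p * u)))).eval y₀ -
        (derivative (Q.map (evalRingHom t₀))).eval y₀ := by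
      have h3 : ∀ x : O, (derivative (Q.map (evalRingHom x))).eval y₀ =
          ((derivative Q).eval (C y₀)).eval x := by
        intro x
        rw [heval, eval_C, derivative_map]
      rw [h3, h3]
      refine dvd_trans ?_ (sub_dvd_eval_sub _ _ _)
      simp
    have h4 : v * (derivative (Q.map (evalRingHom (t₀ + p * u)))).eval (G.eval (p * u)) - 1 =
        v * (((derivative (Q.map (evalRingHom (t₀ + p * u)))).eval (G.eval (p * u)) -
        (derivative (Q.map (evalRingHom (t₀ + p * u)))).eval y₀) +
        ((derivative (Q.map (evalRingHom (t₀ + p * u)))).eval y₀ -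
        (derivative (Q.map (evalRingHom t₀))).eval y₀)) +
        (v * (derivative (Q.map (evalRingHom t₀))).eval y₀ - 1) := by ring
    rw [h4]
    exact dvd_add (dvd_mul_of_dvd_right (dvd_add h1 h2) _) hv

/-- A simple residue class modulo `p` contains boundedly many small points `(t₀ + p * u, y)`, `u < U`,
of the curve `Q = 0`: they lie on the graph of a rational function `H / V`, where `H` is a polynomial of
degree less than `M` and `V` is constant. The hypothesis `hnr` says that `Q(t₀ + p * X, Y)` has no root
of this form. -/
theorem card_le_of_residue_class (hσ : ∀ b : O, (∀ j, |σ j b| < 1) → b = 0)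
    {Q : O[X][X]} (hQ : Q.Monic) {e M U p t₀ : ℕ} (he : ∀ i, (Q.coeff i).natDegree ≤ e)
    (hnr : ∀ V : O, V ≠ 0 → ∀ H : O[X],
      ((Q.map (compRingHom (C (t₀ : O) + C (p : O) * X))).scaleRoots (C V)).eval H ≠ 0)
    {y₀ v : O} (h₀ : (p : O) ∣ (Q.map (evalRingHom (t₀ : O))).eval y₀)
    (hv : (p : O) ∣ v * (derivative (Q.map (evalRingHom (t₀ : O)))).eval y₀ - 1)
    {B : ℝ} (hbig : interpBound σ U * B < (p : ℝ) ^ M)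
    {S : Finset ℕ} (hS : S ⊆ Finset.range U) {y : ℕ → O}
    (hy : ∀ u ∈ S, (Q.map (evalRingHom ((t₀ : O) + p * u))).eval (y u) = 0)
    (hyy : ∀ u ∈ S, (p : O) ∣ y u - y₀) (hB : ∀ u ∈ S, ∀ j, |σ j (y u)| ≤ B) :
    S.card ≤ M + (e + Q.natDegree * M) := by
  by_contra! hlt
  obtain ⟨s, hsS, hcard⟩ := Finset.exists_subset_card_eq (show M ≤ S.card by omega)
  obtain ⟨G, hG⟩ := exists_hensel_polynomial h₀ hv M
  set V : O := nodeDenom O s with hV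
  set H : O[X] := ∑ i ∈ s, nodeNumer O s i * C (y i) with hH
  have hval : ∀ u ∈ S, V * y u = H.eval (u : O) := by
    intro u hu
    rw [← sub_eq_zero]
    refine eq_zero_of_dvd_of_abs_lt hσ (m := p ^ M) ?_ ?_
    · push_cast
      have h1 := pow_dvd_nodeDenom_mul_sub s G (p : O) (u : O)
      rw [hcard] at h1
      have h2 : V * y u - H.eval (u : O) = V * (y u - G.eval ((p : O) * u)) -
          ∑ i ∈ s, (nodeNumer O s i).eval (u : O) * (y i - G.eval ((p : O) * i)) +
          (nodeDenom O s * G.eval ((p : O) * u) -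
            ∑ i ∈ s, (nodeNumer O s i).eval (u : O) * G.eval ((p : O) * i)) := by
        simp only [hV, hH, eval_finsetSum, eval_mul, eval_C, mul_sub, Finset.sum_sub_distrib]
        ring
      rw [h2]
      refine dvd_add (dvd_sub (dvd_mul_of_dvd_right (hG _ _ (hy u hu) (hyy u hu)) _)
        (Finset.dvd_sum fun i hi => dvd_mul_of_dvd_right (hG _ _ (hy i (hsS hi))
          (hyy i (hsS hi))) _)) h1
    · intro j
      have hB0 : 0 ≤ B := (abs_nonneg _).trans (hB u hu j)
      push_cast
      refine lt_of_le_of_lt ?_ hbig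
      refine le_trans ?_ (mul_le_mul_of_nonneg_right
        (le_interpBound (hsS.trans hS) (Finset.mem_range.mp (hS hu)) j) hB0)
      rw [map_sub, map_mul, hH, eval_finsetSum, map_sum, add_mul, Finset.sum_mul]
      refine (abs_sub _ _).trans (add_le_add ?_ ?_)
      · rw [abs_mul]
        exact mul_le_mul_of_nonneg_left (hB u hu j) (abs_nonneg _)
      · refine (Finset.abs_sum_le_sum_abs _ _).trans (Finset.sum_le_sum fun i hi => ?_)
        rw [eval_mul, eval_C, map_mul, abs_mul]
        exact mul_le_mul_of_nonneg_left (hB i (hsS hi) j) (abs_nonneg _)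
  -- the points of the class are roots of one polynomial of bounded degree
  set Q' := Q.map (compRingHom (C (t₀ : O) + C (p : O) * X)) with hQ'
  have hQ'mon : Q'.Monic := hQ.map _
  set R := (Q'.scaleRoots (C V)).eval H with hR
  have hR0 : R ≠ 0 := hnr V (nodeDenom_ne_zero s) H
  have hHdeg : H.natDegree ≤ M := by
    refine natDegree_sum_le_of_forall_le _ _ fun i hi => ?_
    refine (natDegree_mul_C_le _ _).trans ?_
    rw [← hcard]
    exact (natDegree_nodeNumer_lt hi).le
  have hlin : (C (t₀ : O) + C (p : O) * X).natDegree ≤ 1 := by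
    refine (natDegree_add_le _ _).trans ?_
    simpa using (natDegree_C_mul_le (p : O) X).trans natDegree_X_le
  have hRdeg : R.natDegree ≤ e + Q.natDegree * M := by
    rw [hR, eval_eq_sum_range, natDegree_scaleRoots, hQ.natDegree_map]
    refine natDegree_sum_le_of_forall_le _ _ fun i hi => ?_
    have hi' : i ≤ Q.natDegree := Nat.lt_succ_iff.mp (Finset.mem_range.mp hi)
    rw [coeff_scaleRoots, ← C_pow]
    refine natDegree_mul_le.trans (add_le_add ((natDegree_mul_C_le _ _).trans ?_) ?_)
    · rw [hQ', coeff_map, coe_compRingHom_apply]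
      refine natDegree_comp_le.trans ?_
      calc (Q.coeff i).natDegree * _ ≤ (Q.coeff i).natDegree * 1 := Nat.mul_le_mul_left _ hlin
        _ ≤ e := by rw [mul_one]; exact he i
    · exact natDegree_pow_le.trans (Nat.mul_le_mul hi' hHdeg)
  have hroot : ∀ u ∈ S, R.eval (u : O) = 0 := by
    intro u hu
    have hcomp : (evalRingHom (u : O)).comp (compRingHom (C (t₀ : O) + C (p : O) * X)) =
        evalRingHom ((t₀ : O) + p * u) := by
      refine ringHom_ext' ?_ ?_
      · ext; simp
      · simp
    have h1 : R.eval (u : O) =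
        ((Q.map (evalRingHom ((t₀ : O) + p * u))).scaleRoots V).eval (V * y u) := by
      rw [hval u hu, ← hcomp, ← map_map, ← hQ', ← coe_evalRingHom, hR, ← eval₂_hom, ← eval_map,
        map_scaleRoots _ _ _ (by rw [hQ'mon.leadingCoeff, map_one]; exact one_ne_zero)]
      simp
    rw [h1, scaleRoots_eval_mul, hy u hu, mul_zero]
  refine hR0 (eq_zero_of_natDegree_lt_card_of_eval_eq_zero' R
    (S.map ⟨(Nat.cast : ℕ → O), Nat.cast_injective⟩) ?_ ?_)
  · intro x hx
    obtain ⟨u, hu, rfl⟩ := Finset.mem_map.mp hx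
    exact hroot u hu
  · rw [Finset.card_map]
    omega

end ResidueClass

/-! ### Counting parameters at which a polynomial has an integral root -/

section Counting
variable {O : Type*} [CommRing O] [IsDomain O] [CharZero O] {ι : Type*} [Fintype ι]
  {σ : ι → O →+* ℝ}

/-- `p` is inert in `O`: all elements that are not divisible by `p` are invertible modulo `p`. -/
def IsInert (O : Type*) [CommRing O] (p : ℕ) : Prop :=
  ∀ a : O, ¬ (p : O) ∣ a → ∃ v, (p : O) ∣ v * a - 1

omit [IsDomain O] [CharZero O] in
lemma not_dvd_of_abs_lt (hσ : ∀ b : O, (∀ j, |σ j b| < 1) → b = 0) {a : O} (ha : a ≠ 0) {p : ℕ}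
    (hp : ∑ j, |σ j a| < p) : ¬ (p : O) ∣ a := fun h =>
  ha (eq_zero_of_dvd_of_abs_lt hσ h fun j => lt_of_le_of_lt
    (Finset.single_le_sum (f := fun j => |σ j a|) (fun _ _ => abs_nonneg _) (Finset.mem_univ j)) hp)

omit [IsDomain O] [Fintype ι] in
lemma IsInert.isPrime_span (hσ : ∀ b : O, (∀ j, |σ j b| < 1) → b = 0) {p : ℕ} (hp1 : 1 < p)
    (hp : IsInert O p) : (Ideal.span {(p : O)}).IsPrime := by
  have hnu : ¬ (p : O) ∣ 1 := by
    intro h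
    refine one_ne_zero (eq_zero_of_dvd_of_abs_lt hσ h fun j => ?_)
    rw [map_one, abs_one]
    exact_mod_cast hp1
  refine ⟨fun h => hnu ?_, fun {a b} hab => ?_⟩
  · rw [← Ideal.mem_span_singleton, h]; trivial
  · rw [Ideal.mem_span_singleton] at hab ⊢
    rw [Ideal.mem_span_singleton]
    by_cases ha : (p : O) ∣ a
    · exact Or.inl ha
    · obtain ⟨v, hv⟩ := hp a ha
      right
      have : b = v * (a * b) - (v * a - 1) * b := by ring
      rw [this]
      exact dvd_sub (dvd_mul_of_dvd_right hab v) (dvd_mul_of_dvd_left hv b)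

omit [IsDomain O] [Fintype ι] in
lemma natCast_injOn_mod (hσ : ∀ b : O, (∀ j, |σ j b| < 1) → b = 0) {p : ℕ} :
    Set.InjOn (fun t : ℕ => Ideal.Quotient.mk (Ideal.span {(p : O)}) (t : O))
      (Finset.range p : Set ℕ) := by
  intro a ha b hb hab
  simp only [Finset.coe_range, Set.mem_Iio] at ha hb
  rw [Ideal.Quotient.eq, Ideal.mem_span_singleton] at hab
  have h := eq_zero_of_dvd_of_abs_lt hσ hab fun j => by
    rw [map_sub, map_natCast, map_natCast, abs_lt]
    have h1 : (a : ℝ) < p := by exact_mod_cast ha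
    have h2 : (b : ℝ) < p := by exact_mod_cast hb
    have h3 : (0 : ℝ) ≤ a := Nat.cast_nonneg a
    have h4 : (0 : ℝ) ≤ b := Nat.cast_nonneg b
    constructor <;> linarith
  rw [sub_eq_zero] at h
  exact_mod_cast h

omit [IsDomain O] [Fintype ι] in
/-- A polynomial that is nonzero modulo an inert `p` has at most as many zeros modulo `p` among
`0, …, p - 1` as its degree. -/
lemma card_filter_dvd_eval_le (hσ : ∀ b : O, (∀ j, |σ j b| < 1) → b = 0) {p : ℕ} (hp1 : 1 < p)
    (hp : IsInert O p) {D : O[X]} {i : ℕ} (hD : ¬ (p : O) ∣ D.coeff i) [DecidablePred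
      fun t : ℕ => (p : O) ∣ D.eval (t : O)] :
    ((Finset.range p).filter fun t : ℕ => (p : O) ∣ D.eval (t : O)).card ≤ D.natDegree := by
  have := hp.isPrime_span hσ hp1
  set q := Ideal.Quotient.mk (Ideal.span {(p : O)}) with hq
  have hD0 : D.map q ≠ 0 := by
    intro h
    have := congrArg (fun g => g.coeff i) h
    simp only [coeff_map, coeff_zero] at this
    rw [hq, Ideal.Quotient.eq_zero_iff_mem, Ideal.mem_span_singleton] at this
    exact hD this
  refine le_trans ?_ ((card_roots' (D.map q)).trans natDegree_map_le)
  classical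
  refine le_trans ?_ (Multiset.toFinset_card_le _)
  refine Finset.card_le_card_of_injOn (fun t : ℕ => q (t : O)) ?_ ?_
  · intro t ht
    rw [Finset.mem_coe, Finset.mem_filter] at ht
    rw [Finset.mem_coe, Multiset.mem_toFinset, mem_roots hD0, IsRoot, eval_map, eval₂_hom, hq,
      Ideal.Quotient.eq_zero_iff_mem, Ideal.mem_span_singleton]
    exact ht.2
  · exact (natCast_injOn_mod hσ).mono (by
      rw [Finset.coe_subset]; exact Finset.filter_subset _ _)

/-- The number of `t < p * U` such that `Q(t, Y)` has a root in `O`, for a separable `Q` without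
roots in the field of rational functions. Of the `p` residue classes, `δ` are singular modulo `p`, and
the others contain boundedly many points each. -/
theorem exists_card_roots_le (hσ : ∀ b : O, (∀ j, |σ j b| < 1) → b = 0)
    {Q : O[X][X]} (hQ : Q.Monic) {D : O[X]} (hD : D ≠ 0) {A B : O[X][X]}
    (hAB : A * Q + B * derivative Q = C D)
    (hnr : ∀ (V : O) (t₀ p : ℕ), V ≠ 0 → p ≠ 0 → ∀ H : O[X],
      ((Q.map (compRingHom (C (t₀ : O) + C (p : O) * X))).scaleRoots (C V)).eval H ≠ 0) :
    ∃ δ R : ℕ, ∀ U : ℕ, ∃ p₀ : ℕ, ∀ p ≥ p₀, IsInert O p → ∀ T ⊆ Finset.range (p * U),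
      (∀ t ∈ T, ∃ y, (Q.map (evalRingHom (t : O))).eval y = 0) → T.card ≤ δ * U + p * R := by
  classical
  obtain ⟨B₀, c, hB₀, hbound⟩ := exists_root_bound σ hQ
  set e := Q.support.sup fun i => (Q.coeff i).natDegree with he
  have hei : ∀ i, (Q.coeff i).natDegree ≤ e := by
    intro i
    by_cases hi : i ∈ Q.support
    · exact Finset.le_sup (f := fun i => (Q.coeff i).natDegree) hi
    · rw [notMem_support_iff.mp hi]
      simp
  set M := c + 1 with hM
  refine ⟨D.natDegree, Q.natDegree * (M + (e + Q.natDegree * M)), fun U => ?_⟩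
  obtain ⟨n₁, hn₁⟩ := exists_nat_gt (interpBound σ U * (B₀ * (U : ℝ) ^ c))
  obtain ⟨n₂, hn₂⟩ := exists_nat_gt (∑ j, |σ j D.leadingCoeff|)
  refine ⟨n₁ + n₂ + 2, fun p hp hinert T hT hroot => ?_⟩
  have hp1 : 1 < p := by omega
  have := hinert.isPrime_span hσ hp1
  have hlc : ¬ (p : O) ∣ D.coeff D.natDegree := by
    refine not_dvd_of_abs_lt hσ (leadingCoeff_ne_zero.mpr hD) (hn₂.trans_le ?_)
    exact_mod_cast (by omega : n₂ ≤ p)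
  have hbig : interpBound σ U * (B₀ * ((p * U : ℕ) : ℝ) ^ c) < (p : ℝ) ^ M := by
    have h1 : (n₁ : ℝ) ≤ p := by exact_mod_cast (by omega : n₁ ≤ p)
    have h2 : (0 : ℝ) < (p : ℝ) ^ c := by
      have : (0 : ℝ) < p := by exact_mod_cast (by omega : 0 < p)
      positivity
    rw [hM, pow_succ, Nat.cast_mul, mul_pow]
    nlinarith
  -- a root for each parameter in `T`
  have hchoose : ∃ y : ℕ → O, ∀ t ∈ T, (Q.map (evalRingHom (t : O))).eval (y t) = 0 := by
    choose! y hy using hroot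
    exact ⟨y, hy⟩
  obtain ⟨y, hy⟩ := hchoose
  set S : ℕ → Finset ℕ := fun t₀ => (Finset.range U).filter fun u => t₀ + p * u ∈ T with hS
  have hTsub : T ⊆ (Finset.range p).biUnion fun t₀ => (S t₀).image fun u => t₀ + p * u := by
    intro t ht
    have h1 := Finset.mem_range.mp (hT ht)
    rw [Finset.mem_biUnion]
    refine ⟨t % p, Finset.mem_range.mpr (Nat.mod_lt _ (by omega)), ?_⟩
    rw [Finset.mem_image]
    refine ⟨t / p, ?_, Nat.mod_add_div t p⟩
    rw [hS, Finset.mem_filter, Finset.mem_range, Nat.mod_add_div]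
    exact ⟨Nat.div_lt_of_lt_mul h1, ht⟩
  have hclass : ∀ t₀ : ℕ, ¬ (p : O) ∣ D.eval (t₀ : O) →
      (S t₀).card ≤ Q.natDegree * (M + (e + Q.natDegree * M)) := by
    intro t₀ hreg
    set q := Ideal.Quotient.mk (Ideal.span {(p : O)}) with hq
    set Q₀ := Q.map (evalRingHom (t₀ : O)) with hQ₀
    have hQ₀q : Q₀.map q ≠ 0 := ((hQ.map _).map q).ne_zero
    have hmap : ∀ u ∈ S t₀, (p : O) ∣ Q₀.eval (y (t₀ + p * u)) := by
      intro u hu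
      have h1 := hy _ (Finset.mem_filter.mp hu).2
      have heval : ∀ x : O, (Q.map (evalRingHom x)).eval (y (t₀ + p * u)) =
          (Q.eval (C (y (t₀ + p * u)))).eval x := by
        intro x
        conv_rhs => rw [← coe_evalRingHom x, ← eval₂_hom, ← eval_map]
        simp
      rw [hQ₀, heval]
      rw [heval] at h1
      have h2 := sub_dvd_eval_sub (t₀ : O) ((t₀ + p * u : ℕ) : O) (Q.eval (C (y (t₀ + p * u))))
      rw [h1, sub_zero] at h2
      refine dvd_trans ?_ h2
      push_cast
      exact ⟨-u, by ring⟩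
    have hsub : S t₀ ⊆ (Q₀.map q).roots.toFinset.biUnion fun z =>
        (S t₀).filter fun u => q (y (t₀ + p * u)) = z := by
      intro u hu
      rw [Finset.mem_biUnion]
      refine ⟨q (y (t₀ + p * u)), ?_, Finset.mem_filter.mpr ⟨hu, rfl⟩⟩
      rw [Multiset.mem_toFinset, mem_roots hQ₀q, IsRoot, eval_map, eval₂_hom, hq,
        Ideal.Quotient.eq_zero_iff_mem, Ideal.mem_span_singleton]
      exact hmap u hu
    refine (Finset.card_le_card hsub).trans ((Finset.card_biUnion_le_card_mul _ _
      (M + (e + Q.natDegree * M)) ?_).trans ?_)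
    · intro z _
      rcases Finset.eq_empty_or_nonempty ((S t₀).filter fun u => q (y (t₀ + p * u)) = z) with h | h
      · rw [h]; simp
      obtain ⟨u₀, hu₀⟩ := h
      obtain ⟨hu₀S, hu₀z⟩ := Finset.mem_filter.mp hu₀
      have hsimple : ¬ (p : O) ∣ (derivative Q₀).eval (y (t₀ + p * u₀)) := by
        intro h
        apply hreg
        have h1 := congrArg (fun g => (g.map (evalRingHom (t₀ : O))).eval (y (t₀ + p * u₀))) hAB
        simp only [Polynomial.map_add, Polynomial.map_mul, eval_add, eval_mul, map_C, eval_C,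
          coe_evalRingHom] at h1
        rw [← derivative_map] at h1
        rw [← h1]
        exact dvd_add (dvd_mul_of_dvd_right (hmap u₀ hu₀S) _) (dvd_mul_of_dvd_right h _)
      obtain ⟨v, hv⟩ := hinert _ hsimple
      refine card_le_of_residue_class hσ hQ hei (fun V hV H => hnr V t₀ p hV (by omega) H)
        (hmap u₀ hu₀S) hv hbig ((Finset.filter_subset _ _).trans (Finset.filter_subset _ _))
        (y := fun u => y (t₀ + p * u)) ?_ ?_ ?_
      · intro u hu
        have := hy _ (Finset.mem_filter.mp (Finset.mem_filter.mp hu).1).2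
        push_cast at this
        exact this
      · intro u hu
        have h1 := (Finset.mem_filter.mp hu).2
        rw [← hu₀z, hq, Ideal.Quotient.eq, Ideal.mem_span_singleton] at h1
        exact h1
      · intro u hu j
        have h1 := (Finset.mem_filter.mp (Finset.mem_filter.mp hu).1).2
        refine (hbound _ _ (hy _ h1) j).trans ?_
        have h2 : t₀ + p * u + 1 ≤ p * U := Finset.mem_range.mp (hT h1)
        have h3 : ((t₀ + p * u : ℕ) : ℝ) + 1 ≤ ((p * U : ℕ) : ℝ) := by exact_mod_cast h2
        gcongr
    · refine Nat.mul_le_mul_right _ ?_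
      refine (Multiset.toFinset_card_le _).trans ((card_roots' _).trans ?_)
      rw [((hQ.map _).natDegree_map q), hQ.natDegree_map]
  set R := Q.natDegree * (M + (e + Q.natDegree * M)) with hR
  calc T.card ≤ ∑ t₀ ∈ Finset.range p, (S t₀).card :=
        (Finset.card_le_card hTsub).trans (Finset.card_biUnion_le.trans
          (Finset.sum_le_sum fun t₀ _ => Finset.card_image_le))
    _ ≤ ∑ t₀ ∈ Finset.range p, ((if (p : O) ∣ D.eval (t₀ : O) then U else 0) + R) := by
        refine Finset.sum_le_sum fun t₀ _ => ?_
        split_ifs with h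
        · refine le_trans ?_ (Nat.le_add_right _ _)
          exact (Finset.card_filter_le _ _).trans (Finset.card_range U).le
        · exact (hclass t₀ h).trans (Nat.le_add_left _ _)
    _ ≤ D.natDegree * U + p * R := by
        rw [Finset.sum_add_distrib, ← Finset.sum_filter, Finset.sum_const, Finset.sum_const,
          Finset.card_range, smul_eq_mul, smul_eq_mul]
        exact Nat.add_le_add_right (Nat.mul_le_mul_right _
          (card_filter_dvd_eval_le hσ hp1 hinert hlc)) _

/-- There is a parameter at which none of finitely many polynomials has a root in `O`: for large `p` and
`U` the parameters below `p * U` with a root are too few. -/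
theorem exists_forall_eval_ne_zero (hσ : ∀ b : O, (∀ j, |σ j b| < 1) → b = 0)
    (hinert : ∀ n, ∃ p ≥ n, IsInert O p) {κ : Type*} [Fintype κ] (Q : κ → O[X][X])
    (hQ : ∀ l, (Q l).Monic) (D : κ → O[X]) (hD : ∀ l, D l ≠ 0) (A B : κ → O[X][X])
    (hAB : ∀ l, A l * Q l + B l * derivative (Q l) = C (D l))
    (hnr : ∀ (l : κ) (V : O) (t₀ p : ℕ), V ≠ 0 → p ≠ 0 → ∀ H : O[X],
      (((Q l).map (compRingHom (C (t₀ : O) + C (p : O) * X))).scaleRoots (C V)).eval H ≠ 0)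
    (E : Finset ℕ) :
    ∃ t : ℕ, t ∉ E ∧ ∀ l y, ((Q l).map (evalRingHom (t : O))).eval y ≠ 0 := by
  classical
  choose δ R hδR using fun l => exists_card_roots_le hσ (hQ l) (hD l) (hAB l) (hnr l)
  set U := ∑ l, R l + 1 with hU
  choose p₀ hp₀ using fun l => hδR l U
  obtain ⟨p, hp, hpi⟩ := hinert (∑ l, p₀ l + (∑ l, δ l * U + E.card + 1))
  by_contra! hcon
  have hcover : Finset.range (p * U) ⊆ E ∪ Finset.univ.biUnion fun l =>
      (Finset.range (p * U)).filter fun t : ℕ =>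
        ∃ y, ((Q l).map (evalRingHom (t : O))).eval y = 0 := by
    intro t ht
    by_cases htE : t ∈ E
    · exact Finset.mem_union_left _ htE
    · obtain ⟨l, y, hy⟩ := hcon t htE
      exact Finset.mem_union_right _ (Finset.mem_biUnion.mpr ⟨l, Finset.mem_univ l,
        Finset.mem_filter.mpr ⟨ht, y, hy⟩⟩)
  have h1 := (Finset.card_le_card hcover).trans ((Finset.card_union_le _ _).trans
    (Nat.add_le_add_left Finset.card_biUnion_le _))
  have h2 : ∑ l, ((Finset.range (p * U)).filter fun t : ℕ =>
      ∃ y, ((Q l).map (evalRingHom (t : O))).eval y = 0).card ≤ ∑ l, (δ l * U + p * R l) := by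
    refine Finset.sum_le_sum fun l _ => hp₀ l p ?_ hpi _ (Finset.filter_subset _ _)
      fun t ht => (Finset.mem_filter.mp ht).2
    have := Finset.single_le_sum (f := p₀) (fun _ _ => Nat.zero_le _) (Finset.mem_univ l)
    omega
  rw [Finset.card_range] at h1
  rw [Finset.sum_add_distrib, ← Finset.mul_sum] at h2
  have h3 : p * U = p * ∑ l, R l + p := by rw [hU]; ring
  omega

end Counting

/-! ### Rescaling roots and making polynomials monic -/

section ScaleRoots
variable {R : Type*} [CommRing R]

/-- Multiplying the roots by a unit preserves irreducibility. -/
lemma irreducible_scaleRoots_iff {r : R} (hr : IsUnit r) (p : R[X]) :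
    Irreducible (p.scaleRoots r) ↔ Irreducible p := by
  obtain ⟨u, rfl⟩ := hr
  let inv : Invertible ((u⁻¹ : Rˣ) : R) := (u⁻¹).invertible
  have h : p.scaleRoots (u : R) =
      C ((u : R) ^ p.natDegree) * algEquivCMulXAddC ((u⁻¹ : Rˣ) : R) 0 p := by
    ext i
    rw [coeff_scaleRoots, coeff_C_mul, algEquivCMulXAddC_apply, C_0, add_zero,
      ← comp_eq_aeval, comp_C_mul_X_coeff]
    by_cases hi : i ≤ p.natDegree
    · obtain ⟨k, hk⟩ := Nat.exists_eq_add_of_le hi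
      rw [hk, Nat.add_sub_cancel_left, pow_add]
      have : (u : R) ^ i * ((u⁻¹ : Rˣ) : R) ^ i = 1 := by rw [← mul_pow]; simp
      linear_combination (-(p.coeff i * (u : R) ^ k)) * this
    · rw [coeff_eq_zero_of_natDegree_lt (by omega)]
      simp
  rw [h, irreducible_isUnit_mul ((u.isUnit.pow _).map C)]
  exact MulEquiv.irreducible_iff (algEquivCMulXAddC ((u⁻¹ : Rˣ) : R) 0)

lemma irreducible_integralNormalization [IsDomain R] [UniqueFactorizationMonoid R] {P : R[X]}
    (hP : Irreducible P) (hd : P.natDegree ≠ 0) : Irreducible P.integralNormalization := by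
  let _ : NormalizedGCDMonoid R := Classical.choice inferInstance
  set F := FractionRing R
  have hmon := monic_integralNormalization hP.ne_zero
  have hinj : Function.Injective (algebraMap R F) := IsFractionRing.injective R F
  have hlc : algebraMap R F P.leadingCoeff ≠ 0 := by
    rw [Ne, IsFractionRing.to_map_eq_zero_iff, leadingCoeff_eq_zero]
    exact hP.ne_zero
  rw [hmon.irreducible_iff_irreducible_map_fraction_map (K := F)]
  have h1 := congrArg (map (algebraMap R F)) (integralNormalization_mul_C_leadingCoeff P)
  rw [Polynomial.map_mul, map_C, map_scaleRoots _ _ _ hlc] at h1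
  rw [← irreducible_mul_isUnit ((isUnit_iff_ne_zero.mpr hlc).map C), h1,
    irreducible_scaleRoots_iff (isUnit_iff_ne_zero.mpr hlc)]
  exact ((hP.isPrimitive hd).irreducible_iff_irreducible_map_fraction_map).mp hP

/-- If the leading coefficient survives a specialization, then irreducibility of the specialized
`integralNormalization` gives irreducibility of the specialized polynomial. -/
lemma irreducible_map_of_integralNormalization {F : Type*} [Field F] (f : R →+* F) {P : R[X]}
    (hlc : f P.leadingCoeff ≠ 0) (h : Irreducible (P.integralNormalization.map f)) :
    Irreducible (P.map f) := by
  have h1 := congrArg (map f) (integralNormalization_mul_C_leadingCoeff P)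
  rw [Polynomial.map_mul, map_C, map_scaleRoots _ _ _ hlc] at h1
  rwa [← irreducible_mul_isUnit ((isUnit_iff_ne_zero.mpr hlc).map C), h1,
    irreducible_scaleRoots_iff (isUnit_iff_ne_zero.mpr hlc)] at h

end ScaleRoots

/-! ### From reducible specializations to rational roots -/

section Extend

/-- A homomorphism from `R` to an algebraically closed field extends to integral extensions. -/
lemma exists_ringHom_extend {R B Ω : Type*} [CommRing R] [CommRing B] [Algebra R B]
    [Algebra.IsIntegral R B] [FaithfulSMul R B] [Field Ω] [IsAlgClosed Ω] (ψ : R →+* Ω) :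
    ∃ φ : B →+* Ω, φ.comp (algebraMap R B) = ψ := by
  have : (RingHom.ker ψ).IsPrime := RingHom.ker_isPrime ψ
  obtain ⟨q, -, hq, hcomap⟩ := Ideal.exists_ideal_over_prime_of_isIntegral (S := B)
    (RingHom.ker ψ) ⊥ (by
      rw [← RingHom.ker_eq_comap_bot, (RingHom.injective_iff_ker_eq_bot _).mp
        (FaithfulSMul.algebraMap_injective R B)]
      exact bot_le)
  have hlies : q.LiesOver (RingHom.ker ψ) := ⟨hcomap.symm⟩
  let _ : Algebra (R ⧸ RingHom.ker ψ) Ω := (RingHom.kerLift ψ).toAlgebra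
  have hinj1 : Function.Injective (algebraMap (R ⧸ RingHom.ker ψ) Ω) := RingHom.kerLift_injective ψ
  have hinj2 : Function.Injective (algebraMap (R ⧸ RingHom.ker ψ) (B ⧸ q)) := by
    rintro ⟨a⟩ ⟨b⟩ hab
    have h1 : Ideal.Quotient.mk q (algebraMap R B a) = Ideal.Quotient.mk q (algebraMap R B b) := hab
    rw [Ideal.Quotient.eq, ← map_sub] at h1
    exact Ideal.Quotient.eq.mpr (hcomap ▸ h1)
  have : FaithfulSMul (R ⧸ RingHom.ker ψ) Ω := (faithfulSMul_iff_algebraMap_injective _ _).mpr hinj1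
  have : FaithfulSMul (R ⧸ RingHom.ker ψ) (B ⧸ q) :=
    (faithfulSMul_iff_algebraMap_injective _ _).mpr hinj2
  have : Module.IsTorsionFree (R ⧸ RingHom.ker ψ) (B ⧸ q) := .trans_faithfulSMul _ (B ⧸ q) (B ⧸ q)
  have : Module.IsTorsionFree (R ⧸ RingHom.ker ψ) Ω := .trans_faithfulSMul _ Ω Ω
  have : Algebra.IsAlgebraic (R ⧸ RingHom.ker ψ) (B ⧸ q) := inferInstance
  let l : (B ⧸ q) →ₐ[R ⧸ RingHom.ker ψ] Ω := IsAlgClosed.lift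
  refine ⟨l.toRingHom.comp (Ideal.Quotient.mk q), RingHom.ext fun r => ?_⟩
  exact l.commutes (Ideal.Quotient.mk _ r)

lemma exists_le_map_eq_of_le_map {α β : Type*} {f : α → β} {s : Multiset α} {m : Multiset β}
    (h : m ≤ s.map f) : ∃ u ≤ s, u.map f = m := by
  induction s using Quotient.inductionOn with | _ l
  induction m using Quotient.inductionOn with | _ l'
  obtain ⟨l₂, hl₂, hsub⟩ : l'.Subperm (l.map f) := h
  obtain ⟨l₃, hl₃, rfl⟩ := List.sublist_map_iff.mp hsub
  exact ⟨(l₃ : Multiset α), hl₃.subperm, Quotient.sound hl₂⟩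

end Extend

section Splitting
variable {K : Type*} [Field K]

lemma map_prod_X_sub_C {B S : Type*} [CommRing B] [CommRing S] (f : B →+* S) (τ : Multiset B) :
    (τ.map fun b => X - C b).prod.map f = ((τ.map f).map fun b => X - C b).prod := by
  rw [Polynomial.map_multiset_prod, Multiset.map_map, Multiset.map_map]
  simp

lemma exists_finset_irreducible_of_splits {F L : Type*} (Ω : Type*) [Field Ω] [IsAlgClosed Ω]
    [Algebra K Ω] [Field F] [Algebra K[X] F]
    [IsFractionRing K[X] F] [Field L] [Algebra F L] [Algebra K[X] L] [IsScalarTower K[X] F L]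
    {P : K[X][X]} (hP : P.Monic) (hirr : Irreducible P)
    (hsplit : (P.map (algebraMap K[X] L)).Splits) :
    ∃ 𝒬 : Finset K[X][X], (∀ Q ∈ 𝒬, Q.Monic ∧ Irreducible Q ∧ 2 ≤ Q.natDegree) ∧
      ∀ t : K, (∀ Q ∈ 𝒬, ∀ y, (Q.map (evalRingHom t)).eval y ≠ 0) →
        Irreducible (P.map (evalRingHom t)) := by
  classical
  have hirrF : Irreducible (P.map (algebraMap K[X] F)) :=
    (hP.irreducible_iff_irreducible_map_fraction_map).mp hirr
  have hcompRFL : algebraMap K[X] L = (algebraMap F L).comp (algebraMap K[X] F) :=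
    IsScalarTower.algebraMap_eq _ _ _
  set B := integralClosure K[X] L with hB
  have hPL : (P.map (algebraMap K[X] L)).Monic := hP.map _
  have hprod := hsplit.eq_prod_roots_of_monic hPL
  -- the roots are integral
  obtain ⟨s, hs⟩ : ∃ s : Multiset B, s.map (fun b : B => (b : L)) = (P.map (algebraMap K[X] L)).roots := by
    have : ∀ x ∈ (P.map (algebraMap K[X] L)).roots, x ∈ B := by
      intro x hx
      rw [mem_roots hPL.ne_zero, IsRoot, eval_map] at hx
      exact ⟨P, hP, hx⟩
    refine ⟨(P.map (algebraMap K[X] L)).roots.attach.map fun x => ⟨x.1, this x.1 x.2⟩, ?_⟩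
    rw [Multiset.map_map]
    exact Multiset.attach_map_val _
  set g : Multiset B → B[X] := fun τ => (τ.map fun b => X - C b).prod with hg
  set val : B →+* L := B.val.toRingHom with hval
  have hgs : P.map (algebraMap K[X] B) = g s := by
    apply map_injective val Subtype.val_injective
    rw [map_map, map_prod_X_sub_C]
    have : s.map val = (P.map (algebraMap K[X] L)).roots := hs
    rw [this, ← hprod]
    rfl
  have hcard : s.card = P.natDegree := by
    rw [← Multiset.card_map (fun b : B => (b : L)) s, hs, ← hsplit.natDegree_eq_card_roots,
      hP.natDegree_map]
  have hbad : ∀ τ ≤ s, 0 < τ.card → τ.card < s.card →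
      ∃ i, val ((g τ).coeff i) ∉ (algebraMap F L).range := by
    intro τ hτ h0 h1
    by_contra! hcon
    have hmon : ((g τ).map val).Monic := by
      rw [map_prod_X_sub_C]
      exact monic_multiset_prod_of_monic _ _ fun b _ => monic_X_sub_C b
    obtain ⟨h, hh1, hh2, hh3⟩ := lifts_and_natDegree_eq_and_monic (f := algebraMap F L)
      ((lifts_iff_coeff_lifts _).mpr fun n => by rw [coeff_map]; exact hcon n) hmon
    have hdeg : h.natDegree = τ.card := by
      rw [hh2, map_prod_X_sub_C, natDegree_multiset_prod_X_sub_C_eq_card, Multiset.card_map]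
    have hdvd : h ∣ P.map (algebraMap K[X] F) := by
      rw [← map_dvd_map' (algebraMap F L), hh1, map_map, ← hcompRFL, hprod, map_prod_X_sub_C]
      refine Multiset.prod_dvd_prod_of_le (Multiset.map_le_map ?_)
      rw [← hs]
      exact Multiset.map_le_map hτ
    obtain ⟨k, hk⟩ := hdvd
    have hk0 : k ≠ 0 := by
      rintro rfl
      rw [mul_zero] at hk
      exact hirrF.ne_zero hk
    have hdegs := congrArg natDegree hk
    rw [natDegree_mul hh3.ne_zero hk0, hP.natDegree_map, ← hcard, hdeg] at hdegs
    rcases hirrF.isUnit_or_isUnit hk with hu | hu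
    · have := natDegree_eq_zero_of_isUnit hu
      omega
    · have := natDegree_eq_zero_of_isUnit hu
      omega
  choose! i hi using hbad
  set c : Multiset B → L := fun τ => val ((g τ).coeff (i τ)) with hc
  have hcint : ∀ τ, IsIntegral K[X] (c τ) := fun τ => ((g τ).coeff (i τ)).2
  refine ⟨(s.powerset.toFinset.filter fun τ => 0 < τ.card ∧ τ.card < s.card).image
    fun τ => minpoly K[X] (c τ), ?_, ?_⟩
  · intro Q hQ
    obtain ⟨τ, hτ, rfl⟩ := Finset.mem_image.mp hQ
    obtain ⟨hτ1, hτ2, hτ3⟩ := Finset.mem_filter.mp hτ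
    rw [Multiset.mem_toFinset, Multiset.mem_powerset] at hτ1
    refine ⟨minpoly.monic (hcint τ), minpoly.irreducible (hcint τ), ?_⟩
    rw [minpoly.two_le_natDegree_iff (hcint τ)]
    rintro ⟨r, hr⟩
    refine hi τ hτ1 hτ2 hτ3 ⟨algebraMap K[X] F r, ?_⟩
    rw [← RingHom.comp_apply, ← hcompRFL]
    exact hr
  intro t ht
  have hPt : (P.map (evalRingHom t)).Monic := hP.map _
  rw [hPt.irreducible_iff_natDegree']
  refine ⟨fun h1 => ?_, fun f₁ f₂ hf₁ hf₂ hfac hmem => ?_⟩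
  · have h2 := congrArg natDegree h1
    rw [hP.natDegree_map, natDegree_one, hP.natDegree_eq_zero] at h2
    rw [h2] at hirr
    exact not_irreducible_one hirr
  rw [Finset.mem_Ioc, hP.natDegree_map] at hmem
  have hfaith : FaithfulSMul K[X] B := by
    rw [faithfulSMul_iff_algebraMap_injective]
    have : Function.Injective (algebraMap K[X] L) := by
      rw [hcompRFL]
      exact (algebraMap F L).injective.comp (IsFractionRing.injective K[X] F)
    intro a b hab
    exact this (congrArg val hab)
  obtain ⟨φ, hφ⟩ := exists_ringHom_extend (B := B)
    ((algebraMap K Ω).comp (evalRingHom t))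
  have hPφ : (P.map (evalRingHom t)).map (algebraMap K Ω) =
      ((s.map φ).map fun b => X - C b).prod := by
    rw [map_map, ← hφ, ← map_map, hgs, map_prod_X_sub_C]
  have hroots : (f₂.map (algebraMap K Ω)).roots ≤ s.map φ := by
    have hdvd : f₂.map (algebraMap K Ω) ∣ ((s.map φ).map fun b => X - C b).prod := by
      rw [← hPφ, ← hfac, Polynomial.map_mul]
      exact dvd_mul_left _ _
    have hne : ((s.map φ).map fun b => X - C b).prod ≠ 0 :=
      (monic_multiset_prod_of_monic _ _ fun b _ => monic_X_sub_C b).ne_zero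
    have h1 := roots.le_of_dvd hne hdvd
    rwa [roots_multiset_prod_X_sub_C] at h1
  obtain ⟨τ, hτ, hτφ⟩ := exists_le_map_eq_of_le_map hroots
  have hf₂split := IsAlgClosed.splits (f₂.map (algebraMap K Ω))
  have hf₂φ : f₂.map (algebraMap K Ω) = (g τ).map φ := by
    rw [map_prod_X_sub_C, hτφ]
    exact hf₂split.eq_prod_roots_of_monic (hf₂.map _)
  have hτcard : τ.card = f₂.natDegree := by
    rw [← Multiset.card_map φ τ, hτφ, ← hf₂split.natDegree_eq_card_roots, hf₂.natDegree_map]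
  refine ht (minpoly K[X] (c τ)) (Finset.mem_image.mpr ⟨τ, Finset.mem_filter.mpr ⟨?_, ?_, ?_⟩, rfl⟩)
    (f₂.coeff (i τ)) ?_
  · rwa [Multiset.mem_toFinset, Multiset.mem_powerset]
  · omega
  · omega
  · apply (algebraMap K Ω).injective
    have h1 : (minpoly K[X] (c τ)).eval₂ (algebraMap K[X] B) ((g τ).coeff (i τ)) = 0 := by
      apply Subtype.val_injective
      have h2 := minpoly.aeval K[X] (c τ)
      rw [aeval_def] at h2
      have h3 := hom_eval₂ (minpoly K[X] (c τ)) (algebraMap K[X] B) val ((g τ).coeff (i τ))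
      exact h3.trans h2
    have h2 := congrArg φ h1
    rw [hom_eval₂, hφ, ← coeff_map, ← hf₂φ, coeff_map, ← hom_eval₂, map_zero] at h2
    rw [eval_map, h2, map_zero]

/-- If a specialization of the monic irreducible polynomial `P` over `K[X]` is reducible, then one of
finitely many monic irreducible polynomials of degree at least `2` has a root at that
specialization: the coefficients of a proper factor specialize coefficients of a partial product of
the linear factors of `P`, and not all of these are rational functions. -/
theorem exists_finset_irreducible_of_forall_eval_ne_zero {P : K[X][X]} (hP : P.Monic)
    (hirr : Irreducible P) :
    ∃ 𝒬 : Finset K[X][X], (∀ Q ∈ 𝒬, Q.Monic ∧ Irreducible Q ∧ 2 ≤ Q.natDegree) ∧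
      ∀ t : K, (∀ Q ∈ 𝒬, ∀ y, (Q.map (evalRingHom t)).eval y ≠ 0) →
        Irreducible (P.map (evalRingHom t)) := by
  let F := FractionRing K[X]
  let L := (P.map (algebraMap K[X] F)).SplittingField
  refine exists_finset_irreducible_of_splits (AlgebraicClosure K) (F := F) (L := L) hP hirr ?_
  rw [IsScalarTower.algebraMap_eq K[X] F L, ← map_map]
  exact SplittingField.splits _

end Splitting

/-! ### Clearing denominators in ideals of polynomials -/

section Localization

/-- A polynomial in the extension of an ideal `I` to a localization has a multiple in `I`. -/
lemma exists_mem_map_eq_C_mul {R A : Type*} [CommRing R] [CommRing A] [Algebra R A]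
    (M : Submonoid R) [IsLocalization M A] {I : Ideal R[X]} {g : A[X]}
    (hg : g ∈ I.map (mapRingHom (algebraMap R A))) :
    ∃ m ∈ M, ∃ a ∈ I, a.map (algebraMap R A) = C (algebraMap R A m) * g := by
  let := Polynomial.algebra R A
  have := Polynomial.isLocalization M A
  obtain ⟨⟨⟨a, ha⟩, ⟨_, m, hm, rfl⟩⟩, h⟩ :=
    (IsLocalization.mem_map_algebraMap_iff (M.map C) A[X]).mp hg
  refine ⟨m, hm, a, ha, ?_⟩
  have h' : g * (C m).map (algebraMap R A) = a.map (algebraMap R A) := h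
  rw [map_C] at h'
  rw [← h', mul_comm]

end Localization

section Descent
variable {O K : Type*} [CommRing O] [IsDomain O] [Field K] [Algebra O K]
  [IsFractionRing O K]

lemma eval_ne_zero_of_irreducible {R : Type*} [CommRing R] [IsDomain R] {P : R[X]}
    (hP : Irreducible P) (h2 : 2 ≤ P.natDegree) (h : R) : P.eval h ≠ 0 := by
  intro h0
  obtain ⟨k, hk⟩ := dvd_iff_isRoot.mpr h0
  have hk0 : k ≠ 0 := by
    rintro rfl
    rw [mul_zero] at hk
    exact hP.ne_zero hk
  have hdeg := congrArg natDegree hk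
  rw [natDegree_mul (X_sub_C_ne_zero h) hk0, natDegree_X_sub_C] at hdeg
  rcases hP.isUnit_or_isUnit hk with hu | hu
  · exact not_isUnit_X_sub_C h hu
  · have := natDegree_eq_zero_of_isUnit hu
    omega

/-- A monic polynomial over `O[X]` that is irreducible over `K[X]` is separable: a nonzero element
of `O[X]` is a combination of the polynomial and its derivative. -/
lemma exists_eq_C_of_irreducible [CharZero K] {Q : O[X][X]} (hQ : Q.Monic)
    (hirr : Irreducible (Q.map (mapRingHom (algebraMap O K)))) :
    ∃ (D : O[X]) (A B : O[X][X]), D ≠ 0 ∧ A * Q + B * derivative Q = C D := by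
  set μ := mapRingHom (algebraMap O K) with hμ
  have hμinj : Function.Injective μ := map_injective _ (IsFractionRing.injective O K)
  set F := FractionRing K[X]
  have hinj : Function.Injective (algebraMap K[X] F) := IsFractionRing.injective K[X] F
  have hF : Irreducible ((Q.map μ).map (algebraMap K[X] F)) :=
    ((hQ.map μ).irreducible_iff_irreducible_map_fraction_map).mp hirr
  have : CharZero F := charZero_of_injective_algebraMap hinj
  obtain ⟨a, b, hab⟩ := hF.separable
  have h1 : (1 : F[X]) ∈ (Ideal.span {Q.map μ, (derivative Q).map μ}).map
      (mapRingHom (algebraMap K[X] F)) := by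
    rw [← hab, Ideal.map_span, Set.image_pair, ← derivative_map]
    exact Ideal.mem_span_pair.mpr ⟨a, b, by simp [derivative_map]⟩
  obtain ⟨m₁, hm₁, a₁, ha₁, h2⟩ := exists_mem_map_eq_C_mul (nonZeroDivisors K[X]) h1
  rw [mul_one, ← map_C (f := algebraMap K[X] F)] at h2
  have h3 := map_injective _ hinj h2
  rw [h3] at ha₁
  have h4 : C m₁ ∈ (Ideal.span {Q, derivative Q}).map (mapRingHom μ) := by
    rw [Ideal.map_span, Set.image_pair]
    exact ha₁
  let := Polynomial.algebra O K
  have := Polynomial.isLocalization (nonZeroDivisors O) K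
  obtain ⟨m₂, ⟨m, hm, rfl⟩, a₂, ha₂, h5⟩ :=
    exists_mem_map_eq_C_mul (R := O[X]) (A := K[X]) ((nonZeroDivisors O).map C) h4
  have h6 : a₂.map μ = C (μ (C m) * m₁) := by
    rw [C_mul]
    exact h5
  have hne : μ (C m) * m₁ ≠ 0 := by
    refine mul_ne_zero ?_ (nonZeroDivisors.ne_zero hm₁)
    rw [Ne, map_eq_zero_iff _ hμinj, C_eq_zero]
    exact nonZeroDivisors.ne_zero hm
  have h7 : a₂.natDegree = 0 := by
    rw [← natDegree_map_eq_of_injective hμinj, h6, natDegree_C]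
  rw [eq_C_of_natDegree_eq_zero h7] at ha₂ h6
  obtain ⟨A, B, hAB⟩ := Ideal.mem_span_pair.mp ha₂
  refine ⟨a₂.coeff 0, A, B, ?_, hAB⟩
  intro h0
  rw [h0, C_0, Polynomial.map_zero, eq_comm, C_eq_zero] at h6
  exact hne h6

omit [IsDomain O] in
lemma eval_scaleRoots_ne_zero [CharZero K] {Q : O[X][X]} (hQ : Q.Monic)
    (hirr : Irreducible (Q.map (mapRingHom (algebraMap O K)))) (h2 : 2 ≤ Q.natDegree)
    {V : O} {t₀ p : ℕ} (hV : V ≠ 0) (hp : p ≠ 0) (H : O[X]) :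
    ((Q.map (compRingHom (C (t₀ : O) + C (p : O) * X))).scaleRoots (C V)).eval H ≠ 0 := by
  intro h0
  set μ := mapRingHom (algebraMap O K) with hμ
  set V' := algebraMap O K V with hV'
  have hV0 : V' ≠ 0 := by rwa [hV', Ne, IsFractionRing.to_map_eq_zero_iff]
  let inv := invertibleOfNonzero (Nat.cast_ne_zero.mpr hp : (p : K) ≠ 0)
  let e : K[X] ≃+* K[X] := algEquivCMulXAddC (p : K) (t₀ : K)
  have he : μ.comp (compRingHom (C (t₀ : O) + C (p : O) * X)) = (e : K[X] →+* K[X]).comp μ := by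
    refine ringHom_ext' ?_ ?_
    · ext r
      simp [hμ, e]
    · simp [hμ, e, add_comm]
  have hirr' : Irreducible ((Q.map μ).map (e : K[X] →+* K[X])) := by
    rw [← mapEquiv_apply]
    exact (MulEquiv.irreducible_iff (mapEquiv e)).mpr hirr
  have hmon' := (hQ.map μ).map (e : K[X] →+* K[X])
  have hdeg' : ((Q.map μ).map (e : K[X] →+* K[X])).natDegree = Q.natDegree := by
    rw [(hQ.map μ).natDegree_map, hQ.natDegree_map]
  refine eval_ne_zero_of_irreducible hirr' (by rwa [hdeg']) (C V'⁻¹ * μ H) ?_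
  have h1 := congrArg μ h0
  rw [map_zero, ← eval₂_hom, ← eval_map, map_scaleRoots _ _ _ (by
    rw [(hQ.map _).leadingCoeff, map_one]; exact one_ne_zero), map_map, he, ← map_map] at h1
  have h3 : μ H = μ (C V) * (C V'⁻¹ * μ H) := by
    rw [hμ, coe_mapRingHom, map_C, ← hV', ← mul_assoc, ← C_mul, mul_inv_cancel₀ hV0, C_1, one_mul]
  rw [h3, scaleRoots_eval_mul] at h1
  refine (mul_eq_zero.mp h1).resolve_left (pow_ne_zero _ ?_)
  rw [hμ, coe_mapRingHom, map_C, Ne, C_eq_zero]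
  exact hV0

omit [IsDomain O] in
/-- After multiplying its roots by a suitable element of `O`, or by any multiple of it, a monic
polynomial over `K[X]` has coefficients in `O[X]`. -/
lemma exists_map_eq_scaleRoots {Q : K[X][X]} (hQ : Q.Monic) :
    ∃ r ∈ nonZeroDivisors O, ∀ m : O, ∃ Q' : O[X][X], Q'.Monic ∧ Q'.natDegree = Q.natDegree ∧
      Q'.map (mapRingHom (algebraMap O K)) = Q.scaleRoots (C (algebraMap O K (r * m))) := by
  classical
  obtain ⟨⟨r, hr⟩, h⟩ := IsLocalization.exist_integer_multiples_of_finset (nonZeroDivisors O)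
    (Q.support.biUnion fun i => (Q.coeff i).support.image fun j => (Q.coeff i).coeff j)
  have hint : ∀ i j, algebraMap O K r * (Q.coeff i).coeff j ∈ Set.range (algebraMap O K) := by
    intro i j
    by_cases h0 : (Q.coeff i).coeff j = 0
    · exact ⟨0, by rw [h0, mul_zero, map_zero]⟩
    · have hi : i ∈ Q.support := by
        rw [mem_support_iff]
        intro h1
        rw [h1, coeff_zero] at h0
        exact h0 rfl
      have := h ((Q.coeff i).coeff j) (Finset.mem_biUnion.mpr ⟨i, hi,
        Finset.mem_image.mpr ⟨j, mem_support_iff.mpr h0, rfl⟩⟩)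
      obtain ⟨z, hz⟩ := this
      exact ⟨z, by rw [hz]; simp [Algebra.smul_def]⟩
  refine ⟨r, hr, fun m => ?_⟩
  have hmon : (Q.scaleRoots (C (algebraMap O K (r * m)))).Monic := (monic_scaleRoots_iff _).mpr hQ
  have hlift : Q.scaleRoots (C (algebraMap O K (r * m))) ∈ lifts (mapRingHom (algebraMap O K)) := by
    rw [lifts_iff_coeff_lifts]
    intro i
    rw [coeff_scaleRoots]
    have : Q.coeff i * C (algebraMap O K (r * m)) ^ (Q.natDegree - i) ∈
        lifts (algebraMap O K) := by
      rcases lt_trichotomy i Q.natDegree with hi | hi | hi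
      · obtain ⟨k, hk⟩ := Nat.exists_eq_add_of_lt hi
        rw [show Q.natDegree - i = k + 1 by omega, ← C_pow, lifts_iff_coeff_lifts]
        intro j
        obtain ⟨z, hz⟩ := hint i j
        rw [coeff_mul_C]
        refine ⟨z * m * (r * m) ^ k, ?_⟩
        rw [map_mul, map_mul, hz, map_pow, map_mul, pow_succ]
        ring
      · rw [hi, Nat.sub_self, pow_zero, mul_one, hQ.coeff_natDegree]
        exact ⟨1, map_one _⟩
      · rw [coeff_eq_zero_of_natDegree_lt hi, zero_mul]
        exact ⟨0, map_zero _⟩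
    obtain ⟨z, hz⟩ := this
    exact ⟨z, hz⟩
  obtain ⟨Q', h1, h2, h3⟩ := lifts_and_natDegree_eq_and_monic hlift hmon
  exact ⟨Q', h3, by rw [h2, natDegree_scaleRoots], h1⟩

variable {ι : Type*} [Fintype ι] {σ : ι → O →+* ℝ}

lemma map_evalRingHom_comp {R S : Type*} [CommRing R] [CommRing S] (f : R →+* S) (x : R) :
    (evalRingHom (f x)).comp (mapRingHom f) = f.comp (evalRingHom x) := by
  refine ringHom_ext' ?_ ?_
  · ext; simp
  · simp

/-- There are natural numbers at which none of finitely many irreducible polynomials of degree at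
least `2` has a root in `K`. -/
theorem exists_natCast_forall_eval_ne_zero [CharZero O]
    (hσ : ∀ b : O, (∀ j, |σ j b| < 1) → b = 0) (hinert : ∀ n, ∃ p ≥ n, IsInert O p)
    {c : O} (hc0 : c ≠ 0)
    (hc : ∀ y : K, IsIntegral O y → ∃ z : O, algebraMap O K z = algebraMap O K c * y)
    {κ : Type*} [Fintype κ] (Q : κ → K[X][X]) (hQ : ∀ l, (Q l).Monic)
    (hirr : ∀ l, Irreducible (Q l)) (h2 : ∀ l, 2 ≤ (Q l).natDegree) (E : Finset ℕ) :
    ∃ t : ℕ, t ∉ E ∧ ∀ l y, ((Q l).map (evalRingHom (t : K))).eval y ≠ 0 := by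
  have hinj : Function.Injective (algebraMap O K) := IsFractionRing.injective O K
  have hK : CharZero K := charZero_of_injective_algebraMap hinj
  choose r hr hQr using fun l => exists_map_eq_scaleRoots (O := O) (hQ l)
  have hr0 : ∀ l, r l ≠ 0 := fun l => nonZeroDivisors.ne_zero (hr l)
  choose Q₁ hQ₁mon hQ₁deg hQ₁ using fun l => hQr l 1
  choose Q₂ hQ₂mon hQ₂deg hQ₂ using fun l => hQr l c
  have hirr₂ : ∀ l, Irreducible ((Q₂ l).map (mapRingHom (algebraMap O K))) := by
    intro l
    rw [hQ₂, irreducible_scaleRoots_iff]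
    · exact hirr l
    · refine (isUnit_iff_ne_zero.mpr ?_).map C
      rw [Ne, IsFractionRing.to_map_eq_zero_iff]
      exact mul_ne_zero (hr0 l) hc0
  choose D A B hD hAB using fun l => exists_eq_C_of_irreducible (hQ₂mon l) (hirr₂ l)
  obtain ⟨t, htE, ht⟩ := exists_forall_eval_ne_zero hσ hinert Q₂ hQ₂mon D hD A B hAB
    (fun l V t₀ p hV hp H => eval_scaleRoots_ne_zero (hQ₂mon l) (hirr₂ l)
      (by rw [hQ₂deg]; exact h2 l) hV hp H) E
  refine ⟨t, htE, fun l y hy => ?_⟩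
  have hmap : ∀ (Q' : O[X][X]) (s : O),
      Q'.map (mapRingHom (algebraMap O K)) = (Q l).scaleRoots (C (algebraMap O K s)) →
      ((Q'.map (evalRingHom (t : O))).map (algebraMap O K)).eval (algebraMap O K s * y) = 0 := by
    intro Q' s h
    rw [map_map, ← map_evalRingHom_comp, ← map_map, h, map_natCast, map_scaleRoots _ _ _ (by
      rw [(hQ l).leadingCoeff, map_one]; exact one_ne_zero), coe_evalRingHom, eval_C,
      scaleRoots_eval_mul, hy, mul_zero]
  have h1 := hmap _ _ (hQ₁ l)
  have hintegral : IsIntegral O (algebraMap O K (r l * 1) * y) :=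
    ⟨(Q₁ l).map (evalRingHom (t : O)), (hQ₁mon l).map _, by rwa [eval_map] at h1⟩
  obtain ⟨z, hz⟩ := hc _ hintegral
  have h3 := hmap _ _ (hQ₂ l)
  have h4 : algebraMap O K (r l * c) * y = algebraMap O K z := by
    rw [hz, mul_one, map_mul]
    ring
  rw [h4, eval_map, eval₂_hom, IsFractionRing.to_map_eq_zero_iff] at h3
  exact ht l z h3

/-- Hilbert's irreducibility theorem for one parameter and one variable. -/
theorem exists_natCast_forall_irreducible [CharZero O]
    (hσ : ∀ b : O, (∀ j, |σ j b| < 1) → b = 0) (hinert : ∀ n, ∃ p ≥ n, IsInert O p)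
    {c : O} (hc0 : c ≠ 0)
    (hc : ∀ y : K, IsIntegral O y → ∃ z : O, algebraMap O K z = algebraMap O K c * y)
    {κ : Type*} [Fintype κ] (P : κ → K[X][X]) (hirr : ∀ l, Irreducible (P l))
    (hd : ∀ l, (P l).natDegree ≠ 0) {g : K[X]} (hg : g ≠ 0) :
    ∃ t : ℕ, g.eval (t : K) ≠ 0 ∧ ∀ l, Irreducible ((P l).map (evalRingHom (t : K))) := by
  classical
  have hK : CharZero K := charZero_of_injective_algebraMap (IsFractionRing.injective O K)
  choose 𝒬 h𝒬 hspec using fun l => exists_finset_irreducible_of_forall_eval_ne_zero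
    (monic_integralNormalization (hirr l).ne_zero)
    (irreducible_integralNormalization (hirr l) (hd l))
  set h := g * ∏ l, (P l).leadingCoeff with hh
  have hh0 : h ≠ 0 := mul_ne_zero hg
    (Finset.prod_ne_zero_iff.mpr fun l _ => leadingCoeff_ne_zero.mpr (hirr l).ne_zero)
  have hfin : {t : ℕ | h.eval (t : K) = 0}.Finite := by
    refine ((h.roots.toFinset.finite_toSet).preimage
      (f := fun t : ℕ => (t : K)) Nat.cast_injective.injOn).subset ?_
    intro t ht
    simpa [hh0] using ht
  obtain ⟨t, htE, ht⟩ := exists_natCast_forall_eval_ne_zero (K := K) hσ hinert hc0 hc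
    (fun x : Σ l, 𝒬 l => (x.2 : K[X][X])) (fun x => (h𝒬 x.1 _ x.2.2).1)
    (fun x => (h𝒬 x.1 _ x.2.2).2.1) (fun x => (h𝒬 x.1 _ x.2.2).2.2) hfin.toFinset
  rw [Set.Finite.mem_toFinset, Set.mem_ofPred_eq, hh, eval_mul, eval_prod] at htE
  refine ⟨t, left_ne_zero_of_mul htE, fun l => ?_⟩
  refine irreducible_map_of_integralNormalization _ ?_
    (hspec l t fun Q hQ y => ht ⟨l, ⟨Q, hQ⟩⟩ y)
  exact Finset.prod_ne_zero_iff.mp (right_ne_zero_of_mul htE) l (Finset.mem_univ l)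

end Descent

end SchinzelRing

namespace SchinzelRing
open MvPolynomial

/-! ### Kronecker's substitution -/

section Kronecker
variable {R S : Type*} [CommRing R] [CommRing S] {n : ℕ}

/-- Kronecker's substitution `Y_i ↦ X ^ (D ^ i)`. -/
noncomputable def kronecker (R : Type*) [CommRing R] (n D : ℕ) :
    MvPolynomial (Fin n) R →+* Polynomial R :=
  eval₂Hom Polynomial.C fun i => Polynomial.X ^ (D ^ (i : ℕ))

/-- The exponent of the image of the monomial `Y ^ e` under Kronecker's substitution. -/
def kroneckerExp (D : ℕ) (e : Fin n →₀ ℕ) : ℕ := ∑ i, e i * D ^ (i : ℕ)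

/-- All exponents occurring in `A` are less than `D`. -/
def IsBoxed (D : ℕ) (A : MvPolynomial (Fin n) R) : Prop :=
  ∀ e, A.coeff e ≠ 0 → ∀ i, e i < D

lemma kronecker_monomial (D : ℕ) (e : Fin n →₀ ℕ) (c : R) :
    kronecker R n D (monomial e c) = Polynomial.monomial (kroneckerExp D e) c := by
  rw [kronecker, coe_eval₂Hom, eval₂_monomial, Finsupp.prod_fintype _ _ (by simp),
    ← Polynomial.C_mul_X_pow_eq_monomial, kroneckerExp, ← Finset.prod_pow_eq_pow_sum]
  congr 1
  refine Finset.prod_congr rfl fun i _ => ?_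
  rw [← pow_mul, mul_comm]

lemma kroneckerExp_eq {D : ℕ} {e : Fin n →₀ ℕ} (he : ∀ i, e i < D) :
    kroneckerExp D e = (finFunctionFinEquiv fun i => (⟨e i, he i⟩ : Fin D) : ℕ) := by
  rw [finFunctionFinEquiv_apply, kroneckerExp]

lemma kroneckerExp_injOn {D : ℕ} {e e' : Fin n →₀ ℕ} (he : ∀ i, e i < D) (he' : ∀ i, e' i < D)
    (h : kroneckerExp D e = kroneckerExp D e') : e = e' := by
  rw [kroneckerExp_eq he, kroneckerExp_eq he'] at h
  have h1 := finFunctionFinEquiv.injective (Fin.ext h)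
  ext i
  exact congrArg Fin.val (congrFun h1 i)

lemma kronecker_eq_sum (D : ℕ) (A : MvPolynomial (Fin n) R) :
    kronecker R n D A = ∑ e ∈ A.support, Polynomial.monomial (kroneckerExp D e) (A.coeff e) := by
  conv_lhs => rw [A.as_sum, map_sum]
  exact Finset.sum_congr rfl fun e _ => kronecker_monomial D e _

lemma coeff_kronecker {D : ℕ} {A : MvPolynomial (Fin n) R} (hA : IsBoxed D A) {e : Fin n →₀ ℕ}
    (he : ∀ i, e i < D) : (kronecker R n D A).coeff (kroneckerExp D e) = A.coeff e := by
  classical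
  rw [kronecker_eq_sum, Polynomial.finsetSum_coeff]
  simp only [Polynomial.coeff_monomial]
  rw [Finset.sum_eq_single e]
  · simp
  · intro e' he' hne
    rw [if_neg]
    intro h
    exact hne (kroneckerExp_injOn (hA e' (mem_support_iff.mp he')) he h)
  · intro h
    rw [notMem_support_iff.mp h]
    simp

/-- Kronecker's substitution is injective on polynomials with small exponents. -/
lemma kronecker_injOn {D : ℕ} {A B : MvPolynomial (Fin n) R} (hA : IsBoxed D A) (hB : IsBoxed D B)
    (h : kronecker R n D A = kronecker R n D B) : A = B := by
  ext e
  by_cases he : ∀ i, e i < D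
  · rw [← coeff_kronecker hA he, h, coeff_kronecker hB he]
  · have h1 : A.coeff e = 0 := by
      by_contra h0
      exact he (hA e h0)
    have h2 : B.coeff e = 0 := by
      by_contra h0
      exact he (hB e h0)
    rw [h1, h2]

lemma natDegree_kronecker_lt {D : ℕ} (hD : 0 < D) {A : MvPolynomial (Fin n) R} (hA : IsBoxed D A) :
    (kronecker R n D A).natDegree < D ^ n := by
  have hpos : 0 < D ^ n := pow_pos hD n
  rw [kronecker_eq_sum]
  refine lt_of_le_of_lt (Polynomial.natDegree_sum_le_of_forall_le (n := D ^ n - 1) _ _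
    fun e he => ?_) (by omega)
  refine (Polynomial.natDegree_monomial_le _).trans ?_
  rw [kroneckerExp_eq (hA e (mem_support_iff.mp he))]
  have := (finFunctionFinEquiv fun i => (⟨e i, hA e (mem_support_iff.mp he) i⟩ : Fin D)).isLt
  omega

/-- Kronecker's substitution is onto the polynomials of degree less than `D ^ n`. -/
lemma exists_kronecker_eq {D : ℕ} {g : Polynomial R} (hg : g.natDegree < D ^ n) :
    ∃ A : MvPolynomial (Fin n) R, IsBoxed D A ∧ kronecker R n D A = g := by
  classical
  let ε : ℕ → Fin n →₀ ℕ := fun m => if h : m < D ^ n then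
    Finsupp.equivFunOnFinite.symm fun i => (finFunctionFinEquiv.symm ⟨m, h⟩ i : ℕ) else 0
  have hε1 : ∀ m < D ^ n, ∀ i, ε m i < D := by
    intro m hm i
    simp only [ε, dif_pos hm, Finsupp.equivFunOnFinite_symm_apply_apply]
    exact (finFunctionFinEquiv.symm ⟨m, hm⟩ i).isLt
  have hε2 : ∀ m < D ^ n, kroneckerExp D (ε m) = m := by
    intro m hm
    rw [kroneckerExp_eq (hε1 m hm)]
    have : (fun i => (⟨ε m i, hε1 m hm i⟩ : Fin D)) = finFunctionFinEquiv.symm ⟨m, hm⟩ := by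
      funext i
      ext
      simp only [ε, dif_pos hm, Finsupp.equivFunOnFinite_symm_apply_apply]
    rw [this, Equiv.apply_symm_apply]
  have hsupp : ∀ m ∈ g.support, m < D ^ n := fun m hm =>
    (Polynomial.le_natDegree_of_mem_supp m hm).trans_lt hg
  refine ⟨∑ m ∈ g.support, monomial (ε m) (g.coeff m), ?_, ?_⟩
  · intro e he i
    rw [coeff_sum] at he
    obtain ⟨m, hm, hne⟩ := Finset.exists_ne_zero_of_sum_ne_zero he
    rw [coeff_monomial] at hne
    split_ifs at hne with h
    · rw [← h]
      exact hε1 m (hsupp m hm) i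
    · exact absurd rfl hne
  · rw [map_sum]
    conv_rhs => rw [g.as_sum_support]
    refine Finset.sum_congr rfl fun m hm => ?_
    rw [kronecker_monomial, hε2 m (hsupp m hm)]

lemma kronecker_map (D : ℕ) (f : R →+* S) (A : MvPolynomial (Fin n) R) :
    kronecker S n D (map f A) = (kronecker R n D A).map f := by
  have : (kronecker S n D).comp (map f) = (Polynomial.mapRingHom f).comp (kronecker R n D) := by
    refine ringHom_ext' ?_ ?_
    · ext r
      simp [kronecker]
    · intro i
      simp [kronecker]
  exact congrArg (fun g => g A) this

lemma IsBoxed.map {D : ℕ} {A : MvPolynomial (Fin n) R} (hA : IsBoxed D A) (f : R →+* S) :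
    IsBoxed D (map f A) := by
  intro e he
  refine hA e fun h => he ?_
  rw [coeff_map, h, map_zero]

lemma IsBoxed.C_mul {D : ℕ} {A : MvPolynomial (Fin n) R} (hA : IsBoxed D A) (c : R) :
    IsBoxed D (C c * A) := by
  intro e he
  refine hA e fun h => he ?_
  rw [coeff_C_mul, h, mul_zero]

lemma isBoxed_of_totalDegree_lt {D : ℕ} {A : MvPolynomial (Fin n) R} (hA : A.totalDegree < D) :
    IsBoxed D A := by
  intro e he i
  refine lt_of_le_of_lt ?_ hA
  refine le_trans ?_ (le_totalDegree (mem_support_iff.mpr he))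
  rw [Finsupp.sum_fintype _ _ (by simp)]
  exact Finset.single_le_sum (fun _ _ => Nat.zero_le _) (Finset.mem_univ i)

lemma kronecker_C (D : ℕ) (c : R) : kronecker R n D (C c) = Polynomial.C c := by
  simp [kronecker]

/-- A divisor of a product of primes and units is associated to a partial product. -/
lemma exists_associated_prod_of_dvd {α β : Type*} [CommRing β] [IsDomain β] (φ : α → β)
    (m : Multiset α) (hm : ∀ x ∈ m, Prime (φ x) ∨ IsUnit (φ x)) {a : β}
    (ha : a ∣ (m.map φ).prod) : ∃ s ≤ m, Associated a (s.map φ).prod := by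
  induction m using Multiset.induction_on generalizing a with
  | empty =>
    refine ⟨0, le_rfl, ?_⟩
    simpa [associated_one_iff_isUnit, isUnit_iff_dvd_one] using ha
  | cons x m ih =>
    have hm' : ∀ y ∈ m, Prime (φ y) ∨ IsUnit (φ y) := fun y hy => hm y (Multiset.mem_cons_of_mem hy)
    rw [Multiset.map_cons, Multiset.prod_cons] at ha
    have hx := hm x (Multiset.mem_cons_self x m)
    by_cases hdvd : φ x ∣ a ∧ Prime (φ x)
    · obtain ⟨⟨a', rfl⟩, hp⟩ := hdvd
      obtain ⟨s, hs, has⟩ := ih hm' ((mul_dvd_mul_iff_left hp.ne_zero).mp ha)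
      refine ⟨x ::ₘ s, Multiset.cons_le_cons x hs, ?_⟩
      rw [Multiset.map_cons, Multiset.prod_cons]
      exact has.mul_left _
    · have hdvd' : a ∣ (m.map φ).prod := by
        rcases hx with hp | hu
        · have hna : ¬ φ x ∣ a := fun h => hdvd ⟨h, hp⟩
          obtain ⟨c, hc⟩ := ha
          obtain ⟨c', rfl⟩ := (hp.dvd_or_dvd (Dvd.intro _ hc)).resolve_left hna
          refine ⟨c', mul_left_cancel₀ hp.ne_zero ?_⟩
          rw [hc]; ring
        · exact (hu.dvd_mul_left).mp ha
      obtain ⟨s, hs, has⟩ := ih hm' hdvd'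
      exact ⟨s, hs.trans (Multiset.le_cons_self m x), has⟩

/-- Reduction of the specialization of irreducible polynomials in several variables to one
variable: it suffices that the irreducible factors of the image under Kronecker's substitution stay
irreducible. A factorization of the specialized polynomial then comes from a partition of these factors,
and the product of the polynomials with small exponents that correspond to the two parts is either
associated to `P` or has a monomial with a large exponent, which is to survive the specialization. -/
theorem exists_finset_irreducible_of_kronecker {K : Type*} [Field K]
    {P : MvPolynomial (Fin n) (Polynomial K)} (hP : Irreducible P) (hd : 1 ≤ P.totalDegree) :
    ∃ (𝒢 : Finset (Polynomial (Polynomial K))) (h : Polynomial K),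
      (∀ G ∈ 𝒢, Irreducible G ∧ G.natDegree ≠ 0) ∧ h ≠ 0 ∧
      ∀ t : K, h.eval t ≠ 0 → (∀ G ∈ 𝒢, Irreducible (G.map (Polynomial.evalRingHom t))) →
        Irreducible (map (Polynomial.evalRingHom t) P) := by
  classical
  set D := P.totalDegree + 1 with hDdef
  have hPbox : IsBoxed D P := isBoxed_of_totalDegree_lt (Nat.lt_succ_self _)
  set κ := kronecker (Polynomial K) n D with hκ
  have hκP : κ P ≠ 0 := by
    intro h0
    refine hP.ne_zero (kronecker_injOn hPbox (B := 0) (fun e he => ?_) ?_)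
    · simp at he
    · rw [← hκ, h0, map_zero]
  set m := UniqueFactorizationMonoid.factors (κ P) with hm
  have hmprod : Associated m.prod (κ P) := UniqueFactorizationMonoid.factors_prod hκP
  have hmirr : ∀ G ∈ m, Irreducible G :=
    fun G hG => UniqueFactorizationMonoid.irreducible_of_factor G hG
  have hlift : ∀ s ≤ m, ∃ A : MvPolynomial (Fin n) (Polynomial K), IsBoxed D A ∧ κ A = s.prod := by
    intro s hs
    refine exists_kronecker_eq (lt_of_le_of_lt ?_ (natDegree_kronecker_lt (Nat.succ_pos _) hPbox))
    exact Polynomial.natDegree_le_of_dvd ((Multiset.prod_dvd_prod_of_le hs).trans hmprod.dvd) hκP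
  choose! A hAbox hAκ using hlift
  -- `hs s` detects a monomial of `A s * A (m - s)` with a large exponent, if there is one
  have hdetect : ∀ s : Multiset (Polynomial (Polynomial K)), ∃ hs : Polynomial K, hs ≠ 0 ∧
      (IsBoxed D (A s * A (m - s)) ∨
        ∃ e, (A s * A (m - s)).coeff e = hs ∧ ¬ ∀ i, e i < D) := by
    intro s
    by_cases hb : IsBoxed D (A s * A (m - s))
    · exact ⟨1, one_ne_zero, Or.inl hb⟩
    · rw [IsBoxed] at hb
      push Not at hb
      obtain ⟨e, he, i, hi⟩ := hb
      exact ⟨_, he, Or.inr ⟨e, rfl, fun h => absurd (h i) (not_lt.mpr hi)⟩⟩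
  choose hs hs0 hsspec using hdetect
  obtain ⟨d, hd1, hd0⟩ := (one_le_totalDegree_iff P).mp hd
  refine ⟨m.toFinset.filter fun G => G.natDegree ≠ 0,
    P.coeff d * ((∏ s ∈ m.powerset.toFinset, hs s) *
      ∏ G ∈ m.toFinset.filter fun G => G.natDegree = 0, G.coeff 0), ?_, ?_, ?_⟩
  · intro G hG
    rw [Finset.mem_filter, Multiset.mem_toFinset] at hG
    exact ⟨hmirr G hG.1, hG.2⟩
  · refine mul_ne_zero hd1 (mul_ne_zero (Finset.prod_ne_zero_iff.mpr fun s _ => hs0 s)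
      (Finset.prod_ne_zero_iff.mpr fun G hG h0 => ?_))
    rw [Finset.mem_filter, Multiset.mem_toFinset] at hG
    have := (hmirr G hG.1).ne_zero
    rw [Polynomial.eq_C_of_natDegree_eq_zero hG.2, h0, Polynomial.C_0] at this
    exact this rfl
  intro t ht hirr
  rw [Polynomial.eval_mul, Polynomial.eval_mul, Polynomial.eval_prod, Polynomial.eval_prod] at ht
  set f := Polynomial.evalRingHom t with hf
  have htd := left_ne_zero_of_mul ht
  have hts := Finset.prod_ne_zero_iff.mp (left_ne_zero_of_mul (right_ne_zero_of_mul ht))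
  have htc := Finset.prod_ne_zero_iff.mp (right_ne_zero_of_mul (right_ne_zero_of_mul ht))
  have hPt : 1 ≤ (map f P).totalDegree :=
    (one_le_totalDegree_iff _).mpr ⟨d, by rw [coeff_map]; exact htd, hd0⟩
  have hPt0 : map f P ≠ 0 := by
    intro h
    rw [h, totalDegree_zero] at hPt
    omega
  have hfac : ∀ G ∈ m, Prime (G.map f) ∨ IsUnit (G.map f) := by
    intro G hG
    by_cases h0 : G.natDegree = 0
    · right
      rw [Polynomial.eq_C_of_natDegree_eq_zero h0, Polynomial.map_C]
      refine (isUnit_iff_ne_zero.mpr ?_).map Polynomial.C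
      exact htc G (Finset.mem_filter.mpr ⟨Multiset.mem_toFinset.mpr hG, h0⟩)
    · exact Or.inl (hirr G (Finset.mem_filter.mpr ⟨Multiset.mem_toFinset.mpr hG, h0⟩)).prime
  refine ⟨fun hu => ?_, fun {U V} hUV => ?_⟩
  · have := (isUnit_iff_totalDegree_of_isReduced.mp hu).2
    omega
  have hU0 : U ≠ 0 := by
    rintro rfl
    rw [zero_mul] at hUV
    exact hPt0 hUV
  have hV0 : V ≠ 0 := by
    rintro rfl
    rw [mul_zero] at hUV
    exact hPt0 hUV
  have hdeg := totalDegree_mul_of_isDomain hU0 hV0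
  have hle : (map f P).totalDegree ≤ P.totalDegree :=
    Finset.sup_mono (support_map_subset _ _)
  rw [← hUV] at hdeg
  have hUbox : IsBoxed D U := isBoxed_of_totalDegree_lt (by omega)
  have hVbox : IsBoxed D V := isBoxed_of_totalDegree_lt (by omega)
  have hprodmap : ∀ s : Multiset (Polynomial (Polynomial K)),
      (s.map fun G => G.map f).prod = s.prod.map f := by
    intro s
    rw [Polynomial.map_multiset_prod]
  have hκUV : Associated ((m.map fun G => G.map f).prod)
      (kronecker K n D U * kronecker K n D V) := by
    rw [← map_mul, ← hUV, kronecker_map, hprodmap]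
    exact hmprod.map (Polynomial.mapRingHom f)
  obtain ⟨s, hsm, hsU⟩ := exists_associated_prod_of_dvd (fun G => G.map f) m hfac
    ((dvd_mul_right _ _).trans hκUV.symm.dvd)
  have hsm' : m - s ≤ m := Multiset.sub_le_self m s
  have hκU0 : kronecker K n D U ≠ 0 := by
    intro h0
    refine hU0 (kronecker_injOn hUbox (B := 0) (fun e he => ?_) (by rw [h0, map_zero]))
    simp at he
  have hsV : Associated (kronecker K n D V) ((m - s).map fun G => G.map f).prod := by
    have h1 : Associated (kronecker K n D U * kronecker K n D V)
        ((s.map fun G => G.map f).prod * ((m - s).map fun G => G.map f).prod) := by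
      rw [← Multiset.prod_add, ← Multiset.map_add, add_tsub_cancel_of_le hsm]
      exact hκUV.symm
    exact Associated.of_mul_left h1 hsU hκU0
  -- recombine: `U` and `V` are specializations of `A s` and `A (m - s)`, up to constants
  have hrecomb : ∀ (W : MvPolynomial (Fin n) K) (r : Multiset (Polynomial (Polynomial K))),
      r ≤ m → IsBoxed D W → Associated (kronecker K n D W) ((r.map fun G => G.map f).prod) →
      ∃ c : K, IsUnit c ∧ W = C c * map f (A r) := by
    intro W r hr hW hass
    obtain ⟨u, hu⟩ := hass.symm
    obtain ⟨c, hc, hcu⟩ := Polynomial.isUnit_iff.mp u.isUnit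
    refine ⟨c, hc, kronecker_injOn hW (((hAbox r hr).map f).C_mul c) ?_⟩
    rw [map_mul, kronecker_C, kronecker_map, ← hκ, hAκ r hr, ← hu, hprodmap, ← hcu, mul_comm]
  obtain ⟨c, hc, hUc⟩ := hrecomb U s hsm hUbox hsU
  obtain ⟨c', hc', hVc⟩ := hrecomb V (m - s) hsm' hVbox hsV
  rcases hsspec s with hbox | ⟨e, he, hebox⟩
  · obtain ⟨u, hu⟩ := hmprod.symm
    obtain ⟨r, hr, hru⟩ := Polynomial.isUnit_iff.mp u.isUnit
    have h1 : A s * A (m - s) = C r * P := by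
      refine kronecker_injOn hbox (hPbox.C_mul r) ?_
      rw [map_mul, map_mul, kronecker_C, ← hκ, hAκ s hsm, hAκ (m - s) hsm', ← Multiset.prod_add,
        add_tsub_cancel_of_le hsm, ← hu, ← hru, mul_comm]
    have h2 : Irreducible (A s * A (m - s)) := by
      rw [h1, irreducible_isUnit_mul (hr.map C)]
      exact hP
    rcases h2.isUnit_or_isUnit rfl with h | h
    · left
      rw [hUc]
      exact (hc.map C).mul (h.map _)
    · right
      rw [hVc]
      exact (hc'.map C).mul (h.map _)
  · exfalso
    apply hebox
    refine (hPbox.map f) e ?_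
    have h1 : map f P = C (c * c') * map f (A s * A (m - s)) := by
      rw [hUV, hUc, hVc, RingHom.map_mul (map f) (A s) (A (m - s)), C_mul]
      ring
    rw [h1, coeff_C_mul, coeff_map, he]
    exact mul_ne_zero (hc.mul hc').ne_zero
      (hts s (Multiset.mem_toFinset.mpr (Multiset.mem_powerset.mpr hsm)))

end Kronecker

/-! ### Hilbert's irreducibility theorem -/

section HilbertIrreducibility
variable {O K : Type*} [CommRing O] [IsDomain O] [CharZero O] [Field K] [Algebra O K]
  [IsFractionRing O K] {ι : Type*} [Fintype ι] {σ : ι → O →+* ℝ}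

/-- Hilbert's irreducibility theorem: the natural numbers form a Hilbert set in the fraction field
of a ring with a discrete system of real embeddings and infinitely many inert integers, provided that
a fixed element of the ring clears the denominators of all integral elements. -/
theorem isHilbertSet_range_algebraMap
    (hσ : ∀ b : O, (∀ j, |σ j b| < 1) → b = 0) (hinert : ∀ n, ∃ p ≥ n, IsInert O p)
    {c : O} (hc0 : c ≠ 0)
    (hc : ∀ y : K, IsIntegral O y → ∃ z : O, algebraMap O K z = algebraMap O K c * y) :
    IsHilbertSet (Set.range (algebraMap O K)) := by
  intro N s hs P hP hd g hg
  choose 𝒢 h h𝒢 hh0 hspec using fun i => exists_finset_irreducible_of_kronecker (hP i) (hd i)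
  obtain ⟨t, ht, hirr⟩ := exists_natCast_forall_irreducible (K := K) hσ hinert hc0 hc
    (fun x : Σ i, 𝒢 i => (x.2 : Polynomial (Polynomial K))) (fun x => (h𝒢 x.1 _ x.2.2).1)
    (fun x => (h𝒢 x.1 _ x.2.2).2) (g := g * ∏ i, h i)
    (mul_ne_zero hg (Finset.prod_ne_zero_iff.mpr fun i _ => hh0 i))
  rw [Polynomial.eval_mul, Polynomial.eval_prod] at ht
  refine ⟨t, ⟨t, map_natCast _ _⟩, left_ne_zero_of_mul ht, fun i => hspec i t ?_ fun G hG => ?_⟩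
  · exact Finset.prod_ne_zero_iff.mp (right_ne_zero_of_mul ht) i (Finset.mem_univ i)
  · exact hirr ⟨i, ⟨G, hG⟩⟩

end HilbertIrreducibility

end SchinzelRing

namespace SchinzelRing

/-! ### The ring `ℤ[√5]` is Hilbertian -/

section ZsqrtdFive

lemma five_ne_mul_self (n : ℤ) : (5 : ℤ) ≠ n * n := by
  intro h
  have h1 : n < 3 := by nlinarith
  have h2 : -3 < n := by nlinarith
  interval_cases n <;> omega

/-- The two real embeddings of `ℤ[√5]`. -/
noncomputable def realEmbedding : Bool → Zsqrtd 5 →+* ℝ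
  | true => Zsqrtd.toReal (by norm_num)
  | false => (Zsqrtd.toReal (by norm_num)).comp (starRingEnd (Zsqrtd 5))

lemma eq_zero_of_abs_realEmbedding_lt_one {b : Zsqrtd 5} (hb : ∀ j, |realEmbedding j b| < 1) :
    b = 0 := by
  have h1 := hb true
  have h2 := hb false
  have h3 : realEmbedding true b * realEmbedding false b = (b.norm : ℝ) := by
    have := Zsqrtd.norm_eq_mul_conj b
    have h := congrArg (realEmbedding true) this
    rw [map_intCast, map_mul] at h
    exact h.symm
  have h4 : |(b.norm : ℝ)| < 1 := by
    rw [← h3, abs_mul]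
    exact mul_lt_one_of_nonneg_of_lt_one_left (abs_nonneg _) h1 h2.le
  have h5 : |b.norm| < 1 := by exact_mod_cast h4
  exact (Zsqrtd.norm_eq_zero five_ne_mul_self b).mp (Int.abs_lt_one_iff.mp h5)

/-- A prime `p ≡ 2 mod 5` is inert in `ℤ[√5]`, since `5` is not a square modulo `p`. -/
lemma isInert_of_mod_five_eq_two {p : ℕ} (hp : p.Prime) (hp2 : p ≠ 2) (hp5 : p % 5 = 2) :
    IsInert (Zsqrtd 5) p := by
  have := Fact.mk hp
  have : Fact (Nat.Prime 5) := ⟨by norm_num⟩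
  have hsq : ¬ IsSquare (5 : ZMod p) := by
    have h := ZMod.exists_sq_eq_prime_iff_of_mod_four_eq_one (p := 5) (q := p) (by norm_num) hp2
    have hp' : (p : ZMod 5) = 2 := by
      have : ((p : ℕ) : ZMod 5) = ((2 : ℕ) : ZMod 5) := by
        rw [ZMod.natCast_eq_natCast_iff]
        exact hp5
      simpa using this
    rw [hp'] at h
    push_cast at h
    rw [← h]
    clear h hp' hp5 hp2 hp
    decide +revert
  intro a ha
  have hN : ¬ (p : ℤ) ∣ a.norm := by
    intro hdvd
    apply ha
    have h0 : ((a.norm : ℤ) : ZMod p) = 0 := (ZMod.intCast_zmod_eq_zero_iff_dvd _ _).mpr hdvd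
    rw [Zsqrtd.norm_def] at h0
    push_cast at h0
    have him : (a.im : ZMod p) = 0 := by
      by_contra h
      refine hsq ⟨(a.re : ZMod p) / a.im, ?_⟩
      field_simp
      linear_combination -h0
    have hre : (a.re : ZMod p) = 0 := by
      rw [him] at h0
      simpa using h0
    have := (Zsqrtd.intCast_dvd (p : ℤ) a).mpr
      ⟨(ZMod.intCast_zmod_eq_zero_iff_dvd _ _).mp hre,
        (ZMod.intCast_zmod_eq_zero_iff_dvd _ _).mp him⟩
    simpa using this
  have hcop : IsCoprime (p : ℤ) a.norm :=
    (Prime.coprime_iff_not_dvd (Nat.prime_iff_prime_int.mp hp)).mpr hN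
  obtain ⟨u, w, huw⟩ := hcop
  refine ⟨w * star a, -u, ?_⟩
  have h := congrArg (Int.cast : ℤ → Zsqrtd 5) huw
  push_cast at h
  rw [Zsqrtd.norm_eq_mul_conj] at h
  linear_combination h

lemma exists_isInert_zsqrtd_five (n : ℕ) : ∃ p ≥ n, IsInert (Zsqrtd 5) p := by
  have hu : IsUnit (2 : ZMod 5) := by decide
  obtain ⟨p, hpn, hp, hp5⟩ := Nat.forall_exists_prime_gt_and_eq_mod hu (max n 2)
  have h5 : p % 5 = 2 := by
    have : ((p : ℕ) : ZMod 5) = ((2 : ℕ) : ZMod 5) := by simpa using hp5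
    rw [ZMod.natCast_eq_natCast_iff] at this
    exact this
  exact ⟨p, by omega, isInert_of_mod_five_eq_two hp (by omega) h5⟩

/-- Integers are integrally closed in any field of characteristic zero. -/
lemma exists_intCast_eq_of_isIntegral {K : Type*} [Field K] [CharZero K] {x : K}
    (hx : IsIntegral ℤ x) {M p : ℤ} (hM : M ≠ 0) (h : (M : K) * x = p) : ∃ n : ℤ, (n : K) = x := by
  have hM' : (M : K) ≠ 0 := Int.cast_ne_zero.mpr hM
  have hxq : x = ((p / M : ℚ) : K) := by
    push_cast
    field_simp
    linear_combination h
  rw [hxq] at hx ⊢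
  have h1 : IsIntegral ℤ (p / M : ℚ) :=
    (isIntegral_algHom_iff (Rat.castHom K).toIntAlgHom (Rat.castHom K).injective).mp hx
  obtain ⟨n, hn⟩ := IsIntegrallyClosed.isIntegral_iff.mp h1
  refine ⟨n, ?_⟩
  rw [← hn]
  simp

lemma isIntegral_int_zsqrtd_five (z : Zsqrtd 5) : IsIntegral ℤ z := by
  have h : z = z.re + z.im * Zsqrtd.sqrtd (d := 5) := by
    ext <;> simp
  have hs : IsIntegral ℤ (Zsqrtd.sqrtd : Zsqrtd 5) := by
    refine IsIntegral.of_pow (n := 2) (by norm_num) ?_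
    rw [pow_two, Zsqrtd.dmuld]
    exact isIntegral_algebraMap (x := (5 : ℤ))
  rw [h]
  exact (isIntegral_algebraMap (x := z.re)).add ((isIntegral_algebraMap (x := z.im)).mul hs)

/-- Over its fraction field, twice an element integral over `ℤ[√5]` belongs to `ℤ[√5]`. -/
lemma exists_two_mul_of_isIntegral {K : Type*} [Field K] [Algebra (Zsqrtd 5) K]
    [IsFractionRing (Zsqrtd 5) K] (y : K) (hy : IsIntegral (Zsqrtd 5) y) :
    ∃ z : Zsqrtd 5, algebraMap (Zsqrtd 5) K z = algebraMap (Zsqrtd 5) K 2 * y := by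
  set f := algebraMap (Zsqrtd 5) K with hf
  have hfi : Function.Injective f := IsFractionRing.injective _ _
  have : CharZero K := charZero_of_injective_algebraMap hfi
  have : Algebra.IsIntegral ℤ (Zsqrtd 5) := ⟨isIntegral_int_zsqrtd_five⟩
  have hyZ : IsIntegral ℤ y := isIntegral_trans y hy
  -- the conjugation of the fraction field
  let τ : K →+* K := IsFractionRing.map (A := Zsqrtd 5) (B := Zsqrtd 5)
    (j := starRingEnd (Zsqrtd 5)) star_injective
  have hτ : ∀ z, τ (f z) = f (star z) := fun z => IsLocalization.map_eq _ z
  -- an integer `M` with `M * y = u + v * √5`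
  obtain ⟨M, u, v, hM, hMy⟩ : ∃ M u v : ℤ, M ≠ 0 ∧ (M : K) * y = u + v * f Zsqrtd.sqrtd := by
    obtain ⟨a, b, hb, hab⟩ := IsFractionRing.div_surjective (A := Zsqrtd 5) y
    have hb0 : b ≠ 0 := nonZeroDivisors.ne_zero hb
    have hfb : f b ≠ 0 := (map_ne_zero_iff f hfi).mpr hb0
    refine ⟨b.norm, (a * star b).re, (a * star b).im,
      (Zsqrtd.norm_eq_zero five_ne_mul_self b).not.mpr hb0, ?_⟩
    have h1 : (a * star b : Zsqrtd 5) =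
        ((a * star b).re : ℤ) + ((a * star b).im : ℤ) * Zsqrtd.sqrtd (d := 5) := by
      ext <;> simp
    have h2 : ((b.norm : ℤ) : K) = f b * f (star b) := by
      rw [← map_mul, ← Zsqrtd.norm_eq_mul_conj, map_intCast]
    have h3 := congrArg f h1
    rw [map_add, map_mul, map_mul, map_intCast, map_intCast] at h3
    rw [← h3, h2, ← hab, ← hf]
    field_simp
  set r := f Zsqrtd.sqrtd with hr
  have hrr : r * r = 5 := by
    rw [hr, ← map_mul, Zsqrtd.dmuld, map_intCast, Int.cast_ofNat]
  have hτr : τ r = -r := by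
    rw [hr, hτ, ← map_neg]
    congr 1
  have hτy : (M : K) * τ y = u - v * r := by
    have := congrArg τ hMy
    rw [map_add, map_mul, map_mul, map_intCast, map_intCast, map_intCast, hτr] at this
    linear_combination this
  have hM' : (M : K) ≠ 0 := Int.cast_ne_zero.mpr hM
  have hτyZ : IsIntegral ℤ (τ y) := hyZ.map τ.toIntAlgHom
  have hrZ : IsIntegral ℤ r := (isIntegral_int_zsqrtd_five _).map f.toIntAlgHom
  -- the trace of `y`, and the trace and the norm of `√5 * y`
  obtain ⟨t, ht⟩ := exists_intCast_eq_of_isIntegral (hyZ.add hτyZ) hM (p := 2 * u) (by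
    push_cast
    linear_combination hMy + hτy)
  obtain ⟨w, hw⟩ := exists_intCast_eq_of_isIntegral ((hyZ.sub hτyZ).mul hrZ) hM (p := 10 * v) (by
    push_cast
    linear_combination r * (hMy - hτy) + 2 * v * hrr)
  obtain ⟨n, hn⟩ := exists_intCast_eq_of_isIntegral ((hyZ.sub hτyZ).pow 2) (pow_ne_zero 2 hM)
    (p := 20 * v ^ 2) (by
      push_cast
      linear_combination (M * (y - τ y) + 2 * v * r) * (hMy - hτy) + 4 * v ^ 2 * hrr)
  have hwn : w ^ 2 = 5 * n := by
    have : ((w ^ 2 : ℤ) : K) = ((5 * n : ℤ) : K) := by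
      push_cast
      rw [hw, hn]
      linear_combination (y - τ y) ^ 2 * hrr
    exact_mod_cast this
  obtain ⟨w', rfl⟩ : (5 : ℤ) ∣ w :=
    (by norm_num : Prime (5 : ℤ)).dvd_of_dvd_pow (Dvd.intro _ hwn.symm)
  refine ⟨t + w' * Zsqrtd.sqrtd (d := 5), ?_⟩
  rw [map_add, map_mul, map_intCast, map_intCast, ← hr, ht, map_ofNat]
  push_cast at hw
  linear_combination (1 / 5 : K) * r * hw + (1 / 5 : K) * (y - τ y) * hrr

/-- The ring `ℤ[√5]` is Hilbertian. -/
theorem isHilbertianRing_zsqrtd_five : IsHilbertianRing (Zsqrtd 5) :=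
  isHilbertianRing_of_isHilbertSet <|
    isHilbertSet_range_algebraMap (σ := realEmbedding) (fun _ => eq_zero_of_abs_realEmbedding_lt_one)
      exists_isInert_zsqrtd_five (c := 2) two_ne_zero exists_two_mul_of_isIntegral

end ZsqrtdFive

end SchinzelRing

namespace SchinzelRing
open MvPolynomial

/-! ### Failure of the Schinzel property for `ℤ[√5]` -/

section Counterexample

lemma isHalfNearUFD_zsqrtd_five : IsHalfNearUFD (Zsqrtd 5) := by
  refine ⟨fun a ha => ?_⟩
  have hN : a.norm ≠ 0 := (Zsqrtd.norm_eq_zero five_ne_mul_self a).not.mpr ha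
  set m := a.norm.natAbs with hm
  have : NeZero m := ⟨Int.natAbs_ne_zero.mpr hN⟩
  -- an ideal that contains `m` is determined by its image in `(ℤ/m)²`
  let φ : Zsqrtd 5 → ZMod m × ZMod m := fun z => (z.re, z.im)
  have hφ : ∀ {I : Ideal (Zsqrtd 5)}, (m : Zsqrtd 5) ∈ I → ∀ {x y}, φ x = φ y → y ∈ I → x ∈ I := by
    intro I hI x y hxy hy
    have h1 : ((m : ℤ) : Zsqrtd 5) ∣ x - y := by
      rw [Zsqrtd.intCast_dvd, Zsqrtd.re_sub, Zsqrtd.im_sub,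
        ← ZMod.intCast_zmod_eq_zero_iff_dvd, ← ZMod.intCast_zmod_eq_zero_iff_dvd]
      push_cast
      exact ⟨sub_eq_zero.mpr (Prod.ext_iff.mp hxy).1, sub_eq_zero.mpr (Prod.ext_iff.mp hxy).2⟩
    have h2 := I.add_mem (I.mem_of_dvd h1 (by simpa using hI)) hy
    rwa [sub_add_cancel] at h2
  refine Set.Finite.of_injOn (f := fun I : Ideal (Zsqrtd 5) => φ '' I) (Set.mapsTo_univ _ _) ?_
    Set.finite_univ
  have hmem : ∀ I ∈ {I : Ideal (Zsqrtd 5) | ∃ p, Prime p ∧ p ∣ a ∧ I = Ideal.span {p}},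
      (m : Zsqrtd 5) ∈ I := by
    rintro I ⟨p, -, hp, rfl⟩
    rw [Ideal.mem_span_singleton]
    have h1 : p ∣ ((a.norm : ℤ) : Zsqrtd 5) := by
      rw [Zsqrtd.norm_eq_mul_conj]
      exact hp.mul_right _
    have h2 : ((a.norm : ℤ) : Zsqrtd 5) ∣ ((m : ℤ) : Zsqrtd 5) := by
      rw [Zsqrtd.intCast_dvd_intCast, hm]
      exact Int.dvd_natAbs.mpr dvd_rfl
    simpa using h1.trans h2
  intro I hI J hJ hIJ
  simp only at hIJ
  ext x
  constructor
  · intro hx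
    obtain ⟨y, hy, hyx⟩ := hIJ ▸ Set.mem_image_of_mem φ hx
    exact hφ (hmem J hJ) hyx.symm hy
  · intro hx
    obtain ⟨y, hy, hyx⟩ := hIJ.symm ▸ Set.mem_image_of_mem φ hx
    exact hφ (hmem I hI) hyx.symm hy

lemma natAbs_norm_ne_two (z : Zsqrtd 5) : z.norm.natAbs ≠ 2 := by
  intro h
  have h1 : z.norm = 2 ∨ z.norm = -2 := by omega
  have key : ∀ x y : ZMod 4, x * x - 5 * y * y ≠ 2 := by decide
  refine key z.re z.im ?_
  have h2 : ((z.norm : ℤ) : ZMod 4) = 2 := by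
    rcases h1 with h1 | h1 <;> rw [h1] <;> decide
  rw [Zsqrtd.norm_def] at h2
  push_cast at h2
  exact h2

lemma irreducible_of_natAbs_norm_eq_four {z : Zsqrtd 5} (hz : z.norm.natAbs = 4) :
    Irreducible z := by
  refine ⟨fun h => ?_, fun {a b} hab => ?_⟩
  · rw [← Zsqrtd.norm_eq_one_iff] at h
    omega
  · rw [← Zsqrtd.norm_eq_one_iff, ← Zsqrtd.norm_eq_one_iff]
    rw [hab, Zsqrtd.norm_mul, Int.natAbs_mul] at hz
    have h1 : a.norm.natAbs ≤ 4 := Nat.le_of_dvd (by norm_num) (Dvd.intro _ hz)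
    have h2 := natAbs_norm_ne_two a
    interval_cases h : a.norm.natAbs <;> omega

lemma irreducible_two_zsqrtd_five : Irreducible (2 : Zsqrtd 5) :=
  irreducible_of_natAbs_norm_eq_four (by decide)

lemma irreducible_one_add_sqrt_five : Irreducible (⟨1, 1⟩ : Zsqrtd 5) :=
  irreducible_of_natAbs_norm_eq_four (by decide)

lemma isUnit_of_dvd_two_of_dvd_one_add_sqrt_five {a : Zsqrtd 5} (h2 : a ∣ 2)
    (h : a ∣ (⟨1, 1⟩ : Zsqrtd 5)) : IsUnit a := by
  obtain ⟨b, hb⟩ := h2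
  refine (irreducible_two_zsqrtd_five.isUnit_or_isUnit hb).resolve_right fun hu => ?_
  have h3 : (2 : Zsqrtd 5) ∣ ⟨1, 1⟩ := by
    rw [hb, hu.mul_right_dvd]
    exact h
  have h4 := (Zsqrtd.intCast_dvd 2 ⟨1, 1⟩).mp (by exact_mod_cast h3)
  norm_num at h4

/-- For every `m`, the elements `2 + (√5 - 1) * m` and `4` have one of the irreducible elements `2`
and `1 + √5` as a common divisor. -/
lemma exists_irreducible_dvd (m : Zsqrtd 5) :
    ∃ a : Zsqrtd 5, Irreducible a ∧ a ∣ 2 + ⟨-1, 1⟩ * m ∧ a ∣ 4 := by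
  obtain ⟨x, y⟩ := m
  rcases Int.even_or_odd (x + y) with h | h
  · refine ⟨2, irreducible_two_zsqrtd_five, ?_, ⟨2, by norm_num⟩⟩
    obtain ⟨r, hr⟩ := h
    refine ⟨⟨1 + 3 * y - r, r - y⟩, ?_⟩
    ext <;> simp <;> omega
  · refine ⟨⟨1, 1⟩, irreducible_one_add_sqrt_five, ?_, ⟨⟨-1, 1⟩, by decide⟩⟩
    obtain ⟨r, hr⟩ := h
    refine ⟨⟨3 * r + 1 - 4 * y, 2 * y - r⟩, ?_⟩
    ext <;> simp <;> omega

section Linear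
variable {R : Type*} [CommRing R]

lemma coeff_linear_zero (a b : R) : coeff 0 (C a * X 0 + C b : MvPolynomial (Fin 1) R) = b := by
  rw [coeff_add, coeff_C_mul, coeff_zero_X, mul_zero, zero_add, coeff_zero_C]

lemma coeff_linear_one (a b : R) :
    coeff (Finsupp.single 0 1) (C a * X 0 + C b : MvPolynomial (Fin 1) R) = a := by
  classical
  have h : (0 : Fin 1 →₀ ℕ) ≠ Finsupp.single 0 1 := by simp [eq_comm]
  rw [coeff_add, coeff_C_mul, coeff_X, if_pos rfl, mul_one, coeff_C, if_neg h, add_zero]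

lemma isZeroMod_linear {I : Ideal R} {a b : R} :
    IsZeroMod I (C a * X 0 + C b : MvPolynomial (Fin 1) R) ↔ a ∈ I ∧ b ∈ I := by
  classical
  constructor
  · intro h
    have h1 := h (Finsupp.single 0 1)
    have h2 := h 0
    rw [coeff_linear_one] at h1
    rw [coeff_linear_zero] at h2
    exact ⟨h1, h2⟩
  · rintro ⟨ha, hb⟩ d
    rw [coeff_add, coeff_C_mul, coeff_C]
    refine I.add_mem (I.mul_mem_right _ ha) ?_
    split_ifs
    · exact hb
    · exact I.zero_mem

lemma irreducible_linear {F : Type*} [Field F] {a : F} (ha : a ≠ 0) (b : F) :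
    Irreducible (C a * X 0 + C b : MvPolynomial (Fin 1) F) := by
  have h1 := coeff_linear_one a b
  refine irreducible_of_totalDegree_eq_one (le_antisymm ?_ ?_) fun x hx => ?_
  · refine (totalDegree_add _ _).trans (max_le ?_ (by simp))
    exact (totalDegree_mul _ _).trans (by simp)
  · have h2 := le_totalDegree (p := (C a * X 0 + C b : MvPolynomial (Fin 1) F))
      (s := Finsupp.single 0 1) (by rwa [mem_support_iff, h1])
    simpa using h2
  · exact isUnit_of_dvd_unit (hx (Finsupp.single 0 1)) (by rw [h1]; exact ha.isUnit)

lemma irredOverQT_linear {Z : Type*} [CommRing Z] [IsDomain Z] {k : ℕ} {a : MvPolynomial (Fin k) Z}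
    (ha : a ≠ 0) (b : MvPolynomial (Fin k) Z) : IrredOverQT (C a * X 0 + C b : PolyTY Z k 1) := by
  have h1 : map (algebraMap Z (FractionRing Z)) a ≠ 0 :=
    (map_ne_zero_iff _ (map_injective _ (IsFractionRing.injective _ _))).mpr ha
  rw [IrredOverQT, map_add, map_mul, map_C, map_X, map_C, map_add, map_mul, map_C, map_X, map_C]
  exact irreducible_linear ((map_ne_zero_iff _ (IsFractionRing.injective _ _)).mpr h1) _

end Linear

/-- The polynomial `(2 + (√5 - 1) * T) * Y + 4` over `ℤ[√5]`. -/
noncomputable def counterexample : PolyTY (Zsqrtd 5) 1 1 :=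
  C (C 2 + C ⟨-1, 1⟩ * X 0) * X 0 + C (C 4)

lemma spec_counterexample (t : Fin 1 → Zsqrtd 5) :
    spec t counterexample = C (2 + ⟨-1, 1⟩ * t 0) * X 0 + C 4 := by
  simp [spec, counterexample]

lemma primOverQT_counterexample : PrimOverQT counterexample := by
  intro r hr
  have h := hr 0
  rw [counterexample, coeff_linear_zero, map_C] at h
  refine isUnit_of_dvd_unit h ((IsUnit.mk0 _ ?_).map C)
  exact (map_ne_zero_iff _ (IsFractionRing.injective _ _)).mpr (by decide : (4 : Zsqrtd 5) ≠ 0)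

lemma irredOverQT_counterexample : IrredOverQT counterexample := by
  refine irredOverQT_linear (fun h => ?_) _
  have h1 := congrArg (eval 0) h
  simp at h1

lemma noFixDiv_counterexample {PT : Set (Ideal (Zsqrtd 5))} (hPT : PT ⊆ nonunitType _) :
    NoFixDiv PT (fun _ : Fin 1 => counterexample) := by
  intro I hI ⟨_, hfix⟩
  obtain ⟨a, -, hu, rfl⟩ := hPT hI
  refine hu (isUnit_of_dvd_two_of_dvd_one_add_sqrt_five ?_ ?_)
  · have := hfix 0
    rw [Fin.prod_univ_one, spec_counterexample, isZeroMod_linear] at this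
    simpa [Ideal.mem_span_singleton] using this.1
  · have := hfix 1
    rw [Fin.prod_univ_one, spec_counterexample, isZeroMod_linear] at this
    have h := this.1
    rw [Ideal.mem_span_singleton] at h
    rwa [show (2 + ⟨-1, 1⟩ * (1 : Fin 1 → Zsqrtd 5) 0 : Zsqrtd 5) = ⟨1, 1⟩ by decide] at h

lemma irredType_subset_nonunitType (R : Type*) [CommRing R] : irredType R ⊆ nonunitType R := by
  rintro I ⟨a, ha, rfl⟩
  exact ⟨a, ha.ne_zero, ha.not_isUnit, rfl⟩

/-- Every specialization of the counterexample is divisible by an irreducible element. -/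
lemma exists_irredType_isZeroMod_counterexample (t : Fin 1 → Zsqrtd 5) :
    ∃ I ∈ irredType (Zsqrtd 5), IsZeroMod I (spec t counterexample) := by
  obtain ⟨a, ha, h1, h2⟩ := exists_irreducible_dvd (t 0)
  refine ⟨_, ⟨a, ha, rfl⟩, ?_⟩
  rw [spec_counterexample, isZeroMod_linear, Ideal.mem_span_singleton, Ideal.mem_span_singleton]
  exact ⟨h1, h2⟩

lemma ne_top_of_mem_nonunitType {R : Type*} [CommRing R] {I : Ideal R} (hI : I ∈ nonunitType R) :
    I ≠ ⊤ := by
  obtain ⟨a, -, hu, rfl⟩ := hI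
  rwa [Ne, Ideal.span_singleton_eq_top]

/-- All specializations of the counterexample acquire a fixed divisor, while an arithmetic progression
is infinite. -/
theorem not_isSchinzelRing_zsqrtd_five {PT : Set (Ideal (Zsqrtd 5))} (h1 : irredType _ ⊆ PT)
    (h2 : PT ⊆ nonunitType _) : ¬ IsSchinzelRing (Zsqrtd 5) PT := by
  intro h
  obtain ⟨ω, α, hω, hfin⟩ := h 0 1 1 le_rfl le_rfl (fun _ => counterexample)
    (fun _ => primOverQT_counterexample) (noFixDiv_counterexample h2)
  have hbad : ∀ t₁ : Zsqrtd 5,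
      ¬ NoFixDiv PT (fun _ : Fin 1 => specFirst t₁ counterexample) := by
    intro t₁ hno
    obtain ⟨I, hI, hzero⟩ := exists_irredType_isZeroMod_counterexample fun _ => t₁
    refine hno I (h1 hI) ⟨ne_top_of_mem_nonunitType (irredType_subset_nonunitType _ hI), fun t => ?_⟩
    rw [Fin.prod_univ_one, spec_specFirst]
    convert hzero using 2
    ext i : 1
    fin_cases i
    rfl
  refine (Set.infinite_range_of_injective (f := fun l : Zsqrtd 5 => ω * l + α) ?_) (hfin.subset ?_)
  · intro x y hxy
    simpa [hω] using hxy
  · exact fun t₁ ht => ⟨ht, fun h' => hbad t₁ h'.2⟩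

theorem not_isIntegrallyHilbertian_zsqrtd_five {PT : Set (Ideal (Zsqrtd 5))}
    (h1 : irredType _ ⊆ PT) (h2 : PT ⊆ nonunitType _) :
    ¬ IsIntegrallyHilbertian (Zsqrtd 5) PT := by
  intro h
  obtain ⟨t, ht, -⟩ := h 1 1 1 le_rfl le_rfl le_rfl (fun _ => counterexample)
    (fun _ => irredOverQT_counterexample) (fun _ => primOverQT_counterexample)
    (noFixDiv_counterexample h2) 1 one_ne_zero
  obtain ⟨I, hI, hzero⟩ := exists_irredType_isZeroMod_counterexample t
  refine ht.2 I (h1 hI) ?_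
  rwa [Fin.prod_univ_one]

end Counterexample

/-! ### Specializing coprime families of polynomials -/

section Coprime

/-- Polynomials over a unique factorization domain without nonunit common divisors generate an ideal
that contains a nonzero constant: over the fraction field they generate the unit ideal. -/
lemma exists_C_mem_span {R : Type*} [CommRing R] [IsDomain R] [UniqueFactorizationMonoid R]
    {S : Set (Polynomial R)} (hS : ∀ r, (∀ a ∈ S, r ∣ a) → IsUnit r) :
    ∃ r : R, r ≠ 0 ∧ Polynomial.C r ∈ Ideal.span S := by
  classical
  let : NormalizedGCDMonoid R := Classical.choice inferInstance
  let F := FractionRing R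
  set φ := Polynomial.mapRingHom (algebraMap R F) with hφ
  have hφi : Function.Injective φ := Polynomial.map_injective _ (IsFractionRing.injective R F)
  by_cases htop : (Ideal.span S).map φ = ⊤
  · obtain ⟨m, hm, a, ha, h⟩ := exists_mem_map_eq_C_mul (nonZeroDivisors R) (A := F)
      (I := Ideal.span S) (g := 1) (by rw [← hφ, htop]; trivial)
    refine ⟨m, nonZeroDivisors.ne_zero hm, ?_⟩
    rw [mul_one, ← Polynomial.map_C] at h
    rwa [← hφi h]
  exfalso
  -- otherwise the primitive part `q` of a proper generator is a common divisor
  obtain ⟨g, hg⟩ := (IsPrincipalIdealRing.principal ((Ideal.span S).map φ)).principal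
  rw [Ideal.submodule_span_eq] at hg
  rw [hg, Ideal.span_singleton_eq_top] at htop
  have hgS : ∀ a ∈ S, g ∣ φ a := fun a ha =>
    Ideal.mem_span_singleton.mp (hg ▸ Ideal.mem_map_of_mem φ (Ideal.subset_span ha))
  rcases eq_or_ne g 0 with rfl | hg0
  · refine not_isUnit_zero (hS 0 fun a ha => ?_)
    rw [(map_eq_zero_iff φ hφi).mp (zero_dvd_iff.mp (hgS a ha))]
  obtain ⟨m, hm, a, -, h⟩ := exists_mem_map_eq_C_mul (nonZeroDivisors R) (A := F)
    (I := ⊤) (g := g) (by rw [Ideal.map_top]; trivial)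
  have hm0 : IsUnit (Polynomial.C (algebraMap R F m)) :=
    ((IsLocalization.map_units F (⟨m, hm⟩ : nonZeroDivisors R)).map Polynomial.C)
  have ha0 : a ≠ 0 := by
    rintro rfl
    rw [Polynomial.map_zero, eq_comm] at h
    exact (mul_ne_zero hm0.ne_zero hg0) h
  have hag : φ a ∣ g := by
    change a.map (algebraMap R F) ∣ g
    rw [h, hm0.mul_left_dvd]
  have hqu : IsUnit a.primPart := hS _ fun b hb =>
    a.isPrimitive_primPart.dvd_of_fraction_map_dvd_fraction_map (K := F)
      (((map_dvd φ a.primPart_dvd).trans hag).trans (hgS b hb))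
  refine htop (isUnit_of_mul_isUnit_right (x := Polynomial.C (algebraMap R F m)) ?_)
  rw [← h, a.eq_C_content_mul_primPart, Polynomial.map_mul, Polynomial.map_C]
  refine IsUnit.mul (IsUnit.map Polynomial.C (IsUnit.mk0 _ ?_)) (hqu.map φ)
  exact (map_ne_zero_iff _ (IsFractionRing.injective R F)).mpr (Polynomial.content_eq_zero_iff.not.mpr ha0)

variable {σ R : Type*} [CommRing R] [IsDomain R] [UniqueFactorizationMonoid R]

/-- Polynomials in several variables without nonunit common divisors generate an ideal that contains
a nonzero polynomial free of a given variable. -/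
lemma exists_degreeOf_eq_zero_mem_span {S : Set (MvPolynomial σ R)}
    (hS : ∀ r, (∀ a ∈ S, r ∣ a) → IsUnit r) (j : σ) :
    ∃ D ∈ Ideal.span S, D ≠ 0 ∧ D.degreeOf j = 0 := by
  classical
  let e : MvPolynomial σ R ≃+* Polynomial (MvPolynomial {b // b ≠ j} R) :=
    ((renameEquiv R (Equiv.optionSubtypeNe j).symm).trans (optionEquivLeft R _) : _ ≃+* _)
  have hdeg : ∀ p, (e p).natDegree = p.degreeOf j := fun p => (degreeOf_eq_natDegree j p).symm
  obtain ⟨r, hr, hmem⟩ := exists_C_mem_span (S := e '' S) fun r hr => by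
    have := hS (e.symm r) fun a ha => by
      have := map_dvd e.symm (hr (e a) ⟨a, ha, rfl⟩)
      rwa [e.symm_apply_apply] at this
    simpa using this.map e
  refine ⟨e.symm (Polynomial.C r), ?_, by simpa using hr, ?_⟩
  · have h := Ideal.mem_map_of_mem e.symm hmem
    rw [Ideal.map_span, ← Set.image_comp] at h
    simpa using h
  · rw [← hdeg, e.apply_symm_apply, Polynomial.natDegree_C]

lemma degreeOf_le_of_dvd {R : Type*} [CommRing R] [IsDomain R] {p q : MvPolynomial σ R}
    (h : p ∣ q) (hq : q ≠ 0) (j : σ) : p.degreeOf j ≤ q.degreeOf j := by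
  obtain ⟨r, rfl⟩ := h
  rw [degreeOf_mul_eq (left_ne_zero_of_mul hq) (right_ne_zero_of_mul hq)]
  exact Nat.le_add_right _ _

lemma degreeOf_map_le {R S : Type*} [CommRing R] [CommRing S] (f : R →+* S) (p : MvPolynomial σ R)
    (j : σ) : (map f p).degreeOf j ≤ p.degreeOf j := by
  classical
  rw [degreeOf_def, degreeOf_def]
  exact Multiset.count_le_of_le _ degrees_map_le

lemma finite_map_evalRingHom_eq_zero {Q : Type*} [Field Q] {D : MvPolynomial σ (Polynomial Q)}
    (hD : D ≠ 0) : {t : Q | map (Polynomial.evalRingHom t) D = 0}.Finite := by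
  obtain ⟨d, hd⟩ := ne_zero_iff.mp hD
  refine (Polynomial.finite_setOfPred_isRoot hd).subset fun t ht => ?_
  have := congrArg (coeff d) ht
  simpa [coeff_map] using this

/-- Coprime families of polynomials with coefficients in `Q[x]` remain coprime under almost all
specializations of `x`: a common divisor has degree `0` in each variable. -/
lemma finite_not_coprime_specialization {Q : Type*} [Field Q] [Finite σ]
    {S : Set (MvPolynomial σ (Polynomial Q))} (hS : ∀ r, (∀ a ∈ S, r ∣ a) → IsUnit r) :
    {t : Q | ¬ ∀ r, (∀ a ∈ S, r ∣ map (Polynomial.evalRingHom t) a) → IsUnit r}.Finite := by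
  choose D hDS hD0 hDdeg using exists_degreeOf_eq_zero_mem_span hS
  obtain ⟨a, ha, ha0⟩ : ∃ a ∈ S, a ≠ 0 := by
    by_contra! h
    exact not_isUnit_zero (hS 0 fun a ha => by rw [h a ha])
  refine ((finite_map_evalRingHom_eq_zero ha0).union
    (Set.finite_iUnion fun j => finite_map_evalRingHom_eq_zero (hD0 j))).subset fun t ht => ?_
  by_contra hgood
  simp only [Set.mem_union, Set.mem_ofPred_eq, Set.mem_iUnion, not_or, not_exists] at hgood
  refine ht fun r hr => ?_
  have hspan : ∀ b ∈ Ideal.span S, r ∣ map (Polynomial.evalRingHom t) b := by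
    intro b hb
    rw [← Ideal.mem_span_singleton, ← Ideal.mem_comap]
    refine (Ideal.span_le.mpr fun a ha => ?_) hb
    exact Ideal.mem_comap.mpr (Ideal.mem_span_singleton.mpr (hr a ha))
  have hdeg : r.totalDegree = 0 := by
    rw [totalDegree_eq_zero_iff]
    intro d hd j
    have h1 := degreeOf_le_of_dvd (hspan _ (hDS j)) (hgood.2 j) j
    have h2 := degreeOf_map_le (Polynomial.evalRingHom t) (D j) j
    have h3 := monomial_le_degreeOf j hd
    rw [hDdeg j] at h2
    omega
  have hr0 : r ≠ 0 := by
    rintro rfl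
    exact hgood.1 (zero_dvd_iff.mp (hr a ha))
  rw [totalDegree_eq_zero_iff_eq_C] at hdeg
  rw [hdeg] at hr0 ⊢
  exact (IsUnit.mk0 _ fun h => hr0 (by rw [h, C_0])).map C

end Coprime

section Specialization
variable {Z : Type*} [CommRing Z] [IsDomain Z] {k n : ℕ}

omit [IsDomain Z] in
lemma map_coeff_specFirst (P : PolyTY Z (k + 1) n) (t : Z) (d : Fin n →₀ ℕ) :
    map (algebraMap Z (FractionRing Z)) ((specFirst t P).coeff d) =
      map (Polynomial.evalRingHom (algebraMap Z (FractionRing Z) t))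
        (splitFirst (FractionRing Z) k (map (algebraMap Z (FractionRing Z)) (P.coeff d))) := by
  rw [coeff_specFirst, splitFirst_map, map_map, map_map]
  congr 2
  ext x <;> simp

lemma finite_not_primOverQT_specFirst {P : PolyTY Z (k + 1) n} (hP : PrimOverQT P) :
    {t : Z | ¬ PrimOverQT (specFirst t P)}.Finite := by
  have key := finite_not_coprime_specialization
    (S := Set.range fun d => splitFirst (FractionRing Z) k
      (map (algebraMap Z (FractionRing Z)) (P.coeff d))) fun r hr => by
    have h := hP ((splitFirst (FractionRing Z) k).symm r) fun d => by
      have := map_dvd (splitFirst (FractionRing Z) k).symm (hr _ ⟨d, rfl⟩)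
      rwa [AlgEquiv.symm_apply_apply] at this
    simpa using h.map (splitFirst (FractionRing Z) k)
  refine (key.preimage (f := algebraMap Z (FractionRing Z))
    (IsFractionRing.injective Z _).injOn).subset fun t ht h => ht fun r hr => h r ?_
  rintro _ ⟨d, rfl⟩
  rw [← map_coeff_specFirst]
  exact hr d

end Specialization

/-! ### Primes that are not fixed divisors of any specialization -/

section FixedDivisors
variable {Z : Type*} [CommRing Z] [IsDomain Z] {k n : ℕ}

/-- For a primitive polynomial there is a nonzero `δ` in all ideals that contain the coefficients of
some specialization in the first parameter: over `Q[T₁]` the coefficients generate the unit ideal. -/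
lemma exists_ne_zero_mem_span_coeff {P : PolyTY Z (k + 1) n} (hP : PrimOverQT P) :
    ∃ δ : Z, δ ≠ 0 ∧ ∀ (t : Z) (I : Ideal Z),
      (∀ d, (flatten Z k n (specFirst t P)).coeff d ∈ I) → δ ∈ I := by
  let Q := FractionRing Z
  set J : Ideal (Polynomial Z) := Ideal.span (Set.range fun d => (isolateFirst Z k n P).coeff d)
    with hJ
  have htop : J.map (Polynomial.mapRingHom (algebraMap Z Q)) = ⊤ := by
    obtain ⟨g, hg⟩ := (IsPrincipalIdealRing.principal
      (J.map (Polynomial.mapRingHom (algebraMap Z Q)))).principal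
    rw [Ideal.submodule_span_eq] at hg
    have h1 : C g ∣ isolateFirst Q k n (overQ P) := by
      rw [C_dvd_iff_dvd_coeff]
      intro d
      rw [overQ, isolateFirst_map, coeff_map, ← Ideal.mem_span_singleton, ← hg]
      exact Ideal.mem_map_of_mem _ (Ideal.subset_span ⟨d, rfl⟩)
    have h2 : isolateFirst Q k n (C ((splitFirst Q k).symm (C g))) = C g := by
      rw [isolateFirst_C, AlgEquiv.apply_symm_apply, flatten_C_C]
    have h3 : C ((splitFirst Q k).symm (C g)) ∣ overQ P := by
      rw [← h2] at h1
      have := map_dvd (isolateFirst Q k n).symm h1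
      rwa [RingEquiv.symm_apply_apply, RingEquiv.symm_apply_apply] at this
    have h4 := ((primOverQT_iff P).mp hP _ h3).map (splitFirst Q k)
    rw [AlgEquiv.apply_symm_apply] at h4
    rw [hg, Ideal.span_singleton_eq_top]
    simpa using h4.map constantCoeff
  obtain ⟨m, hm, a, ha, h⟩ := exists_mem_map_eq_C_mul (nonZeroDivisors Z) (A := Q) (I := J) (g := 1)
    (by rw [htop]; trivial)
  rw [mul_one, ← Polynomial.map_C] at h
  rw [Polynomial.map_injective _ (IsFractionRing.injective Z Q) h] at ha
  refine ⟨m, nonZeroDivisors.ne_zero hm, fun t I hI => ?_⟩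
  have h5 : J ≤ I.comap (Polynomial.evalRingHom t) := by
    rw [hJ, Ideal.span_le]
    rintro _ ⟨d, rfl⟩
    have := hI d
    rw [flatten_specFirst, coeff_map] at this
    exact this
  simpa using h5 ha

omit [IsDomain Z] in
/-- All coefficients of the specializations in the first parameter have bounded degree. -/
lemma exists_totalDegree_coeff_specFirst_le (P : PolyTY Z (k + 1) n) :
    ∃ D : ℕ, ∀ t d, ((specFirst t P).coeff d).totalDegree ≤ D := by
  refine ⟨P.support.sup fun d => (splitFirst Z k (P.coeff d)).totalDegree, fun t d => ?_⟩
  rw [coeff_specFirst]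
  by_cases hd : d ∈ P.support
  · refine le_trans (Finset.sup_mono (support_map_subset _ _)) ?_
    exact Finset.le_sup (f := fun d => (splitFirst Z k (P.coeff d)).totalDegree) hd
  · rw [notMem_support_iff.mp hd]
    simp

/-- No prime ideal that avoids a certain nonzero `δ` is a fixed divisor of a specialization in the first
parameter of a product of primitive polynomials: such a prime neither contains all coefficients of a
specialization, nor a difference of two elements of `G`, where `G ^ k` is a grid that is large enough to
detect nonzero polynomials. -/
lemma exists_ne_zero_not_isZeroMod [Infinite Z] {s : ℕ} {P : Fin s → PolyTY Z (k + 1) n}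
    (hP : ∀ i, PrimOverQT (P i)) :
    ∃ δ : Z, δ ≠ 0 ∧ ∀ (t : Z) (p : Ideal Z), p.IsPrime → δ ∉ p →
      ∃ u : Fin k → Z, ¬ IsZeroMod p (spec (Fin.cons t u : Fin (k + 1) → Z) (∏ i, P i)) := by
  classical
  choose δ hδ0 hδ using fun i => exists_ne_zero_mem_span_coeff (hP i)
  obtain ⟨D, hD⟩ := exists_totalDegree_coeff_specFirst_le (∏ i, P i)
  obtain ⟨G, hG⟩ := Infinite.exists_subset_card_eq Z (D + 1)
  refine ⟨(∏ i, δ i) * ∏ x ∈ G.offDiag, (x.1 - x.2), mul_ne_zero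
    (Finset.prod_ne_zero_iff.mpr fun i _ => hδ0 i) (Finset.prod_ne_zero_iff.mpr fun x hx =>
      sub_ne_zero.mpr (Finset.mem_offDiag.mp hx).2.2), fun t p hp hδp => ?_⟩
  set q := Ideal.Quotient.mk p
  have h1 : ∀ i, δ i ∉ p := fun i hi =>
    hδp (p.mul_mem_right _ (p.mem_of_dvd (Finset.dvd_prod_of_mem δ (Finset.mem_univ i)) hi))
  have h2 : Set.InjOn q G := by
    intro x hx y hy hxy
    by_contra hne
    refine hδp (p.mul_mem_left _ (p.mem_of_dvd (Finset.dvd_prod_of_mem (fun x => x.1 - x.2)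
      (Finset.mem_offDiag.mpr ⟨hx, hy, hne⟩ : (x, y) ∈ G.offDiag)) ?_))
    exact Ideal.Quotient.eq.mp hxy
  have h3 : map (map q) (specFirst t (∏ i, P i)) ≠ 0 := by
    rw [specFirst_prod, map_prod, Finset.prod_ne_zero_iff]
    intro i _ h0
    refine h1 i (hδ i t p fun d => ?_)
    have h4 := flatten_map q (specFirst t (P i))
    rw [h0, map_zero] at h4
    rw [← Ideal.Quotient.eq_zero_iff_mem, ← coeff_map, ← h4, coeff_zero]
  obtain ⟨d, hd⟩ := ne_zero_iff.mp h3
  rw [coeff_map] at hd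
  have h6 : ∀ i, (map q ((specFirst t (∏ i, P i)).coeff d)).degreeOf i < (G.image q).card := by
    intro i
    rw [Finset.card_image_of_injOn h2, hG, Nat.lt_succ_iff]
    exact ((degreeOf_map_le q _ i).trans (degreeOf_le_totalDegree _ i)).trans (hD t d)
  by_contra! hcon
  refine hd (eq_zero_of_eval_zero_at_prod_finset _ (fun _ => G.image q) h6 fun x hx => ?_)
  choose u hu hux using fun i => Finset.mem_image.mp (hx i)
  have h7 := hcon u d
  rw [← spec_specFirst, spec, coeff_map, ← Ideal.Quotient.eq_zero_iff_mem] at h7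
  obtain rfl : (fun i => q (u i)) = x := funext hux
  rw [← h7, eval_map]
  exact (eval₂_comp_left q (RingHom.id Z) u _).symm

end FixedDivisors

/-! ### Schinzel rings -/

section Schinzel
variable {Z : Type*} [CommRing Z] {k n : ℕ}

/-- The coefficients of `P(t, Y)` modulo an ideal depend on `t` modulo this ideal only. -/
lemma coeff_spec_sub_mem {I : Ideal Z} {t t' : Fin k → Z} (h : ∀ i, t i - t' i ∈ I)
    (P : PolyTY Z k n) (d : Fin n →₀ ℕ) : (spec t P).coeff d - (spec t' P).coeff d ∈ I := by
  have key : ∀ u : Fin k → Z, Ideal.Quotient.mk I (eval u (P.coeff d)) =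
      eval₂ (Ideal.Quotient.mk I) (fun i => Ideal.Quotient.mk I (u i)) (P.coeff d) := fun u =>
    eval₂_comp_left (Ideal.Quotient.mk I) (RingHom.id Z) u _
  rw [spec, spec, coeff_map, coeff_map, ← Ideal.Quotient.eq, key, key]
  congr 1
  exact funext fun i => Ideal.Quotient.eq.mpr (h i)

lemma isZeroMod_spec_congr {I : Ideal Z} {t t' : Fin k → Z} (h : ∀ i, t i - t' i ∈ I)
    (P : PolyTY Z k n) : IsZeroMod I (spec t P) ↔ IsZeroMod I (spec t' P) :=
  forall_congr' fun d => by
    rw [← Submodule.Quotient.mk_eq_zero, ← Submodule.Quotient.mk_eq_zero I,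
      (Submodule.Quotient.eq I).mpr (coeff_spec_sub_mem h P d)]

variable [IsDomain Z]

/-- Since primitivity is preserved by almost all specializations, only fixed divisors matter for the
Schinzel property. -/
lemma isSchinzelRing_of_forall_noFixDiv {PT : Set (Ideal Z)}
    (h : ∀ (_ : Infinite Z) (k n s : ℕ) (P : Fin s → PolyTY Z (k + 1) n), (∀ i, PrimOverQT (P i)) →
      NoFixDiv PT P → ∃ ω α : Z, ω ≠ 0 ∧
        ∀ l, NoFixDiv PT (fun i => specFirst (ω * l + α) (P i))) :
    IsSchinzelRing Z PT := by
  intro k n s _ _ P hP hfix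
  rcases finite_or_infinite Z with hZ | hZ
  · exact ⟨1, 0, one_ne_zero, Set.toFinite _⟩
  obtain ⟨ω, α, hω, hgood⟩ := h hZ k n s P hP hfix
  refine ⟨ω, α, hω, (Set.finite_iUnion fun i => finite_not_primOverQT_specFirst (hP i)).subset ?_⟩
  rintro _ ⟨⟨l, rfl⟩, hbad⟩
  by_contra hprim
  simp only [Set.mem_iUnion, Set.mem_ofPred_eq, not_exists, not_not] at hprim
  exact hbad ⟨hprim, hgood l⟩

omit [IsDomain Z] in
lemma cons_sub_mem (a : Fin (k + 1) → Z) {I : Ideal Z} {t : Z} (ht : t - a 0 ∈ I) :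
    ∀ i, (Fin.cons t (Fin.tail a) : Fin (k + 1) → Z) i - a i ∈ I := by
  intro i
  refine Fin.cases ?_ (fun j => ?_) i
  · simpa using ht
  · simp [Fin.tail]

section Dedekind

omit [IsDomain Z] in
lemma le_of_forall_pow_le [IsDedekindDomain Z] {I F : Ideal Z} (hI : I ≠ ⊥)
    (h : ∀ (v : IsDedekindDomain.HeightOneSpectrum Z) (m : ℕ), I ≤ v.asIdeal ^ m →
      F ≤ v.asIdeal ^ m) : F ≤ I := by
  rw [← Ideal.dvd_iff_le, UniqueFactorizationMonoid.dvd_iff_emultiplicity_le hI]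
  intro p hp
  rw [emultiplicity_le_emultiplicity_iff]
  intro m hm
  exact Ideal.dvd_iff_le.mpr
    (h ⟨p, Ideal.isPrime_of_prime hp, hp.ne_zero⟩ m (Ideal.dvd_iff_le.mp hm))

/-- For each of the finitely many primes outside of which specializations have no fixed divisor, the
arithmetic progression preserves the largest power of the prime that is a fixed divisor. -/
theorem isSchinzelRing_of_isDedekindDomain (_ : IsDedekindDomain Z) (PT : Set (Ideal Z)) :
    IsSchinzelRing Z PT := by
  refine isSchinzelRing_of_forall_noFixDiv fun _ k n s P hP hfix => ?_
  classical
  obtain ⟨δ, hδ0, hδ⟩ := exists_ne_zero_not_isZeroMod hP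
  set R := ∏ i, P i with hR
  have hfin : {v : IsDedekindDomain.HeightOneSpectrum Z | v.asIdeal ∣ Ideal.span {δ}}.Finite :=
    Ideal.finite_factors (by simpa using hδ0)
  have hmem : ∀ v : IsDedekindDomain.HeightOneSpectrum Z, v ∈ hfin.toFinset ↔ δ ∈ v.asIdeal := by
    intro v
    rw [Set.Finite.mem_toFinset, Set.mem_ofPred_eq, Ideal.dvd_span_singleton]
  -- the ideal of all values, whose divisors are the fixed divisors
  set F : Ideal Z := ⨆ t, Ideal.span (Set.range fun d => (spec t R).coeff d) with hF
  have hFle : ∀ I, F ≤ I ↔ ∀ t, IsZeroMod I (spec t R) := by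
    intro I
    rw [hF, iSup_le_iff]
    refine forall_congr' fun t => ?_
    rw [Ideal.span_le, Set.range_subset_iff]
    rfl
  have hF0 : F ≠ ⊥ := by
    intro h0
    obtain ⟨u, hu⟩ := hδ 0 ⊥ Ideal.isPrime_bot (by simpa using hδ0)
    exact hu ((hFle ⊥).mp h0.le _)
  have hex : ∀ v : IsDedekindDomain.HeightOneSpectrum Z, ∃ m, ¬ F ≤ v.asIdeal ^ m := by
    intro v
    by_contra! h
    refine hF0 (le_bot_iff.mp ?_)
    rw [← Ideal.iInf_pow_eq_bot_of_isDomain _ v.isPrime.ne_top]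
    exact le_iInf h
  choose a ha using fun v => not_forall.mp ((hFle _).not.mp (Nat.find_spec (hex v)))
  obtain ⟨α, hα⟩ := IsDedekindDomain.exists_forall_sub_mem_ideal (s := hfin.toFinset)
    (fun v => v.asIdeal) (fun v => Nat.find (hex v)) (fun v _ => v.prime)
    (fun v _ w _ hvw h => hvw (IsDedekindDomain.HeightOneSpectrum.ext h)) (fun v => a v 0)
  refine ⟨δ ^ hfin.toFinset.sup fun v => Nat.find (hex v), α, pow_ne_zero _ hδ0,
    fun l I hI ⟨hI1, hI2⟩ => ?_⟩
  set t := δ ^ (hfin.toFinset.sup fun v => Nat.find (hex v)) * l + α with ht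
  have hzero : ∀ u : Fin k → Z, IsZeroMod I (spec (Fin.cons t u : Fin (k + 1) → Z) R) := by
    intro u
    have := hI2 u
    rwa [← specFirst_prod, spec_specFirst] at this
  have hIbot : I ≠ ⊥ := by
    rintro rfl
    obtain ⟨u, hu⟩ := hδ t ⊥ Ideal.isPrime_bot (by simpa using hδ0)
    exact hu (hzero u)
  refine hfix I hI ⟨hI1, (hFle I).mp (le_of_forall_pow_le hIbot fun v m hm => ?_)⟩
  by_cases hv : δ ∈ v.asIdeal
  · -- the exponent of `v` does not exceed the one in the original fixed divisor
    by_contra hcon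
    have h1 : I ≤ v.asIdeal ^ Nat.find (hex v) :=
      hm.trans (Ideal.pow_le_pow_right (Nat.find_min' (hex v) hcon))
    refine ha v ((isZeroMod_spec_congr (cons_sub_mem (a v) (t := t) ?_) R).mp
      fun d => h1 (hzero _ d))
    rw [ht, add_sub_assoc]
    refine Ideal.add_mem _ (Ideal.mul_mem_right _ _ ?_) (hα v ((hmem v).mpr hv))
    exact Ideal.pow_le_pow_right
      (Finset.le_sup (f := fun v => Nat.find (hex v)) ((hmem v).mpr hv)) (Ideal.pow_mem_pow hv _)
  · rcases Nat.eq_zero_or_pos m with rfl | hm0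
    · rw [pow_zero, Ideal.one_eq_top]
      exact le_top
    · obtain ⟨u, hu⟩ := hδ t v.asIdeal v.isPrime hv
      exact absurd (fun d => (hm.trans (Ideal.pow_le_self hm0.ne')) (hzero u d)) hu

end Dedekind

section HalfNearUFD

omit [IsDomain Z] in
/-- A polynomial nonzero modulo a prime `p` at some point is nonzero at a point that is arbitrarily
prescribed modulo an element `e` outside `p`. -/
lemma exists_not_isZeroMod_add_mul {p : Ideal Z} (hp : p.IsPrime) {R : PolyTY Z k n}
    {t : Fin k → Z} (ht : ¬ IsZeroMod p (spec t R)) (a : Fin k → Z) {e : Z} (he : e ∉ p) :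
    ∃ x : Fin k → Z, ¬ IsZeroMod p (spec (fun i => a i + e * x i) R) := by
  set q := Ideal.Quotient.mk p with hq
  have he0 : q e ≠ 0 := Ideal.Quotient.eq_zero_iff_mem.not.mpr he
  have hinj : ∀ i, Function.Injective fun y => q (a i) + q e * y := fun i y z hyz => by
    simpa [he0] using hyz
  rcases finite_or_infinite (Z ⧸ p) with hfin | hinf
  · -- all points are prescribed by their residues
    choose y hy using fun i => (Finite.injective_iff_surjective.mp (hinj i)) (q (t i))
    choose x hx using fun i => Ideal.Quotient.mk_surjective (y i)
    refine ⟨x, (isZeroMod_spec_congr (fun i => ?_) R).not.mpr ht⟩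
    rw [← Ideal.Quotient.eq, map_add, map_mul, hx i]
    exact hy i
  · by_contra! hcon
    refine ht fun d => ?_
    have key : ∀ u : Fin k → Z, q (eval u (R.coeff d)) =
        eval (fun i => q (u i)) (map q (R.coeff d)) := fun u => by
      rw [eval_map]
      exact eval₂_comp_left q (RingHom.id Z) u _
    have h0 : map q (R.coeff d) = 0 := by
      refine funext_set (fun i => Set.range fun y => q (a i) + q e * y)
        (fun i => Set.infinite_range_of_injective (hinj i)) fun z hz => ?_
      choose y hy using fun i => hz i (Set.mem_univ i)
      choose x hx using fun i => Ideal.Quotient.mk_surjective (y i)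
      have h1 := hcon x d
      rw [spec, coeff_map, ← Ideal.Quotient.eq_zero_iff_mem, key] at h1
      rw [map_zero, ← h1]
      congr 2
      ext i
      rw [← hy i, ← hx i, map_add, map_mul]
    rw [spec, coeff_map, ← Ideal.Quotient.eq_zero_iff_mem, key, h0, map_zero]

omit [IsDomain Z] in
/-- If none of finitely many incomparable primes is a fixed divisor, then there is a point that shows
this for all of them simultaneously. -/
lemma exists_forall_not_isZeroMod (S : Finset (Ideal Z)) (hS : ∀ I ∈ S, I.IsPrime)
    (hanti : ∀ I ∈ S, ∀ J ∈ S, I ≤ J → I = J) (R : PolyTY Z k n)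
    (hR : ∀ I ∈ S, ∃ t, ¬ IsZeroMod I (spec t R)) :
    ∃ t, ∀ I ∈ S, ¬ IsZeroMod I (spec t R) := by
  classical
  induction S using Finset.induction_on with
  | empty => exact ⟨0, by simp⟩
  | insert I S hIS ih =>
    obtain ⟨a, ha⟩ := ih (fun J hJ => hS J (Finset.mem_insert_of_mem hJ))
      (fun J hJ J' hJ' => hanti J (Finset.mem_insert_of_mem hJ) J' (Finset.mem_insert_of_mem hJ'))
      (fun J hJ => hR J (Finset.mem_insert_of_mem hJ))
    have hI := hS I (Finset.mem_insert_self I S)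
    obtain ⟨e, he, heI⟩ : ∃ e ∈ S.inf id, e ∉ I := by
      by_contra! hle
      obtain ⟨J, hJ, hJI⟩ := (Ideal.IsPrime.inf_le' hI).mp hle
      exact hIS (hanti J (Finset.mem_insert_of_mem hJ) I (Finset.mem_insert_self I S) hJI ▸ hJ)
    obtain ⟨t, ht⟩ := hR I (Finset.mem_insert_self I S)
    obtain ⟨x, hx⟩ := exists_not_isZeroMod_add_mul hI ht a heI
    refine ⟨fun i => a i + e * x i, fun J hJ => ?_⟩
    rcases Finset.mem_insert.mp hJ with rfl | hJ
    · exact hx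
    · refine (isZeroMod_spec_congr (fun i => ?_) R).not.mpr (ha J hJ)
      rw [add_sub_cancel_left]
      exact J.mul_mem_right _ ((Finset.inf_le hJ : S.inf id ≤ J) he)

/-- The prime divisors of `δ` are the only candidates for new fixed divisors, and they are excluded by the
class of `t₁` modulo `δ`. -/
theorem IsHalfNearUFD.isSchinzelRing (hZ : IsHalfNearUFD Z) {PT : Set (Ideal Z)}
    (hprime : primeType Z ⊆ PT) (hle : ∀ I ∈ PT, ∃ J ∈ primeType Z, I ≤ J) :
    IsSchinzelRing Z PT := by
  refine isSchinzelRing_of_forall_noFixDiv fun _ k n s P hP hfix => ?_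
  obtain ⟨δ, hδ0, hδ⟩ := exists_ne_zero_not_isZeroMod hP
  set R := ∏ i, P i with hR
  have hfin := hZ.finite_prime_divisors δ hδ0
  have hspan : ∀ {p : Z}, Prime p → (Ideal.span {p}).IsPrime := fun hp =>
    (Ideal.span_singleton_prime hp.ne_zero).mpr hp
  obtain ⟨a, ha⟩ := exists_forall_not_isZeroMod (k := k + 1) hfin.toFinset (fun I hI => by
      obtain ⟨p, hp, -, rfl⟩ := hfin.mem_toFinset.mp hI
      exact hspan hp) (fun I hI J hJ hIJ => by
      obtain ⟨p, hp, -, rfl⟩ := hfin.mem_toFinset.mp hI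
      obtain ⟨p', hp', -, rfl⟩ := hfin.mem_toFinset.mp hJ
      rw [Ideal.span_singleton_le_span_singleton, hp'.dvd_prime_iff_associated hp] at hIJ
      exact Ideal.span_singleton_eq_span_singleton.mpr hIJ.symm) R (fun I hI => by
      obtain ⟨p, hp, -, rfl⟩ := hfin.mem_toFinset.mp hI
      by_contra! h
      exact hfix _ (hprime ⟨p, hp, rfl⟩) ⟨(hspan hp).ne_top, h⟩)
  refine ⟨δ, a 0, hδ0, fun l I hI ⟨hI1, hI2⟩ => ?_⟩
  obtain ⟨_, ⟨p, hp, rfl⟩, hIJ⟩ := hle I hI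
  have hzero : ∀ u : Fin k → Z, IsZeroMod (Ideal.span {p})
      (spec (Fin.cons (δ * l + a 0) u : Fin (k + 1) → Z) R) := by
    intro u
    have := hI2 u
    rw [← specFirst_prod, spec_specFirst] at this
    exact fun d => hIJ (this d)
  by_cases hv : δ ∈ Ideal.span {p}
  · refine ha _ (hfin.mem_toFinset.mpr ⟨p, hp, Ideal.mem_span_singleton.mp hv, rfl⟩)
      ((isZeroMod_spec_congr (cons_sub_mem a ?_) R).mp (hzero _))
    rw [add_sub_cancel_right]
    exact Ideal.mul_mem_right _ _ hv
  · obtain ⟨u, hu⟩ := hδ (δ * l + a 0) _ (hspan hp) hv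
    exact hu (hzero u)

lemma primeType_subset_irredType : primeType Z ⊆ irredType Z := by
  rintro I ⟨p, hp, rfl⟩
  exact ⟨p, hp.irreducible, rfl⟩

lemma IsNearUFD.exists_primeType_le (hZ : IsNearUFD Z) {I : Ideal Z} (hI : I ∈ nonunitType Z) :
    ∃ J ∈ primeType Z, I ≤ J := by
  obtain ⟨a, ha0, ha, rfl⟩ := hI
  obtain ⟨p, hp, hpa⟩ := hZ.exists_prime_divisor a ha0 ha
  exact ⟨_, ⟨p, hp, rfl⟩, Ideal.span_singleton_le_span_singleton.mpr hpa⟩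

theorem IsNearUFD.isSchinzelRing (hZ : IsNearUFD Z) {PT : Set (Ideal Z)}
    (hprime : primeType Z ⊆ PT) (hPT : PT ⊆ nonunitType Z) : IsSchinzelRing Z PT :=
  hZ.toIsHalfNearUFD.isSchinzelRing hprime fun _ hI => hZ.exists_primeType_le (hPT hI)

end HalfNearUFD

/-- The rings and primality types for which the Schinzel property holds. -/
theorem isSchinzelRing_of_isDedekindDomain_or_isNearUFD (Z : Type*) [CommRing Z] [IsDomain Z] :
    (IsDedekindDomain Z →
      IsSchinzelRing Z (specType Z) ∧ IsSchinzelRing Z (irredType Z) ∧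
      IsSchinzelRing Z (primeType Z) ∧ IsSchinzelRing Z (nonunitType Z)) ∧
    (IsNearUFD Z →
      IsSchinzelRing Z (irredType Z) ∧ IsSchinzelRing Z (primeType Z) ∧
      IsSchinzelRing Z (nonunitType Z)) ∧
    (IsHalfNearUFD Z → IsSchinzelRing Z (primeType Z)) := by
  have h1 := primeType_subset_irredType (Z := Z)
  have h2 := irredType_subset_nonunitType Z
  refine ⟨fun h => ⟨?_, ?_, ?_, ?_⟩, fun h => ⟨?_, ?_, ?_⟩, fun h => ?_⟩
  · exact isSchinzelRing_of_isDedekindDomain h _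
  · exact isSchinzelRing_of_isDedekindDomain h _
  · exact isSchinzelRing_of_isDedekindDomain h _
  · exact isSchinzelRing_of_isDedekindDomain h _
  · exact h.isSchinzelRing h1 h2
  · exact h.isSchinzelRing subset_rfl (h1.trans h2)
  · exact h.isSchinzelRing (h1.trans h2) subset_rfl
  · exact h.isSchinzelRing subset_rfl fun I hI => ⟨I, hI, le_rfl⟩

end Schinzel

end SchinzelRing

theorem theorem2p6 :
    -- (a) Schinzel rings: the affirmative answers
    (∀ (Z : Type*) [CommRing Z] [IsDomain Z],
      (IsDedekindDomain Z →
        IsSchinzelRing Z (specType Z) ∧ IsSchinzelRing Z (irredType Z) ∧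
        IsSchinzelRing Z (primeType Z) ∧ IsSchinzelRing Z (nonunitType Z)) ∧
      (IsNearUFD Z →
        IsSchinzelRing Z (irredType Z) ∧ IsSchinzelRing Z (primeType Z) ∧
        IsSchinzelRing Z (nonunitType Z)) ∧
      (IsHalfNearUFD Z → IsSchinzelRing Z (primeType Z))) ∧
    -- (a) Schinzel rings: the negative answers for half near UFDs
    (IsHalfNearUFD (Zsqrtd 5) ∧
      ¬ IsSchinzelRing (Zsqrtd 5) (irredType (Zsqrtd 5)) ∧
      ¬ IsSchinzelRing (Zsqrtd 5) (nonunitType (Zsqrtd 5))) ∧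
    -- (b) integrally Hilbertian rings: the affirmative answers
    (∀ (Z : Type*) [CommRing Z] [IsDomain Z],
      IsHilbertianRing Z → IsCharZeroOrImperfect Z →
      (IsDedekindDomain Z →
        IsIntegrallyHilbertian Z (specType Z) ∧ IsIntegrallyHilbertian Z (irredType Z) ∧
        IsIntegrallyHilbertian Z (primeType Z) ∧ IsIntegrallyHilbertian Z (nonunitType Z)) ∧
      (IsNearUFD Z →
        IsIntegrallyHilbertian Z (irredType Z) ∧ IsIntegrallyHilbertian Z (primeType Z) ∧
        IsIntegrallyHilbertian Z (nonunitType Z)) ∧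
      (IsHalfNearUFD Z → IsIntegrallyHilbertian Z (primeType Z))) ∧
    -- (b) integrally Hilbertian rings: the negative answers for half near UFDs
    (IsHilbertianRing (Zsqrtd 5) ∧ IsCharZeroOrImperfect (Zsqrtd 5) ∧
      IsHalfNearUFD (Zsqrtd 5) ∧
      ¬ IsIntegrallyHilbertian (Zsqrtd 5) (irredType (Zsqrtd 5)) ∧
      ¬ IsIntegrallyHilbertian (Zsqrtd 5) (nonunitType (Zsqrtd 5))) := by
  have h5 := isHalfNearUFD_zsqrtd_five
  refine ⟨isSchinzelRing_of_isDedekindDomain_or_isNearUFD,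
    ⟨h5, not_isSchinzelRing_zsqrtd_five subset_rfl (irredType_subset_nonunitType _),
    not_isSchinzelRing_zsqrtd_five (irredType_subset_nonunitType _) subset_rfl⟩,
    fun Z _ _ hZ _ => ?_, isHilbertianRing_zsqrtd_five, Or.inl inferInstance, h5,
    not_isIntegrallyHilbertian_zsqrtd_five subset_rfl (irredType_subset_nonunitType _),
    not_isIntegrallyHilbertian_zsqrtd_five (irredType_subset_nonunitType _) subset_rfl⟩
  have h1 := primeType_subset_irredType (Z := Z)
  have h2 := irredType_subset_nonunitType Z
  have h3 : ∀ I ∈ nonunitType Z, I ≠ ⊤ := fun _ => ne_top_of_mem_nonunitType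
  have hspec := isIntegrallyHilbertian_of_isSchinzelRing (PT := specType Z)
    (fun _ hI => Ideal.IsPrime.ne_top hI) hZ
  have hirred := isIntegrallyHilbertian_of_isSchinzelRing (PT := irredType Z)
    (fun _ hI => h3 _ (h2 hI)) hZ
  have hprime := isIntegrallyHilbertian_of_isSchinzelRing (PT := primeType Z)
    (fun _ hI => h3 _ (h2 (h1 hI))) hZ
  have hnonunit := isIntegrallyHilbertian_of_isSchinzelRing (PT := nonunitType Z) h3 hZ
  obtain ⟨hD, hN, hH⟩ := isSchinzelRing_of_isDedekindDomain_or_isNearUFD Z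
  refine ⟨fun h => ?_, fun h => ?_, fun h => hprime (hH h)⟩
  · obtain ⟨a, b, c, d⟩ := hD h
    exact ⟨hspec a, hirred b, hprime c, hnonunit d⟩
  · obtain ⟨b, c, d⟩ := hN h
    exact ⟨hirred b, hprime c, hnonunit d⟩
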